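/- Let $\theta\in\mathcal D(\mathbb R)$ (smooth, compactly supported, real-valued) be an even probability density, let $T>0$ and $\zeta\in C^2([0,T])$, and for $t\in[0,T]$, $x\in\mathbb R$ set $$F(t,x)=\frac{1}{1+\theta(x-\zeta(t))},\qquad G(t,x)=-\frac{\dot\zeta(t)\,\theta'(x-\zeta(t))}{1+\theta(x-\zeta(t))}.$$ All functions are real-valued, $\|w\|_{H^k(\mathbb R)}=\bigl(\sum_{j=0}^k\|\partial_x^jw\|_{L^2(\mathbb R)}^2\bigr)^{1/2}$, and $$E_0(T)=C^0([0,T];H^4(\mathbb R))\cap C^1([0,T];H^2(\mathbb R))\cap C^2([0,T];L^2(\mathbb R)).$$ Then there is a constant $C_T>0$, depending only on $T$, $\theta$ and $\zeta$, such that for all $u_0\in H^4(\mathbb R)$, $u_1\in H^2(\mathbb R)$ and $g\in C^0([0,T];H^2(\mathbb R))$ there exists a unique $u\in E_0(T)$ with $$u_{tt}+F\,u_{xxxx}+G\,u_t=g\ \text{ on }[0,T]\times\mathbb R,\qquad u(0,\cdot)=u_0,\quad u_t(0,\cdot)=u_1$$ (the equation being understood in $L^2(\mathbb R)$ for every $t\in[0,T]$),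 and this $u$ satisfies, for every $t\in[0,T]$, $$\|u(t,\cdot)\|_{H^2(\mathbb R)}+\|u_t(t,\cdot)\|_{L^2(\mathbb R)}\le C_T\bigl(\|u_0\|_{H^2(\mathbb R)}+\|u_1\|_{L^2(\mathbb R)}+\|g\|_{L^2(0,t;L^2(\mathbb R))}\bigr).$$ -/

import Mathlib

open MeasureTheory Set
open scoped ContDiff

noncomputable section

namespace BeamEq

/-- The real Hilbert space `L²(ℝ)` (Lebesgue measure, real-valued functions). -/
abbrev L2 : Type := Lp ℝ 2 (volume : Measure ℝ)

/-- `φ ∈ 𝒟(ℝ)`: a smooth, compactly supported real function on the line. -/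
def IsTestFunction (φ : ℝ → ℝ) : Prop :=
  ContDiff ℝ ∞ φ ∧ HasCompactSupport φ

/-- `g` is the weak (distributional) derivative of `f`. -/
def HasWeakDeriv (f g : L2) : Prop :=
  ∀ φ : ℝ → ℝ, IsTestFunction φ → ∫ x, f x * deriv φ x = - ∫ x, g x * φ x

theorem IsTestFunction.memLp {φ : ℝ → ℝ} (hφ : IsTestFunction φ) : MemLp φ 2 volume :=
  hφ.1.continuous.memLp_of_hasCompactSupport hφ.2

theorem IsTestFunction.deriv {φ : ℝ → ℝ} (hφ : IsTestFunction φ) :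
    IsTestFunction (deriv φ) :=
  ⟨(contDiff_infty_iff_deriv.1 hφ.1).2, hφ.2.deriv⟩

theorem integrable_mul_test (f : L2) {φ : ℝ → ℝ} (hφ : IsTestFunction φ) :
    Integrable (fun x => f x * φ x) volume :=
  (Lp.memLp f).integrable_mul hφ.memLp

theorem integral_add_mul (f f' : L2) {φ : ℝ → ℝ} (hφ : IsTestFunction φ) :
    ∫ x, (f + f') x * φ x = (∫ x, f x * φ x) + ∫ x, f' x * φ x := by
  rw [← integral_add (integrable_mul_test f hφ) (integrable_mul_test f' hφ)]
  refine integral_congr_ae ?_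
  filter_upwards [Lp.coeFn_add f f'] with x hx
  rw [hx, Pi.add_apply, add_mul]

theorem integral_smul_mul (c : ℝ) (f : L2) (φ : ℝ → ℝ) :
    ∫ x, (c • f) x * φ x = c * ∫ x, f x * φ x := by
  rw [← integral_const_mul]
  refine integral_congr_ae ?_
  filter_upwards [Lp.coeFn_smul c f] with x hx
  rw [hx, Pi.smul_apply, smul_eq_mul, mul_assoc]

theorem integral_zero_mul (φ : ℝ → ℝ) : ∫ x, (0 : L2) x * φ x = 0 := by
  have h := integral_smul_mul 0 (0 : L2) φ
  rwa [zero_smul, zero_mul] at h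

/-- The Sobolev space `Hᵏ(ℝ)`. An element is a function `u ∈ L²(ℝ)` together with its (unique)
weak derivatives `∂u, …, ∂ᵏu ∈ L²(ℝ)`; it is stored as the tuple `(u, ∂u, …, ∂ᵏu)`, and its norm,
inherited from the `ℓ²` product, is `(∑_{j ≤ k} ‖∂ʲu‖²_{L²})^{1/2}`. -/
def H (k : ℕ) : Submodule ℝ (PiLp 2 (fun _ : Fin (k + 1) => L2)) where
  carrier := {U | ∀ j : Fin k, HasWeakDeriv (U j.castSucc) (U j.succ)}
  add_mem' := by
    intro U V hU hV j φ hφ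
    rw [PiLp.add_apply, PiLp.add_apply, integral_add_mul _ _ hφ.deriv, integral_add_mul _ _ hφ,
      hU j φ hφ, hV j φ hφ]
    ring
  zero_mem' := by
    intro j φ hφ
    rw [PiLp.zero_apply, PiLp.zero_apply, integral_zero_mul, integral_zero_mul, neg_zero]
  smul_mem' := by
    intro c U hU j φ hφ
    rw [PiLp.smul_apply, PiLp.smul_apply, integral_smul_mul, integral_smul_mul, hU j φ hφ]
    ring

/-- The weak derivative `∂ʲu ∈ L²(ℝ)` of `u ∈ Hᵏ(ℝ)`, `j ≤ k`. -/
def wderiv {k : ℕ} (j : Fin (k + 1)) (u : H k) : L2 := u.1 j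

/-- The inclusion `Hᵏ(ℝ) ⊆ L²(ℝ)`. -/
def toL2 {k : ℕ} (u : H k) : L2 := wderiv 0 u

/-- The inclusion `Hᵐ(ℝ) ⊆ Hᵏ(ℝ)` for `k ≤ m`. -/
def incl {k m : ℕ} (h : k ≤ m) (u : H m) : H k :=
  ⟨WithLp.toLp 2 fun j => u.1 (Fin.castLE (Nat.succ_le_succ h) j),
    fun j => u.2 (Fin.castLE h j)⟩

theorem HasWeakDeriv.unique {f g g' : L2} (h : HasWeakDeriv f g) (h' : HasWeakDeriv f g') :
    g = g' := by
  have hz : ∀ᵐ x : ℝ, (g - g') x = 0 := by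
    refine ae_eq_zero_of_integral_contDiff_smul_eq_zero
      ((Lp.memLp (g - g')).locallyIntegrable (by norm_num)) ?_
    intro φ hφ hc
    have e : ∫ x, g x * φ x = ∫ x, g' x * φ x :=
      neg_injective ((h φ ⟨hφ, hc⟩).symm.trans (h' φ ⟨hφ, hc⟩))
    have e2 := integral_add_mul (g - g') g' (φ := φ) ⟨hφ, hc⟩
    rw [sub_add_cancel, e] at e2
    simp only [smul_eq_mul, mul_comm (φ _)]
    linarith
  refine sub_eq_zero.1 (Lp.ext ?_)
  filter_upwards [hz, Lp.coeFn_zero ℝ 2 (volume : Measure ℝ)] with x hx h0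
  rw [hx, h0, Pi.zero_apply]

/-- An element of `Hᵏ(ℝ)` is determined by its underlying function, so `Hᵏ(ℝ)` is indeed
identified with the space of functions in `L²(ℝ)` that have `k` weak derivatives in `L²(ℝ)`. -/
theorem toL2_injective {k : ℕ} : Function.Injective (toL2 (k := k)) := by
  intro u v h
  refine Subtype.ext (PiLp.ext fun j => ?_)
  induction j using Fin.induction with
  | zero => simpa [toL2, wderiv] using h
  | succ j ih => exact (u.2 j).unique (ih ▸ v.2 j)

/-- `E₂(T) = C⁰([0,T]; H²(ℝ))`. Curves are functions on `ℝ`; only their values on `[0,T]` matter. -/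
def E2 (T : ℝ) : Set (ℝ → H 2) := {g | ContinuousOn g (Icc 0 T)}

/-- `E₀(T) = C⁰([0,T]; H⁴(ℝ)) ∩ C¹([0,T]; H²(ℝ)) ∩ C²([0,T]; L²(ℝ))`. Curves are functions on `ℝ`;
only their values on `[0,T]` matter. -/
def E0 (T : ℝ) : Set (ℝ → H 4) :=
  {u | ContinuousOn u (Icc 0 T) ∧
    ContDiffOn ℝ 1 (fun t => incl (by norm_num : 2 ≤ 4) (u t)) (Icc 0 T) ∧
    ContDiffOn ℝ 2 (fun t => toL2 (u t)) (Icc 0 T)}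

/-- `u_t(t) ∈ L²(ℝ)`, the time derivative on `[0,T]` (one-sided at the end points). -/
def dt (T : ℝ) (u : ℝ → H 4) (t : ℝ) : L2 :=
  derivWithin (fun s => toL2 (u s)) (Icc 0 T) t

/-- `u_tt(t) ∈ L²(ℝ)`, the second time derivative on `[0,T]`. -/
def dtt (T : ℝ) (u : ℝ → H 4) (t : ℝ) : L2 :=
  derivWithin (dt T u) (Icc 0 T) t

/-- `F(t,x) = 1 / (1 + θ(x - ζ(t)))`. -/
def F (θ ζ : ℝ → ℝ) (t x : ℝ) : ℝ := 1 / (1 + θ (x - ζ t))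

/-- `G(t,x) = - ζ'(t) θ'(x - ζ(t)) / (1 + θ(x - ζ(t)))`, for `t ∈ [0,T]`. -/
def G (T : ℝ) (θ ζ : ℝ → ℝ) (t x : ℝ) : ℝ :=
  -(derivWithin ζ (Icc 0 T) t * deriv θ (x - ζ t)) / (1 + θ (x - ζ t))

/-- `u ∈ E₀(T)` solves `u_tt + F u_xxxx + G u_t = g` on `[0,T] × ℝ`, with `u(0) = u₀` and
`u_t(0) = u₁`. -/
structure IsSolution (T : ℝ) (θ ζ : ℝ → ℝ) (u₀ : H 4) (u₁ : H 2) (g : ℝ → H 2)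
    (u : ℝ → H 4) : Prop where
  mem : u ∈ E0 T
  eqn : ∀ t ∈ Icc 0 T, ∀ᵐ x : ℝ,
    dtt T u t x + F θ ζ t x * wderiv 4 (u t) x + G T θ ζ t x * dt T u t x = toL2 (g t) x
  init : u 0 = u₀
  init_dt : dt T u 0 = toL2 u₁

/-- The norm of `g` in `L²(0,t; L²(ℝ))`. -/
def normL2L2 (t : ℝ) (g : ℝ → H 2) : ℝ := Real.sqrt (∫ s in (0 : ℝ)..t, ‖toL2 (g s)‖ ^ 2)

end BeamEq

end

open Filter Topology InnerProductSpace

/-! Put `S = -∂²`, `v = u_t`, `q = S u`, `b = F`, `m = -G`. The equation becomes `v' = m v - b S q +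
g`, `q' = S v`. The decisive relation between the coefficients is `b' = m b`: the variable `p = b⁻¹
v` absorbs the damping, leaving `q' = S (b p)`, `p' = -S q + b⁻¹ g`. Since `S` is symmetric, the
unbounded terms cancel in the derivative of `⟪p, b p⟫ + ‖q‖²`, and Gronwall closes the estimate
(`energy_estimate`). For strong solutions this gives both uniqueness and the bound
(`IsStrong.estimate`); the missing first derivative is recovered from `‖y'‖² = -⟪y'', y⟫`.

For existence, `S` is replaced by its bounded Yosida approximations `A ε = S (1 + ε S)⁻¹`, which
gives linear ODEs. For data in the domain of `S`, the images of the solutions under `A ε` are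
bounded uniformly in `ε`, and two approximations differ in squared norm by `O(ε + δ)`; smoothing the
data by resolvents extends convergence to all continuous data (`IsApprox.cauchy`).

These limits need not lie in the domain of `S`. To gain regularity, note that `s = S v` and `r = -S
q` solve a system of the same type, whose source contains `S (m v)`. The commutator `[S, m]` has
order one, so this equals `m s + K (v + s)` with `K` bounded. The resulting closed system for `(v,
s, r)` is solved by a Volterra iteration (`exists_limit_system`). The triples `(v, A v, -A q)` of
the approximations converge to it, and closedness of the graph of `S` identifies `s` and `r`
(`exists_strong_solution`).

For the beam, `S` acts on `L²` with domain `H²`. Density of test functions in `H¹` gives its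
symmetry, Lax-Milgram gives its resolvent, and `beamData` checks the coefficient identities. Finally
`-∂²u = q` with `q` in `H²` places `u` in `H⁴`. -/

/-! ### Gronwall inequalities on `[0,T]`. -/

theorem hasDerivWithinAt_integral_Icc {E : Type*} [NormedAddCommGroup E] [NormedSpace ℝ E]
    [CompleteSpace E] {T : ℝ} {φ : ℝ → E} (hφ : ContinuousOn φ (Icc 0 T)) {t : ℝ}
    (ht : t ∈ Icc 0 T) :
    HasDerivWithinAt (fun t => ∫ s in (0 : ℝ)..t, φ s) (φ t) (Icc 0 T) t := by
  have : Fact (t ∈ Icc 0 T) := ⟨ht⟩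
  refine intervalIntegral.integral_hasDerivWithinAt_right (s := Icc 0 T) (t := Icc 0 T) ?_
    ?_ (hφ t ht)
  · exact (hφ.mono (by rw [uIcc_of_le ht.1]; exact Icc_subset_Icc_right ht.2)).intervalIntegrable
  · exact hφ.stronglyMeasurableAtFilter_nhdsWithin measurableSet_Icc t

/-- Differential form of Gronwall's inequality. -/
theorem gronwall_integral {T k : ℝ} (hk : 0 ≤ k) {E E' φ : ℝ → ℝ} (hφ : ContinuousOn φ (Icc 0 T))
    (hφ0 : ∀ t ∈ Icc 0 T, 0 ≤ φ t)
    (hE : ∀ t ∈ Icc 0 T, HasDerivWithinAt E (E' t) (Icc 0 T) t)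
    (hE' : ∀ t ∈ Icc 0 T, E' t ≤ k * E t + φ t) :
    ∀ t ∈ Icc 0 T, E t ≤ Real.exp (k * t) * (E 0 + ∫ s in (0 : ℝ)..t, φ s) := by
  intro t ht
  have hT : 0 ≤ T := ht.1.trans ht.2
  have hd : ∀ t ∈ Icc 0 T, HasDerivWithinAt
      (fun t => Real.exp (-(k * t)) * E t - ∫ s in (0 : ℝ)..t, φ s)
      (Real.exp (-(k * t)) * (-k) * E t + Real.exp (-(k * t)) * E' t - φ t) (Icc 0 T) t := by
    intro t ht
    have h1 : HasDerivAt (fun t : ℝ => Real.exp (-(k * t))) (Real.exp (-(k * t)) * (-k)) t := by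
      have : HasDerivAt (fun t : ℝ => -(k * t)) (-k) t := by
        simpa using ((hasDerivAt_id t).const_mul k).fun_neg
      exact this.exp
    exact (h1.hasDerivWithinAt.mul (hE t ht)).sub (hasDerivWithinAt_integral_Icc hφ ht)
  -- Integrating factor: after multiplication by `exp (-k t)` the source is still at most `φ`,
  -- because `φ ≥ 0` and `k t ≥ 0`.
  have hanti : AntitoneOn (fun t => Real.exp (-(k * t)) * E t - ∫ s in (0 : ℝ)..t, φ s)
      (Icc 0 T) := by
    refine antitoneOn_of_hasDerivWithinAt_nonpos (convex_Icc 0 T)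
      (fun t ht => (hd t ht).continuousWithinAt)
      (fun t ht => (hd t (interior_subset ht)).mono interior_subset) ?_
    intro t ht
    have ht := interior_subset ht
    have h1 : Real.exp (-(k * t)) ≤ 1 := Real.exp_le_one_iff.2 (by nlinarith [ht.1])
    have h2 := mul_le_mul_of_nonneg_left (hE' t ht) (Real.exp_pos (-(k * t))).le
    nlinarith [mul_le_mul_of_nonneg_right h1 (hφ0 t ht)]
  have h := hanti (left_mem_Icc.2 hT) ht ht.1
  simp only [mul_zero, neg_zero, Real.exp_zero, one_mul, intervalIntegral.integral_same,
    sub_zero] at h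
  have h2 : Real.exp (-(k * t)) * E t ≤ E 0 + ∫ s in (0 : ℝ)..t, φ s := by linarith
  calc E t = Real.exp (k * t) * (Real.exp (-(k * t)) * E t) := by
        rw [← mul_assoc, ← Real.exp_add]; simp
    _ ≤ _ := by gcongr

/-- Integral form of Gronwall's inequality. -/
theorem le_of_le_add_integral {T A K : ℝ} (hA : 0 ≤ A) (hK : 0 ≤ K) {w : ℝ → ℝ}
    (hw : ContinuousOn w (Icc 0 T))
    (h : ∀ t ∈ Icc 0 T, w t ≤ A + K * ∫ s in (0 : ℝ)..t, w s) :
    ∀ t ∈ Icc 0 T, w t ≤ A * (1 + K * (Real.exp (K * T) * T)) := by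
  intro t ht
  -- The differential form is applied to the primitive of `w`, whose derivative is `w ≤ K ∫ w + A`.
  have h1 := gronwall_integral hK (φ := fun _ => A) continuousOn_const (fun _ _ => hA)
    (fun t ht => hasDerivWithinAt_integral_Icc hw ht) (fun t ht => by linarith [h t ht]) t ht
  simp only [intervalIntegral.integral_same, zero_add, intervalIntegral.integral_const, sub_zero,
    smul_eq_mul] at h1
  have h2 : Real.exp (K * t) * (t * A) ≤ Real.exp (K * T) * (T * A) := by
    have := ht.1
    have := ht.2
    have := ht.1.trans ht.2
    gcongr
  calc w t ≤ A + K * (Real.exp (K * T) * (T * A)) := by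
        refine (h t ht).trans ?_
        gcongr
        exact h1.trans h2
    _ = _ := by ring

/-- With `I` the primitive of `h`, `(I²)' = 2 I h ≤ I² + h²`, so Gronwall replaces Cauchy-Schwarz at
the price of the constant `exp T`. -/
theorem sq_integral_le {T : ℝ} {h : ℝ → ℝ} (hh : ContinuousOn h (Icc 0 T)) :
    ∀ t ∈ Icc 0 T, (∫ s in (0 : ℝ)..t, h s) ^ 2 ≤ Real.exp T * ∫ s in (0 : ℝ)..t, h s ^ 2 := by
  intro t ht
  have h1 := gronwall_integral zero_le_one (φ := fun s => h s ^ 2) (hh.pow 2)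
    (fun _ _ => sq_nonneg _) (fun t ht => (hasDerivWithinAt_integral_Icc hh ht).pow 2)
    (fun t ht => by
      simp only [Pi.pow_apply, Nat.cast_ofNat, Nat.add_one_sub_one, pow_one, one_mul]
      nlinarith [sq_nonneg ((∫ s in (0 : ℝ)..t, h s) - h t)]) t ht
  have h0 : 0 ≤ ∫ s in (0 : ℝ)..t, h s ^ 2 :=
    intervalIntegral.integral_nonneg ht.1 fun _ _ => sq_nonneg _
  simp only [Pi.pow_apply, intervalIntegral.integral_same, one_mul] at h1
  calc _ ≤ _ := h1
    _ ≤ _ := by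
      have := ht.2
      norm_num
      gcongr

/-! ### Volterra fixed points and linear ODEs. -/

section Volterra

variable {E : Type*} [NormedAddCommGroup E] {T : ℝ}

/-- The extension of a path on `[0,T]` to the line, constant on both sides. -/
noncomputable def pathExt (hT : 0 ≤ T) (z : C(Icc 0 T, E)) (t : ℝ) : E := z (projIcc 0 T hT t)

theorem continuous_pathExt (hT : 0 ≤ T) (z : C(Icc 0 T, E)) : Continuous (pathExt hT z) :=
  z.continuous.comp continuous_projIcc

theorem pathExt_of_mem (hT : 0 ≤ T) (z : C(Icc 0 T, E)) {t : ℝ} (ht : t ∈ Icc 0 T) :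
    pathExt hT z t = z ⟨t, ht⟩ := by
  rw [pathExt, projIcc_of_mem hT ht]

/-- Iterating the causal bound gains a factor `(K t)ⁿ / n!` on squared distances, so some iterate is
a contraction whatever the size of `K T`. -/
theorem volterra_fixedPoint [CompleteSpace E] (hT : 0 ≤ T) {K : ℝ} (hK : 0 ≤ K)
    (Ψ : C(Icc 0 T, E) → C(Icc 0 T, E))
    (hΨ : ∀ z w : C(Icc 0 T, E), ∀ t ∈ Icc 0 T, ‖pathExt hT (Ψ z) t - pathExt hT (Ψ w) t‖ ^ 2 ≤
      K * ∫ s in (0 : ℝ)..t, ‖pathExt hT z s - pathExt hT w s‖ ^ 2) :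
    ∃ z, Ψ z = z := by
  have key : ∀ (n : ℕ) (z w : C(Icc 0 T, E)), ∀ t ∈ Icc 0 T,
      ‖pathExt hT (Ψ^[n] z) t - pathExt hT (Ψ^[n] w) t‖ ^ 2 ≤
        (K * t) ^ n / n.factorial * dist z w ^ 2 := by
    intro n z w
    induction n with
    | zero =>
      intro t ht
      simp only [Function.iterate_zero, id_eq, pow_zero, Nat.factorial_zero, Nat.cast_one, div_one,
        one_mul]
      gcongr
      rw [← dist_eq_norm]
      exact ContinuousMap.dist_apply_le_dist _
    | succ n ih =>
      intro t ht
      rw [Function.iterate_succ_apply', Function.iterate_succ_apply']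
      refine (hΨ _ _ t ht).trans ?_
      have h1 : ∫ s in (0 : ℝ)..t, ‖pathExt hT (Ψ^[n] z) s - pathExt hT (Ψ^[n] w) s‖ ^ 2 ≤
          ∫ s in (0 : ℝ)..t, (K * s) ^ n / n.factorial * dist z w ^ 2 := by
        refine intervalIntegral.integral_mono_on ht.1 ?_ ?_ fun s hs =>
          ih s ⟨hs.1, hs.2.trans ht.2⟩
        · exact (((continuous_pathExt hT _).sub (continuous_pathExt hT _)).norm.pow
            2).intervalIntegrable _ _
        · exact Continuous.intervalIntegrable (by fun_prop) _ _
      have h2 : ∫ s in (0 : ℝ)..t, (K * s) ^ n / n.factorial * dist z w ^ 2 =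
          K ^ n * t ^ (n + 1) / (n + 1).factorial * dist z w ^ 2 := by
        have : ∀ s : ℝ, (K * s) ^ n / n.factorial * dist z w ^ 2 =
          (K ^ n / n.factorial * dist z w ^ 2) * s ^ n := fun s => by ring
        simp only [this, intervalIntegral.integral_const_mul, integral_pow]
        have : (n.factorial : ℝ) ≠ 0 := by positivity
        have h3 : ((n : ℝ) + 1) ≠ 0 := by positivity
        rw [Nat.factorial_succ]
        push_cast
        field_simp
        simp
      calc _ ≤ _ := mul_le_mul_of_nonneg_left (h1.trans_eq h2) hK
        _ = _ := by ring
  -- The threshold `1/4` is for squared distances, hence the Lipschitz constant `1/2`.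
  obtain ⟨n, hn⟩ := ((FloorSemiring.tendsto_pow_div_factorial_atTop (K * T)).eventually
    (gt_mem_nhds (show (0 : ℝ) < 1 / 4 by norm_num))).exists
  have hlip : LipschitzWith (1 / 2) (Ψ^[n]) := by
    refine LipschitzWith.of_dist_le_mul fun z w => ?_
    rw [ContinuousMap.dist_le (by positivity)]
    intro x
    have h1 := key n z w x x.2
    rw [pathExt_of_mem hT _ x.2, pathExt_of_mem hT _ x.2, ← dist_eq_norm] at h1
    refine le_of_sq_le_sq ?_ (by positivity)
    refine h1.trans ?_
    have h2 : (K * x) ^ n / n.factorial ≤ (K * T) ^ n / n.factorial := by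
      have := x.2.1
      have := x.2.2
      gcongr
    have h3 : ((1 / 2 : NNReal) : ℝ) = 1 / 2 := by norm_num
    rw [h3]
    nlinarith [sq_nonneg (dist z w)]
  have hc : ContractingWith (1 / 2) (Ψ^[n]) := ⟨by
    rw [← NNReal.coe_lt_coe]; norm_num, hlip⟩
  have : Nonempty C(Icc 0 T, E) := ⟨0⟩
  exact ⟨_, hc.isFixedPt_fixedPoint_iterate⟩

theorem exists_linear_ode [NormedSpace ℝ E] [CompleteSpace E] (hT : 0 ≤ T) {M : ℝ → E →L[ℝ] E}
    (hM : Continuous M) {f : ℝ → E} (hf : Continuous f) (z₀ : E) :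
    ∃ z : ℝ → E, Continuous z ∧ z 0 = z₀ ∧
      ∀ t ∈ Icc 0 T, HasDerivAt z (M t (z t) + f t) t := by
  have hcont : ∀ z : C(Icc 0 T, E), Continuous fun s => M s (pathExt hT z s) + f s := fun z =>
    (hM.clm_apply (continuous_pathExt hT z)).add hf
  have hder : ∀ (z : C(Icc 0 T, E)) (t : ℝ), HasDerivAt
      (fun t => z₀ + ∫ s in (0 : ℝ)..t, (M s (pathExt hT z s) + f s))
      (M t (pathExt hT z t) + f t) t := fun z t =>
    ((hcont z).integral_hasStrictDerivAt 0 t).hasDerivAt.const_add z₀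
  let Ψ : C(Icc 0 T, E) → C(Icc 0 T, E) := fun z =>
    ⟨fun t => z₀ + ∫ s in (0 : ℝ)..t, (M s (pathExt hT z s) + f s),
      (continuous_iff_continuousAt.2 fun t => (hder z t).continuousAt).comp continuous_subtype_val⟩
  obtain ⟨B, hB⟩ := isCompact_Icc.exists_bound_of_continuousOn (hM.continuousOn (s := Icc 0 T))
  have hB0 : 0 ≤ B := (norm_nonneg _).trans (hB 0 (left_mem_Icc.2 hT))
  obtain ⟨z, hz⟩ := volterra_fixedPoint hT (K := Real.exp T * B ^ 2) (by positivity) Ψ (by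
    intro z w t ht
    rw [pathExt_of_mem hT _ ht, pathExt_of_mem hT _ ht]
    have e : Ψ z ⟨t, ht⟩ - Ψ w ⟨t, ht⟩ =
        ∫ s in (0 : ℝ)..t, M s (pathExt hT z s - pathExt hT w s) := by
      change (z₀ + ∫ s in (0 : ℝ)..t, (M s (pathExt hT z s) + f s)) -
        (z₀ + ∫ s in (0 : ℝ)..t, (M s (pathExt hT w s) + f s)) = _
      rw [add_sub_add_left_eq_sub, ← intervalIntegral.integral_sub
        ((hcont z).intervalIntegrable _ _) ((hcont w).intervalIntegrable _ _)]
      simp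
    have hcd : Continuous fun s => ‖pathExt hT z s - pathExt hT w s‖ :=
      ((continuous_pathExt hT z).sub (continuous_pathExt hT w)).norm
    have h1 : ‖Ψ z ⟨t, ht⟩ - Ψ w ⟨t, ht⟩‖ ≤
        ∫ s in (0 : ℝ)..t, B * ‖pathExt hT z s - pathExt hT w s‖ := by
      rw [e]
      refine intervalIntegral.norm_integral_le_of_norm_le ht.1 ?_
        ((hcd.const_mul B).intervalIntegrable _ _)
      filter_upwards with s hs
      exact ((M s).le_opNorm _).trans
        (mul_le_mul_of_nonneg_right (hB s ⟨hs.1.le, hs.2.trans ht.2⟩) (norm_nonneg _))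
    calc _ ≤ (∫ s in (0 : ℝ)..t, B * ‖pathExt hT z s - pathExt hT w s‖) ^ 2 := by gcongr
      _ ≤ Real.exp T * ∫ s in (0 : ℝ)..t, (B * ‖pathExt hT z s - pathExt hT w s‖) ^ 2 :=
        sq_integral_le (hcd.const_mul B).continuousOn t ht
      _ = _ := by
        simp only [mul_pow, intervalIntegral.integral_const_mul]
        ring)
  -- The integral formula, rather than the constant extension of `z`, is the witness: it is
  -- differentiable from both sides at `0` and `T`, and agrees with `z` on `[0,T]`.
  refine ⟨fun t => z₀ + ∫ s in (0 : ℝ)..t, (M s (pathExt hT z s) + f s),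
    continuous_iff_continuousAt.2 fun t => (hder z t).continuousAt, by simp, fun t ht => ?_⟩
  have h := hder z t
  have e : pathExt hT z t = z₀ + ∫ s in (0 : ℝ)..t, (M s (pathExt hT z s) + f s) := by
    rw [pathExt_of_mem hT _ ht]
    conv_lhs => rw [← hz]
    rfl
  convert h using 1
  rw [e]

end Volterra

/-! ### The abstract evolution equation. -/

/-- Data of an abstract second order evolution equation `v' = m v - b S q + g`, `q' = S v`: a
symmetric nonnegative operator `S` with domain `Y` embedded in `X` by `ι`, its resolvents
`ρ ε = (1 + ε S)⁻¹`, and time dependent bounded coefficients with `b' = m b`, `a = b⁻¹`. The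
commutator `[S, m] = C` has lower order. -/
structure EvolutionData (X Y : Type*) [NormedAddCommGroup X] [InnerProductSpace ℝ X]
    [NormedAddCommGroup Y] [NormedSpace ℝ Y] where
  ι : Y →L[ℝ] X
  S : Y →L[ℝ] X
  ρ : ℝ → X →L[ℝ] Y
  symm : ∀ x y, ⟪S x, ι y⟫_ℝ = ⟪ι x, S y⟫_ℝ
  nonneg : ∀ x, 0 ≤ ⟪S x, ι x⟫_ℝ
  dense : DenseRange ι
  res_right : ∀ ε, 0 < ε → ∀ x, ι (ρ ε x) + ε • S (ρ ε x) = x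
  res_left : ∀ ε, 0 < ε → ∀ y, ρ ε (ι y + ε • S y) = y
  a : ℝ → X →L[ℝ] X
  b : ℝ → X →L[ℝ] X
  m : ℝ → X →L[ℝ] X
  C : ℝ → Y →L[ℝ] X
  m_cont : Continuous m
  C_cont : Continuous C
  a_deriv : ∀ t, HasDerivAt a (-(a t ∘L m t)) t
  b_deriv : ∀ t, HasDerivAt b (m t ∘L b t) t
  a_b : ∀ t x, a t (b t x) = x
  b_a : ∀ t x, b t (a t x) = x
  b_symm : ∀ t x y, ⟪b t x, y⟫_ℝ = ⟪x, b t y⟫_ℝ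
  c : ℝ
  c_pos : 0 < c
  b_coercive : ∀ t x, c * ‖x‖ ^ 2 ≤ ⟪x, b t x⟫_ℝ
  comm : ∀ t y, ∃ y', ι y' = m t (ι y) ∧ S y' = m t (S y) + C t y

/-! ### Resolvent and Yosida calculus. -/

namespace EvolutionData

variable {X Y : Type*} [NormedAddCommGroup X] [InnerProductSpace ℝ X]
  [NormedAddCommGroup Y] [NormedSpace ℝ Y] (D : EvolutionData X Y)

/-- The resolvent `(1 + ε S)⁻¹` as an operator on `X`. -/
def R (ε : ℝ) : X →L[ℝ] X := D.ι ∘L D.ρ ε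

/-- The Yosida approximation `S (1 + ε S)⁻¹`. -/
def A (ε : ℝ) : X →L[ℝ] X := D.S ∘L D.ρ ε

/-- The commutator `[S, m]` as a bounded operator on `X`. -/
def K (t : ℝ) : X →L[ℝ] X := D.C t ∘L D.ρ 1

theorem a_cont : Continuous D.a :=
  continuous_iff_continuousAt.2 fun t => (D.a_deriv t).continuousAt

theorem b_cont : Continuous D.b :=
  continuous_iff_continuousAt.2 fun t => (D.b_deriv t).continuousAt

theorem K_cont : Continuous D.K := D.C_cont.clm_comp continuous_const

variable {D} {ε δ : ℝ}

theorem R_add_A (hε : 0 < ε) (x : X) : D.R ε x + ε • D.A ε x = x := D.res_right ε hε x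

theorem inner_R_A (x y : X) : ⟪D.R ε x, D.A δ y⟫_ℝ = ⟪D.A ε x, D.R δ y⟫_ℝ := (D.symm _ _).symm

/-- Split the argument on the other side as `R + ε A`: the `R` parts agree by symmetry of `S`, and
the `ε` parts are literally equal. -/
theorem A_symm (hε : 0 < ε) (x y : X) : ⟪D.A ε x, y⟫_ℝ = ⟪x, D.A ε y⟫_ℝ := by
  conv_lhs => rw [← R_add_A (D := D) hε y]
  conv_rhs => rw [← R_add_A (D := D) hε x]
  rw [inner_add_left, inner_add_right, inner_R_A, real_inner_smul_left, real_inner_smul_right]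

theorem norm_sq_eq (hε : 0 < ε) (x : X) :
    ‖x‖ ^ 2 = ‖D.R ε x‖ ^ 2 + 2 * ε * ⟪D.A ε x, D.R ε x⟫_ℝ + ‖ε • D.A ε x‖ ^ 2 := by
  conv_lhs => rw [← R_add_A (D := D) hε x]
  rw [norm_add_sq_real, real_inner_smul_right, real_inner_comm]
  ring

theorem norm_R_le (hε : 0 < ε) (x : X) : ‖D.R ε x‖ ≤ ‖x‖ := by
  refine le_of_sq_le_sq ?_ (norm_nonneg _)
  rw [norm_sq_eq (D := D) hε x]
  have := D.nonneg (D.ρ ε x)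
  have h : 0 ≤ 2 * ε * ⟪D.A ε x, D.R ε x⟫_ℝ := mul_nonneg (by linarith) this
  nlinarith [sq_nonneg ‖ε • D.A ε x‖]

theorem A_ι (hε : 0 < ε) (y : Y) : D.A ε (D.ι y) = D.R ε (D.S y) := by
  have h : D.ρ ε (D.ι y) = y - ε • D.ρ ε (D.S y) := by
    have := D.res_left ε hε y
    rw [map_add, map_smul] at this
    exact eq_sub_of_add_eq this
  have h2 := D.res_right ε hε (D.S y)
  change D.S (D.ρ ε (D.ι y)) = D.ι (D.ρ ε (D.S y))
  rw [h, map_sub, map_smul]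
  exact (eq_sub_of_add_eq h2).symm

/-- With `y = ρ ε v`, the commutator hypothesis gives `m v = (ι y' + ε S y') - ε C y`, and `A ε`
sends the bracket to `S y' = m S y + C y`. What remains is `C y - ε A (C y) = R (C y)`, where `C y =
K (ι y + S y)`. Every operator in the error is thus bounded independently of `ε`. -/
theorem A_m (hε : 0 < ε) (t : ℝ) (v : X) :
    D.A ε (D.m t v) = D.m t (D.A ε v) + D.R ε (D.K t (D.R ε v + D.A ε v)) := by
  set y := D.ρ ε v with hy
  have hR : D.R ε v = D.ι y := rfl
  have hA : D.A ε v = D.S y := rfl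
  have hv : v = D.ι y + ε • D.S y := (D.res_right ε hε v).symm
  have h1 : D.K t (D.ι y + D.S y) = D.C t y := by
    have := D.res_left 1 one_pos y
    rw [one_smul] at this
    change D.C t (D.ρ 1 (D.ι y + D.S y)) = _
    rw [this]
  obtain ⟨y', h2, h3⟩ := D.comm t y
  rw [hR, hA, h1]
  have h4 : D.m t v = (D.ι y' + ε • D.S y') - ε • D.C t y := by
    rw [hv, map_add, map_smul, h2, h3]
    module
  have h5 : D.A ε (D.ι y' + ε • D.S y') = D.S y' := by
    change D.S (D.ρ ε _) = _
    rw [D.res_left ε hε]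
  rw [h4, map_sub, map_smul, h5, h3]
  have h6 := R_add_A (D := D) hε (D.C t y)
  rw [add_sub_assoc, ← eq_sub_of_add_eq h6]

/-- The sequence of regularization parameters. -/
noncomputable def eps (n : ℕ) : ℝ := 1 / ((n : ℝ) + 1)

theorem eps_pos (n : ℕ) : 0 < eps n := by unfold eps; positivity

theorem tendsto_eps : Tendsto eps atTop (𝓝 0) := tendsto_one_div_add_atTop_nhds_zero_nat

/-- On the range of `ι` the error is `-ε R (S y)`. The `R ε` are contractions and the range is
dense, so convergence extends to all of `X`. -/
theorem tendsto_R (x : X) : Tendsto (fun n => D.R (eps n) x) atTop (𝓝 x) := by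
  have hy : ∀ (n : ℕ) (y : Y), ‖D.R (eps n) (D.ι y) - D.ι y‖ ≤ eps n * ‖D.S y‖ := by
    intro n y
    have h := R_add_A (D := D) (eps_pos n) (D.ι y)
    have : D.R (eps n) (D.ι y) - D.ι y = -(eps n • D.A (eps n) (D.ι y)) := by
      nth_rewrite 2 [← h]
      abel
    rw [this, norm_neg, norm_smul, A_ι (eps_pos n), Real.norm_of_nonneg (eps_pos n).le]
    exact mul_le_mul_of_nonneg_left (norm_R_le (eps_pos n) _) (eps_pos n).le
  rw [Metric.tendsto_atTop]
  intro η hη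
  obtain ⟨_, hxy, ⟨y, rfl⟩⟩ := Metric.dense_iff.1 D.dense x (η / 4) (by positivity)
  rw [Metric.mem_ball, dist_eq_norm] at hxy
  have h0 : Tendsto (fun n => eps n * ‖D.S y‖) atTop (𝓝 0) := by
    simpa using tendsto_eps.mul_const ‖D.S y‖
  obtain ⟨N, hN⟩ := (Metric.tendsto_atTop.1 h0) (η / 4) (by positivity)
  refine ⟨N, fun n hn => ?_⟩
  have h1 := hN n hn
  rw [Real.dist_0_eq_abs, abs_of_nonneg (mul_nonneg (eps_pos n).le (norm_nonneg _))] at h1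
  rw [dist_eq_norm]
  have e : D.R (eps n) x - x =
      -(D.R (eps n) (D.ι y - x)) + (D.R (eps n) (D.ι y) - D.ι y) + (D.ι y - x) := by
    rw [map_sub]; abel
  rw [e]
  have h2 := norm_R_le (D := D) (eps_pos n) (D.ι y - x)
  have h3 := norm_add_le (-(D.R (eps n) (D.ι y - x)) + (D.R (eps n) (D.ι y) - D.ι y)) (D.ι y - x)
  have h4 := norm_add_le (-(D.R (eps n) (D.ι y - x))) (D.R (eps n) (D.ι y) - D.ι y)
  rw [norm_neg] at h4
  linarith [hy n y]

theorem tendsto_integral_R {T : ℝ} (hT : 0 ≤ T) {c : ℝ → X} (hc : Continuous c) :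
    Tendsto (fun n => ∫ s in (0 : ℝ)..T, ‖D.R (eps n) (c s) - c s‖ ^ 2) atTop (𝓝 0) := by
  obtain ⟨B, hB⟩ := isCompact_Icc.exists_bound_of_continuousOn (hc.continuousOn (s := Icc 0 T))
  have : Tendsto (fun n => ∫ s in (0 : ℝ)..T, ‖D.R (eps n) (c s) - c s‖ ^ 2) atTop
      (𝓝 (∫ s in (0 : ℝ)..T, (0 : ℝ))) := by
    refine intervalIntegral.tendsto_integral_filter_of_dominated_convergence
      (fun _ => (2 * B) ^ 2) ?_ ?_ (by simp) ?_
    · exact .of_forall fun n => Continuous.aestronglyMeasurable (by fun_prop)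
    · refine .of_forall fun n => .of_forall fun s hs => ?_
      rw [uIoc_of_le hT] at hs
      have h1 := hB s ⟨hs.1.le, hs.2⟩
      have h2 := norm_R_le (D := D) (eps_pos n) (c s)
      rw [Real.norm_of_nonneg (by positivity)]
      gcongr
      linarith [norm_sub_le (D.R (eps n) (c s)) (c s)]
    · refine .of_forall fun s _ => ?_
      have := ((tendsto_R (D := D) (c s)).sub_const (c s)).norm.pow 2
      simpa using this
  simpa using this

/-! ### Energy estimates and the approximate problems. -/

theorem exists_bound (D : EvolutionData X Y) (T : ℝ) :
    ∃ B, 0 ≤ B ∧ ∀ t ∈ Icc 0 T, ‖D.a t‖ ≤ B ∧ ‖D.b t‖ ≤ B ∧ ‖D.m t‖ ≤ B ∧ ‖D.K t‖ ≤ B := by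
  obtain ⟨B1, h1⟩ := isCompact_Icc.exists_bound_of_continuousOn (D.a_cont.continuousOn (s := Icc 0 T))
  obtain ⟨B2, h2⟩ := isCompact_Icc.exists_bound_of_continuousOn (D.b_cont.continuousOn (s := Icc 0 T))
  obtain ⟨B3, h3⟩ := isCompact_Icc.exists_bound_of_continuousOn (D.m_cont.continuousOn (s := Icc 0 T))
  obtain ⟨B4, h4⟩ := isCompact_Icc.exists_bound_of_continuousOn (D.K_cont.continuousOn (s := Icc 0 T))
  refine ⟨|B1| + |B2| + |B3| + |B4|, by positivity, fun t ht => ?_⟩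
  have := le_abs_self B1
  have := le_abs_self B2
  have := le_abs_self B3
  have := le_abs_self B4
  have := abs_nonneg B1
  have := abs_nonneg B2
  have := abs_nonneg B3
  have := abs_nonneg B4
  refine ⟨(h1 t ht).trans ?_, (h2 t ht).trans ?_, (h3 t ht).trans ?_, (h4 t ht).trans ?_⟩ <;>
    linarith

/-- The energy is `⟪p, b p⟫ + ‖q‖²`. Since `b' = m b` and `b` is symmetric, its derivative is `⟪p, m
b p⟫` plus twice the left side of the hypothesis, and coercivity of `b` makes the energy comparable
to `‖q‖² + ‖p‖²`. The generator is left unspecified, so that the lemma serves approximations,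
differences of them and strong solutions alike. -/
theorem energy_estimate (D : EvolutionData X Y) (T : ℝ) {k : ℝ} (hk : 0 ≤ k) :
    ∃ M, 0 ≤ M ∧ ∀ (q p α γ : ℝ → X) (φ : ℝ → ℝ), ContinuousOn φ (Icc 0 T) →
      (∀ t ∈ Icc 0 T, 0 ≤ φ t) →
      (∀ t ∈ Icc 0 T, HasDerivWithinAt q (α t) (Icc 0 T) t) →
      (∀ t ∈ Icc 0 T, HasDerivWithinAt p (γ t) (Icc 0 T) t) →
      (∀ t ∈ Icc 0 T, ⟪q t, α t⟫_ℝ + ⟪D.b t (p t), γ t⟫_ℝ ≤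
        k * (‖q t‖ ^ 2 + ‖p t‖ ^ 2) + φ t) →
      ∀ t ∈ Icc 0 T, ‖q t‖ ^ 2 + ‖p t‖ ^ 2 ≤
        M * (‖q 0‖ ^ 2 + ‖p 0‖ ^ 2 + ∫ s in (0 : ℝ)..t, φ s) := by
  obtain ⟨B, hB0, hB⟩ := D.exists_bound T
  set c₁ := min D.c 1 with hc₁
  have hc₁0 : 0 < c₁ := lt_min D.c_pos one_pos
  set κ := (2 * k + B ^ 2) / c₁ with hκ
  have hκ0 : 0 ≤ κ := by positivity
  refine ⟨Real.exp (κ * |T|) * (B + 3) / c₁, by positivity, ?_⟩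
  intro q p α γ φ hφ hφ0 hq hp hle t ht
  have hT : 0 ≤ T := ht.1.trans ht.2
  set E : ℝ → ℝ := fun t => ⟪p t, D.b t (p t)⟫_ℝ + ‖q t‖ ^ 2 with hEdef
  have hlow : ∀ t, c₁ * (‖q t‖ ^ 2 + ‖p t‖ ^ 2) ≤ E t := by
    intro t
    have h1 := D.b_coercive t (p t)
    have h2 : c₁ * ‖p t‖ ^ 2 ≤ D.c * ‖p t‖ ^ 2 := by gcongr; exact min_le_left _ _
    have h3 : c₁ * ‖q t‖ ^ 2 ≤ 1 * ‖q t‖ ^ 2 := by gcongr; exact min_le_right _ _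
    simp only [hEdef]
    linarith
  have hder : ∀ t ∈ Icc 0 T, HasDerivWithinAt E
      (⟪p t, (D.m t ∘L D.b t) (p t) + D.b t (γ t)⟫_ℝ + ⟪γ t, D.b t (p t)⟫_ℝ +
        2 * ⟪q t, α t⟫_ℝ) (Icc 0 T) t := by
    intro t ht
    exact ((hp t ht).inner ℝ ((D.b_deriv t).hasDerivWithinAt.clm_apply (hp t ht))).add
      ((hq t ht).norm_sq)
  have h := gronwall_integral hκ0 (φ := fun s => 2 * φ s) (hφ.const_mul 2)
    (fun t ht => by have := hφ0 t ht; positivity) hder (fun t ht => by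
      have h1 := hle t ht
      obtain ⟨-, hb, hm, -⟩ := hB t ht
      have h2 : ⟪p t, (D.m t ∘L D.b t) (p t)⟫_ℝ ≤ B ^ 2 * ‖p t‖ ^ 2 := by
        have h3 : ‖(D.m t ∘L D.b t) (p t)‖ ≤ B * (B * ‖p t‖) :=
          (D.m t).le_of_opNorm_le_of_le hm ((D.b t).le_of_opNorm_le hb _)
        calc _ ≤ ‖p t‖ * ‖(D.m t ∘L D.b t) (p t)‖ := real_inner_le_norm _ _
          _ ≤ ‖p t‖ * (B * (B * ‖p t‖)) := by gcongr
          _ = _ := by ring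
      have h4 : κ * (c₁ * (‖q t‖ ^ 2 + ‖p t‖ ^ 2)) = (2 * k + B ^ 2) * (‖q t‖ ^ 2 + ‖p t‖ ^ 2) := by
        rw [hκ]; field_simp
      have h5 := mul_le_mul_of_nonneg_left (hlow t) hκ0
      have h6 : ⟪p t, D.b t (γ t)⟫_ℝ = ⟪D.b t (p t), γ t⟫_ℝ := (D.b_symm _ _ _).symm
      rw [inner_add_right, h6, real_inner_comm (D.b t (p t)) (γ t)]
      nlinarith [sq_nonneg ‖q t‖, sq_nonneg B, mul_nonneg (sq_nonneg B) (sq_nonneg ‖q t‖)]) t ht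
  have hE0 : E 0 ≤ (B + 1) * (‖q 0‖ ^ 2 + ‖p 0‖ ^ 2) := by
    obtain ⟨-, hb, -, -⟩ := hB 0 (left_mem_Icc.2 hT)
    have h1 : ⟪p 0, D.b 0 (p 0)⟫_ℝ ≤ ‖p 0‖ * (B * ‖p 0‖) :=
      (real_inner_le_norm _ _).trans (by gcongr; exact (D.b 0).le_of_opNorm_le hb _)
    simp only [hEdef]
    nlinarith [sq_nonneg ‖q 0‖, sq_nonneg ‖p 0‖, mul_nonneg hB0 (sq_nonneg ‖q 0‖)]
  have hI : 0 ≤ ∫ s in (0 : ℝ)..t, φ s :=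
    intervalIntegral.integral_nonneg ht.1 fun s hs => hφ0 s ⟨hs.1, hs.2.trans ht.2⟩
  have hexp : Real.exp (κ * t) ≤ Real.exp (κ * |T|) := by
    have : t ≤ |T| := ht.2.trans (le_abs_self T)
    gcongr
  rw [intervalIntegral.integral_const_mul] at h
  have hN0 : 0 ≤ ‖q 0‖ ^ 2 + ‖p 0‖ ^ 2 := by positivity
  have h7 : E 0 + 2 * ∫ s in (0 : ℝ)..t, φ s ≤
      (B + 3) * (‖q 0‖ ^ 2 + ‖p 0‖ ^ 2 + ∫ s in (0 : ℝ)..t, φ s) := by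
    nlinarith [mul_nonneg hB0 hI]
  have h8 : E t ≤ Real.exp (κ * |T|) *
      ((B + 3) * (‖q 0‖ ^ 2 + ‖p 0‖ ^ 2 + ∫ s in (0 : ℝ)..t, φ s)) :=
    h.trans ((mul_le_mul_of_nonneg_left h7 (Real.exp_pos _).le).trans
      (mul_le_mul_of_nonneg_right hexp (by positivity)))
  rw [div_mul_eq_mul_div, le_div_iff₀ hc₁0]
  linarith [hlow t]

/-- `q' = A (b p) + f₁`, `p' = -A q + f₂` on `[0,T]`. -/
def IsApprox (D : EvolutionData X Y) (T : ℝ) (A : X →L[ℝ] X) (f₁ f₂ q p : ℝ → X) : Prop :=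
  ∀ t ∈ Icc 0 T, HasDerivWithinAt q (A (D.b t (p t)) + f₁ t) (Icc 0 T) t ∧
    HasDerivWithinAt p (-A (q t) + f₂ t) (Icc 0 T) t

theorem IsApprox.sub {T : ℝ} {A : X →L[ℝ] X} {f₁ f₂ q p f₁' f₂' q' p' : ℝ → X}
    (h : IsApprox D T A f₁ f₂ q p) (h' : IsApprox D T A f₁' f₂' q' p') :
    IsApprox D T A (f₁ - f₁') (f₂ - f₂') (q - q') (p - p') := by
  intro t ht
  refine ⟨((h t ht).1.sub (h' t ht).1).congr_deriv ?_, ((h t ht).2.sub (h' t ht).2).congr_deriv ?_⟩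
  · simp only [Pi.sub_apply, map_sub]; abel
  · simp only [Pi.sub_apply, map_sub]; abel

/-- The constant does not depend on `ε`, because only the symmetry of `A ε` enters and never its
norm. -/
theorem IsApprox.stability (D : EvolutionData X Y) (T : ℝ) :
    ∃ M, 0 ≤ M ∧ ∀ (ε : ℝ) (f₁ f₂ q p : ℝ → X), 0 < ε → ContinuousOn f₁ (Icc 0 T) →
      ContinuousOn f₂ (Icc 0 T) → IsApprox D T (D.A ε) f₁ f₂ q p → ∀ t ∈ Icc 0 T,
      ‖q t‖ ^ 2 + ‖p t‖ ^ 2 ≤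
        M * (‖q 0‖ ^ 2 + ‖p 0‖ ^ 2 + ∫ s in (0 : ℝ)..t, (‖f₁ s‖ ^ 2 + ‖f₂ s‖ ^ 2)) := by
  obtain ⟨B, hB0, hB⟩ := D.exists_bound T
  obtain ⟨M, hM, h⟩ := D.energy_estimate T (k := 1 + B ^ 2) (by positivity)
  refine ⟨M, hM, fun ε f₁ f₂ q p hε hf₁ hf₂ hs => ?_⟩
  refine h q p _ _ _ ((hf₁.norm.pow 2).add (hf₂.norm.pow 2)) (fun _ _ => by positivity)
    (fun t ht => (hs t ht).1) (fun t ht => (hs t ht).2) fun t ht => ?_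
  obtain ⟨-, hb, -, -⟩ := hB t ht
  -- Here `⟪q, A (b p)⟫` and `-⟪b p, A q⟫` cancel, leaving only the sources.
  rw [inner_add_right, inner_add_right, inner_neg_right, ← A_symm hε (q t) (D.b t (p t)),
    real_inner_comm (D.A ε (q t))]
  have h1 := real_inner_le_norm (q t) (f₁ t)
  have h2 := real_inner_le_norm (D.b t (p t)) (f₂ t)
  have h3 : ‖D.b t (p t)‖ ≤ B * ‖p t‖ := (D.b t).le_of_opNorm_le hb _
  have h4 : ‖D.b t (p t)‖ * ‖f₂ t‖ ≤ B * ‖p t‖ * ‖f₂ t‖ := by gcongr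
  change _ ≤ (1 + B ^ 2) * (‖q t‖ ^ 2 + ‖p t‖ ^ 2) + (‖f₁ t‖ ^ 2 + ‖f₂ t‖ ^ 2)
  nlinarith [sq_nonneg (‖q t‖ - ‖f₁ t‖), sq_nonneg (B * ‖p t‖ - ‖f₂ t‖), sq_nonneg ‖p t‖,
    mul_nonneg (sq_nonneg B) (sq_nonneg ‖q t‖)]

theorem IsApprox.continuousOn {T : ℝ} {A : X →L[ℝ] X} {f₁ f₂ q p : ℝ → X}
    (h : IsApprox D T A f₁ f₂ q p) : ContinuousOn q (Icc 0 T) ∧ ContinuousOn p (Icc 0 T) :=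
  ⟨fun t ht => (h t ht).1.continuousWithinAt, fun t ht => (h t ht).2.continuousWithinAt⟩

theorem exists_isApprox [CompleteSpace X] (D : EvolutionData X Y) {T : ℝ} (hT : 0 ≤ T)
    (A : X →L[ℝ] X) {f₁ f₂ : ℝ → X} (hf₁ : Continuous f₁) (hf₂ : Continuous f₂) (q₀ p₀ : X) :
    ∃ q p, IsApprox D T A f₁ f₂ q p ∧ q 0 = q₀ ∧ p 0 = p₀ := by
  have hb := D.b_cont
  obtain ⟨z, -, hz0, hz⟩ := exists_linear_ode hT
    (M := fun t => ContinuousLinearMap.inl ℝ X X ∘L (A ∘L D.b t ∘L ContinuousLinearMap.snd ℝ X X) -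
      ContinuousLinearMap.inr ℝ X X ∘L (A ∘L ContinuousLinearMap.fst ℝ X X))
    (by fun_prop) (hf₁.prodMk hf₂) (q₀, p₀)
  refine ⟨fun t => (z t).1, fun t => (z t).2, fun t ht => ?_, by simp [hz0], by simp [hz0]⟩
  have h := (hz t ht).hasDerivWithinAt (s := Icc 0 T)
  have h1 := (ContinuousLinearMap.fst ℝ X X).hasFDerivAt.comp_hasDerivWithinAt t h
  have h2 := (ContinuousLinearMap.snd ℝ X X).hasFDerivAt.comp_hasDerivWithinAt t h
  exact ⟨h1.congr_deriv (by simp), h2.congr_deriv (by simp)⟩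

end EvolutionData

/-! ### Uniform bounds and the Cauchy property. -/

namespace EvolutionData

variable {X Y : Type*} [NormedAddCommGroup X] [InnerProductSpace ℝ X]
  [NormedAddCommGroup Y] [NormedSpace ℝ Y] {D : EvolutionData X Y} {ε δ T : ℝ}

theorem IsApprox.velocity {A : X →L[ℝ] X} {f₁ f₂ q p : ℝ → X} (h : IsApprox D T A f₁ f₂ q p)
    {t : ℝ} (ht : t ∈ Icc 0 T) :
    HasDerivWithinAt (fun t => D.b t (p t))
      (D.m t (D.b t (p t)) + D.b t (-A (q t)) + D.b t (f₂ t)) (Icc 0 T) t := by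
  refine ((D.b_deriv t).hasDerivWithinAt.clm_apply (h t ht).2).congr_deriv ?_
  rw [map_add, add_assoc]
  rfl

/-- For regular data the images under the generator solve a problem of the same kind. -/
theorem IsApprox.generator {f₁ f₂ q p : ℝ → X} (hε : 0 < ε) {F₁ F₂ : ℝ → Y}
    (h : IsApprox D T (D.A ε) f₁ f₂ q p)
    (h₁ : ∀ t ∈ Icc 0 T, f₁ t = D.ι (F₁ t)) (h₂ : ∀ t ∈ Icc 0 T, D.b t (f₂ t) = D.ι (F₂ t)) :
    IsApprox D T (D.A ε)
      (fun t => D.A ε (D.m t (D.b t (p t))) + D.R ε (D.S (F₂ t)))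
      (fun t => -D.R ε (D.S (F₁ t)))
      (fun t => D.A ε (D.b t (p t))) (fun t => -D.A ε (q t)) := by
  intro t ht
  constructor
  · refine ((D.A ε).hasFDerivAt.comp_hasDerivWithinAt t (h.velocity ht)).congr_deriv ?_
    rw [h₂ t ht, map_add, map_add, A_ι hε, add_comm (D.A ε (D.m t _)), add_assoc]
  · refine ((D.A ε).hasFDerivAt.comp_hasDerivWithinAt t (h t ht).1).neg.congr_deriv ?_
    rw [h₁ t ht, map_add, A_ι hε, neg_add]

/-- This makes the source of the differentiated system controllable by the unknown itself, uniformly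
in `ε`. -/
theorem norm_A_m_le {B : ℝ} (hε : 0 < ε) {t : ℝ} (hm : ‖D.m t‖ ≤ B) (hK : ‖D.K t‖ ≤ B) (v : X) :
    ‖D.A ε (D.m t v)‖ ≤ 2 * B * ‖D.A ε v‖ + B * ‖v‖ := by
  have hB : 0 ≤ B := (norm_nonneg _).trans hm
  rw [A_m hε]
  have h1 : ‖D.m t (D.A ε v)‖ ≤ B * ‖D.A ε v‖ := (D.m t).le_of_opNorm_le hm _
  have h2 : ‖D.R ε (D.K t (D.R ε v + D.A ε v))‖ ≤ B * (‖v‖ + ‖D.A ε v‖) :=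
    (norm_R_le hε _).trans ((D.K t).le_of_opNorm_le_of_le hK
      ((norm_add_le _ _).trans (by gcongr; exact norm_R_le hε _)))
  linarith [norm_add_le (D.m t (D.A ε v)) (D.R ε (D.K t (D.R ε v + D.A ε v)))]

theorem exists_sq_bound {E : Type*} [NormedAddCommGroup E] {f : ℝ → E} (hf : Continuous f) (T : ℝ) :
    ∃ G, 0 ≤ G ∧ ∀ t ∈ Icc 0 T, ‖f t‖ ≤ G := by
  obtain ⟨G, hG⟩ := isCompact_Icc.exists_bound_of_continuousOn (hf.continuousOn (s := Icc 0 T))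
  exact ⟨|G|, abs_nonneg _, fun t ht => (hG t ht).trans (le_abs_self _)⟩

theorem integral_le_of_le {f : ℝ → ℝ} {G : ℝ} (hf : ContinuousOn f (Icc 0 T)) (hG : 0 ≤ G)
    (h : ∀ t ∈ Icc 0 T, f t ≤ G) {t : ℝ} (ht : t ∈ Icc 0 T) : ∫ s in (0 : ℝ)..t, f s ≤ T * G := by
  have hsub : Icc 0 t ⊆ Icc 0 T := Icc_subset_Icc_right ht.2
  calc ∫ s in (0 : ℝ)..t, f s ≤ ∫ _ in (0 : ℝ)..t, G := by
        refine intervalIntegral.integral_mono_on ht.1 ?_ (by simp) fun s hs => h s (hsub hs)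
        exact (hf.mono (by rwa [uIcc_of_le ht.1])).intervalIntegrable
    _ = t * G := by simp
    _ ≤ T * G := by gcongr; exact ht.2

set_option maxHeartbeats 800000 in
/-- Uniform bounds for the approximate solutions with regular data. -/
theorem IsApprox.exists_bound_regular (D : EvolutionData X Y) (hT : 0 ≤ T) {f₁ f₂ : ℝ → X}
    {F₁ F₂ : ℝ → Y}
    (hf₁ : Continuous f₁) (hf₂ : Continuous f₂) (hF₁ : Continuous F₁) (hF₂ : Continuous F₂)
    (h₁ : ∀ t ∈ Icc 0 T, f₁ t = D.ι (F₁ t)) (h₂ : ∀ t ∈ Icc 0 T, D.b t (f₂ t) = D.ι (F₂ t))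
    (y₁ y₂ : Y) :
    ∃ P, 0 ≤ P ∧ ∀ (ε : ℝ) (q p : ℝ → X), 0 < ε → IsApprox D T (D.A ε) f₁ f₂ q p →
      q 0 = D.ι y₁ → D.b 0 (p 0) = D.ι y₂ → ∀ t ∈ Icc 0 T,
        ‖D.A ε (D.b t (p t))‖ ≤ P ∧ ‖D.A ε (q t)‖ ≤ P := by
  obtain ⟨B, hB0, hB⟩ := D.exists_bound T
  obtain ⟨M, hM0, hM⟩ := IsApprox.stability D T
  obtain ⟨G₁, hG₁0, hG₁⟩ := exists_sq_bound hf₁ T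
  obtain ⟨G₂, hG₂0, hG₂⟩ := exists_sq_bound hf₂ T
  obtain ⟨H₁, hH₁0, hH₁⟩ := exists_sq_bound (D.S.continuous.comp hF₁) T
  obtain ⟨H₂, hH₂0, hH₂⟩ := exists_sq_bound (D.S.continuous.comp hF₂) T
  set p₀ := D.a 0 (D.ι y₂) with hp₀
  -- `P₀` bounds `‖q‖² + ‖p‖²` by basic stability. Below, `A₀` gathers the data of the
  -- differentiated system, and `κ` is the coefficient of the integral of its unknown.
  set P₀ := M * (‖D.ι y₁‖ ^ 2 + ‖p₀‖ ^ 2 + T * (G₁ ^ 2 + G₂ ^ 2)) with hP₀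
  have hP₀0 : 0 ≤ P₀ := by positivity
  set A₀ := M * (‖D.S y₂‖ ^ 2 + ‖D.S y₁‖ ^ 2 +
    T * (3 * (B ^ 4 * P₀ + H₂ ^ 2) + H₁ ^ 2)) with hA₀
  have hA₀0 : 0 ≤ A₀ := by positivity
  set κ := M * (12 * B ^ 2) with hκ
  have hκ0 : 0 ≤ κ := by positivity
  set W := A₀ * (1 + κ * (Real.exp (κ * T) * T)) with hW
  have hW0 : 0 ≤ W := by positivity
  refine ⟨Real.sqrt W, Real.sqrt_nonneg _, fun ε q p hε hs hq0 hp0 => ?_⟩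
  have hp0' : p 0 = p₀ := by rw [hp₀, ← hp0, D.a_b]
  have hbase : ∀ t ∈ Icc 0 T, ‖q t‖ ^ 2 + ‖p t‖ ^ 2 ≤ P₀ := by
    intro t ht
    refine (hM ε f₁ f₂ q p hε hf₁.continuousOn hf₂.continuousOn hs t ht).trans ?_
    rw [hq0, hp0', hP₀]
    gcongr
    refine integral_le_of_le (Continuous.continuousOn (by fun_prop)) (by positivity) (fun t ht => ?_) ht
    gcongr
    exacts [hG₁ t ht, hG₂ t ht]
  have hg := hs.generator hε h₁ h₂
  obtain ⟨hsc, hrc⟩ := hg.continuousOn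
  have hpc : ContinuousOn p (Icc 0 T) := hs.continuousOn.2
  have hc₁ : ContinuousOn (fun t => D.A ε (D.m t (D.b t (p t))) + D.R ε (D.S (F₂ t))) (Icc 0 T) := by
    have hm := D.m_cont.continuousOn (s := Icc 0 T)
    have hb := D.b_cont.continuousOn (s := Icc 0 T)
    have hF := hF₂.continuousOn (s := Icc 0 T)
    exact ((D.A ε).continuous.comp_continuousOn (hm.clm_apply (hb.clm_apply hpc))).add
      ((D.R ε).continuous.comp_continuousOn (D.S.continuous.comp_continuousOn hF))
  have hc₂ : ContinuousOn (fun t => -D.R ε (D.S (F₁ t))) (Icc 0 T) :=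
    Continuous.continuousOn (by fun_prop)
  set w : ℝ → ℝ := fun t => ‖D.A ε (D.b t (p t))‖ ^ 2 + ‖-D.A ε (q t)‖ ^ 2 with hw
  have hwc : ContinuousOn w (Icc 0 T) := (hsc.norm.pow 2).add (hrc.norm.pow 2)
  -- Stability applied to the system satisfied by the images under `A ε`: its source is bounded by
  -- these images and by known quantities, which gives a Gronwall inequality for `w`.
  have hmain : ∀ t ∈ Icc 0 T, w t ≤ A₀ + κ * ∫ s in (0 : ℝ)..t, w s := by
    intro t ht
    have hsub : Icc 0 t ⊆ Icc 0 T := Icc_subset_Icc_right ht.2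
    refine (hM ε _ _ _ _ hε hc₁ hc₂ hg t ht).trans ?_
    have i1 : ‖D.A ε (D.b 0 (p 0))‖ ≤ ‖D.S y₂‖ := by
      rw [hp0, A_ι hε]; exact norm_R_le hε _
    have i2 : ‖-D.A ε (q 0)‖ ≤ ‖D.S y₁‖ := by
      rw [norm_neg, hq0, A_ι hε]; exact norm_R_le hε _
    have hi : ∫ s in (0 : ℝ)..t, (‖D.A ε (D.m s (D.b s (p s))) + D.R ε (D.S (F₂ s))‖ ^ 2 +
        ‖-D.R ε (D.S (F₁ s))‖ ^ 2) ≤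
        ∫ s in (0 : ℝ)..t, ((3 * (B ^ 4 * P₀ + H₂ ^ 2) + H₁ ^ 2) + 12 * B ^ 2 * w s) := by
      refine intervalIntegral.integral_mono_on ht.1 ?_ ?_ fun s hs' => ?_
      · exact (((hc₁.norm.pow 2).add (hc₂.norm.pow 2)).mono
          (by rwa [uIcc_of_le ht.1])).intervalIntegrable
      · exact ((continuousOn_const.add (hwc.const_mul _)).mono
          (by rwa [uIcc_of_le ht.1])).intervalIntegrable
      · have hs := hsub hs'
        obtain ⟨-, hb, hm, hK⟩ := hB s hs
        have e1 := norm_A_m_le hε hm hK (D.b s (p s))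
        have e2 : ‖D.b s (p s)‖ ≤ B * ‖p s‖ := (D.b s).le_of_opNorm_le hb _
        have e3 : ‖D.R ε (D.S (F₂ s))‖ ≤ H₂ := (norm_R_le hε _).trans (hH₂ s hs)
        have e4 : ‖-D.R ε (D.S (F₁ s))‖ ≤ H₁ := by
          rw [norm_neg]; exact (norm_R_le hε _).trans (hH₁ s hs)
        have e5 : ‖D.A ε (D.m s (D.b s (p s))) + D.R ε (D.S (F₂ s))‖ ≤
            2 * B * ‖D.A ε (D.b s (p s))‖ + B * (B * ‖p s‖) + H₂ := by
          have := mul_le_mul_of_nonneg_left e2 hB0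
          linarith [norm_add_le (D.A ε (D.m s (D.b s (p s)))) (D.R ε (D.S (F₂ s)))]
        have e6 : ‖p s‖ ^ 2 ≤ P₀ := by linarith [hbase s hs, sq_nonneg ‖q s‖]
        have e7 : (2 * B * ‖D.A ε (D.b s (p s))‖ + B * (B * ‖p s‖) + H₂) ^ 2 ≤
            3 * (4 * B ^ 2 * ‖D.A ε (D.b s (p s))‖ ^ 2 + B ^ 4 * ‖p s‖ ^ 2 + H₂ ^ 2) := by
          generalize ‖D.A ε (D.b s (p s))‖ = x
          generalize ‖p s‖ = z
          nlinarith [sq_nonneg (2 * B * x - B * (B * z)), sq_nonneg (2 * B * x - H₂),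
            sq_nonneg (B * (B * z) - H₂)]
        have e8 : B ^ 4 * ‖p s‖ ^ 2 ≤ B ^ 4 * P₀ := by gcongr
        have e9 := pow_le_pow_left₀ (norm_nonneg _) e5 2
        have e10 := pow_le_pow_left₀ (norm_nonneg _) e4 2
        have e11 : 0 ≤ 12 * B ^ 2 * ‖-D.A ε (q s)‖ ^ 2 := by positivity
        simp only [hw]
        linarith
    have hi2 : ∫ s in (0 : ℝ)..t, ((3 * (B ^ 4 * P₀ + H₂ ^ 2) + H₁ ^ 2) + 12 * B ^ 2 * w s) ≤
        T * (3 * (B ^ 4 * P₀ + H₂ ^ 2) + H₁ ^ 2) + 12 * B ^ 2 * ∫ s in (0 : ℝ)..t, w s := by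
      rw [intervalIntegral.integral_add (by simp)
        (((hwc.const_mul _).mono (by rwa [uIcc_of_le ht.1])).intervalIntegrable),
        intervalIntegral.integral_const_mul, intervalIntegral.integral_const, sub_zero, smul_eq_mul]
      have := ht.2
      gcongr
    have i3 := pow_le_pow_left₀ (norm_nonneg _) i1 2
    have i4 := pow_le_pow_left₀ (norm_nonneg _) i2 2
    calc _ ≤ M * (‖D.S y₂‖ ^ 2 + ‖D.S y₁‖ ^ 2 + (T * (3 * (B ^ 4 * P₀ + H₂ ^ 2) + H₁ ^ 2) +
          12 * B ^ 2 * ∫ s in (0 : ℝ)..t, w s)) :=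
          mul_le_mul_of_nonneg_left (add_le_add (add_le_add i3 i4) (hi.trans hi2)) hM0
      _ = _ := by rw [hA₀, hκ]; ring
  have hfin := le_of_le_add_integral hA₀0 hκ0 hwc hmain
  intro t ht
  have h := hfin t ht
  rw [← hW] at h
  simp only [hw, norm_neg] at h
  exact ⟨Real.le_sqrt_of_sq_le (by nlinarith [sq_nonneg ‖D.A ε (q t)‖]),
    Real.le_sqrt_of_sq_le (by nlinarith [sq_nonneg ‖D.A ε (D.b t (p t))‖])⟩

/-- Each vector is its resolvent part plus `ε A` or `δ A`. The resolvent parts lie in the domain of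
the one operator `S` and cancel by its symmetry, so only terms carrying a factor `ε` or `δ` survive.
-/
theorem inner_skew (hε : 0 < ε) (hδ : 0 < δ) (x y z w : X) :
    ⟪x - z, D.A ε y - D.A δ w⟫_ℝ - ⟪y - w, D.A ε x - D.A δ z⟫_ℝ =
      ⟪ε • D.A ε x - δ • D.A δ z, D.A ε y - D.A δ w⟫_ℝ -
        ⟪ε • D.A ε y - δ • D.A δ w, D.A ε x - D.A δ z⟫_ℝ := by
  have h1 : x - z = D.ι (D.ρ ε x - D.ρ δ z) + (ε • D.A ε x - δ • D.A δ z) := by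
    nth_rewrite 1 [← R_add_A (D := D) hε x, ← R_add_A (D := D) hδ z]
    rw [map_sub]
    change (D.ι (D.ρ ε x) + _) - (D.ι (D.ρ δ z) + _) = _
    abel
  have h2 : y - w = D.ι (D.ρ ε y - D.ρ δ w) + (ε • D.A ε y - δ • D.A δ w) := by
    nth_rewrite 1 [← R_add_A (D := D) hε y, ← R_add_A (D := D) hδ w]
    rw [map_sub]
    change (D.ι (D.ρ ε y) + _) - (D.ι (D.ρ δ w) + _) = _
    abel
  have h3 : D.A ε y - D.A δ w = D.S (D.ρ ε y - D.ρ δ w) := (map_sub D.S _ _).symm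
  have h4 : D.A ε x - D.A δ z = D.S (D.ρ ε x - D.ρ δ z) := (map_sub D.S _ _).symm
  have h5 := D.symm (D.ρ ε x - D.ρ δ z) (D.ρ ε y - D.ρ δ w)
  rw [real_inner_comm] at h5
  rw [h1, h2, inner_add_left, inner_add_left, h3, h4, h5]
  ring

theorem inner_le_of_bounds {P : ℝ} (hε : 0 < ε) (hδ : 0 < δ) {x z y w : X}
    (hx : ‖x‖ ≤ P) (hz : ‖z‖ ≤ P) (hy : ‖y‖ ≤ P) (hw : ‖w‖ ≤ P) :
    |⟪ε • x - δ • z, y - w⟫_ℝ| ≤ 2 * P ^ 2 * (ε + δ) := by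
  have hP : 0 ≤ P := (norm_nonneg _).trans hx
  have h1 : ‖ε • x - δ • z‖ ≤ (ε + δ) * P := by
    refine (norm_sub_le _ _).trans ?_
    rw [norm_smul, norm_smul, Real.norm_of_nonneg hε.le, Real.norm_of_nonneg hδ.le]
    nlinarith
  have h2 : ‖y - w‖ ≤ 2 * P := (norm_sub_le _ _).trans (by linarith)
  calc _ ≤ ‖ε • x - δ • z‖ * ‖y - w‖ := abs_real_inner_le_norm _ _
    _ ≤ ((ε + δ) * P) * (2 * P) := by gcongr
    _ = _ := by ring

/-- The approximate solutions with regular data form a Cauchy family. -/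
theorem IsApprox.dist_le_regular (D : EvolutionData X Y) (hT : 0 ≤ T) {f₁ f₂ : ℝ → X}
    {F₁ F₂ : ℝ → Y}
    (hf₁ : Continuous f₁) (hf₂ : Continuous f₂) (hF₁ : Continuous F₁) (hF₂ : Continuous F₂)
    (h₁ : ∀ t ∈ Icc 0 T, f₁ t = D.ι (F₁ t)) (h₂ : ∀ t ∈ Icc 0 T, D.b t (f₂ t) = D.ι (F₂ t))
    (y₁ y₂ : Y) :
    ∃ P, 0 ≤ P ∧ ∀ (ε δ : ℝ) (q p q' p' : ℝ → X), 0 < ε → 0 < δ →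
      IsApprox D T (D.A ε) f₁ f₂ q p → IsApprox D T (D.A δ) f₁ f₂ q' p' →
      q 0 = D.ι y₁ → D.b 0 (p 0) = D.ι y₂ → q' 0 = D.ι y₁ → D.b 0 (p' 0) = D.ι y₂ →
      ∀ t ∈ Icc 0 T, ‖q t - q' t‖ ^ 2 + ‖p t - p' t‖ ^ 2 ≤ P * (ε + δ) := by
  obtain ⟨P, hP0, hP⟩ := IsApprox.exists_bound_regular D hT hf₁ hf₂ hF₁ hF₂ h₁ h₂ y₁ y₂
  obtain ⟨M, hM0, hM⟩ := D.energy_estimate T le_rfl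
  refine ⟨M * (T * (4 * P ^ 2)), by positivity, ?_⟩
  intro ε δ q p q' p' hε hδ hs hs' hq0 hp0 hq0' hp0' t ht
  -- The energy estimate is used with `k = 0`: the common sources cancel, and the mismatch of the
  -- two generators is a pure source of size `4 P² (ε + δ)`.
  have e := hM (q - q') (p - p') _ _ (fun _ => 4 * P ^ 2 * (ε + δ)) continuousOn_const
    (fun _ _ => by positivity) (fun t ht => (hs t ht).1.sub (hs' t ht).1)
    (fun t ht => (hs t ht).2.sub (hs' t ht).2) (fun t ht => by
      obtain ⟨b1, b2⟩ := hP ε q p hε hs hq0 hp0 t ht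
      obtain ⟨b3, b4⟩ := hP δ q' p' hδ hs' hq0' hp0' t ht
      have hsk := inner_skew (D := D) hε hδ (q t) (D.b t (p t)) (q' t) (D.b t (p' t))
      have j1 := abs_le.1 (inner_le_of_bounds hε hδ b2 b4 b1 b3)
      have j2 := abs_le.1 (inner_le_of_bounds hε hδ b1 b3 b2 b4)
      have k1 : D.A ε (D.b t (p t)) + f₁ t - (D.A δ (D.b t (p' t)) + f₁ t) =
        D.A ε (D.b t (p t)) - D.A δ (D.b t (p' t)) := by abel
      have k2 : -D.A ε (q t) + f₂ t - (-D.A δ (q' t) + f₂ t) =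
        -(D.A ε (q t) - D.A δ (q' t)) := by abel
      rw [Pi.sub_apply, Pi.sub_apply, map_sub, k1, k2, inner_neg_right]
      linarith) t ht
  have hp : p 0 = p' 0 := by rw [← D.a_b 0 (p 0), hp0, ← hp0', D.a_b]
  refine e.trans ?_
  simp only [Pi.sub_apply, hq0, hq0', hp, sub_self, norm_zero, intervalIntegral.integral_const,
    sub_zero, smul_eq_mul]
  have := ht.2
  have : t * (4 * P ^ 2 * (ε + δ)) ≤ T * (4 * P ^ 2 * (ε + δ)) := by gcongr
  calc _ ≤ M * (0 ^ 2 + 0 ^ 2 + T * (4 * P ^ 2 * (ε + δ))) := by gcongr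
    _ = _ := by ring

theorem sq_add_sq_le_of_three {E : Type*} [NormedAddCommGroup E] (x y z w x' y' z' w' : E) {η : ℝ}
    (h1 : ‖x - y‖ ^ 2 + ‖x' - y'‖ ^ 2 ≤ η) (h2 : ‖y - z‖ ^ 2 + ‖y' - z'‖ ^ 2 ≤ η)
    (h3 : ‖w - z‖ ^ 2 + ‖w' - z'‖ ^ 2 ≤ η) :
    ‖x - w‖ ^ 2 + ‖x' - w'‖ ^ 2 ≤ 9 * η := by
  have key : ∀ x y z w : E, ‖x - w‖ ^ 2 ≤ 3 * (‖x - y‖ ^ 2 + ‖y - z‖ ^ 2 + ‖w - z‖ ^ 2) := by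
    intro x y z w
    have e : x - w = (x - y) + (y - z) - (w - z) := by abel
    have h4 : ‖x - w‖ ≤ ‖x - y‖ + ‖y - z‖ + ‖w - z‖ := by
      rw [e]
      linarith [norm_sub_le ((x - y) + (y - z)) (w - z), norm_add_le (x - y) (y - z)]
    have h5 := pow_le_pow_left₀ (norm_nonneg _) h4 2
    nlinarith [sq_nonneg (‖x - y‖ - ‖y - z‖), sq_nonneg (‖x - y‖ - ‖w - z‖),
      sq_nonneg (‖y - z‖ - ‖w - z‖)]
  linarith [key x y z w, key x' y' z' w']

/-- A three-term argument. Stability keeps each solution close to the one with resolvent-smoothed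
data, uniformly in the approximation parameter; for a fixed smoothing level the regular case
compares the two parameters. -/
theorem IsApprox.cauchy [CompleteSpace X] (D : EvolutionData X Y) (hT : 0 ≤ T) {f₁ f₂ : ℝ → X}
    (hf₁ : Continuous f₁) (hf₂ : Continuous f₂) (q₀ p₀ : X) {η : ℝ} (hη : 0 < η) :
    ∃ N, ∀ n ≥ N, ∀ n' ≥ N, ∀ q p q' p' : ℝ → X,
      IsApprox D T (D.A (eps n)) f₁ f₂ q p → IsApprox D T (D.A (eps n')) f₁ f₂ q' p' →
      q 0 = q₀ → p 0 = p₀ → q' 0 = q₀ → p' 0 = p₀ →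
      ∀ t ∈ Icc 0 T, ‖q t - q' t‖ ^ 2 + ‖p t - p' t‖ ^ 2 < η := by
  obtain ⟨B, hB0, hB⟩ := D.exists_bound T
  obtain ⟨M, hM0, hM⟩ := IsApprox.stability D T
  have hb := D.b_cont
  have ha := D.a_cont
  -- distance of the data to regularized data
  set g : ℝ → X := fun t => D.b t (f₂ t) with hg
  have hgc : Continuous g := by fun_prop
  set d : ℕ → ℝ := fun k => M * (‖D.R (eps k) q₀ - q₀‖ ^ 2 +
    B ^ 2 * ‖D.R (eps k) (D.b 0 p₀) - D.b 0 p₀‖ ^ 2 +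
    ((∫ s in (0 : ℝ)..T, ‖D.R (eps k) (f₁ s) - f₁ s‖ ^ 2) +
      B ^ 2 * ∫ s in (0 : ℝ)..T, ‖D.R (eps k) (g s) - g s‖ ^ 2)) with hd
  have hd0 : Tendsto d atTop (𝓝 0) := by
    have t1 := ((tendsto_R (D := D) q₀).sub_const q₀).norm.pow 2
    have t2 := ((tendsto_R (D := D) (D.b 0 p₀)).sub_const (D.b 0 p₀)).norm.pow 2
    have t3 := tendsto_integral_R (D := D) hT hf₁
    have t4 := tendsto_integral_R (D := D) hT hgc
    have := ((t1.add (t2.const_mul (B ^ 2))).add (t3.add (t4.const_mul (B ^ 2)))).const_mul M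
    simpa using this
  -- The three-term inequality costs a factor `9`, so `η / 18` for each leg yields `η / 2 < η`.
  obtain ⟨k, hk⟩ := (hd0.eventually (gt_mem_nhds (show 0 < η / 18 by positivity))).exists
  set f₁' : ℝ → X := fun t => D.R (eps k) (f₁ t) with hf₁'
  -- The smoothing acts on `b f₂` and is transported back by `a`, because regularity is required of
  -- `b f₂'`, not of `f₂'`.
  set f₂' : ℝ → X := fun t => D.a t (D.R (eps k) (g t)) with hf₂'
  have hc₁ : Continuous f₁' := by fun_prop
  have hc₂ : Continuous f₂' := by fun_prop
  obtain ⟨P, hP0, hP⟩ := IsApprox.dist_le_regular D hT hc₁ hc₂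
    (F₁ := fun t => D.ρ (eps k) (f₁ t)) (F₂ := fun t => D.ρ (eps k) (g t))
    (by fun_prop) (by fun_prop) (fun _ _ => rfl) (fun t _ => D.b_a _ _)
    (D.ρ (eps k) q₀) (D.ρ (eps k) (D.b 0 p₀))
  have hclose : ∀ n (q p q' p' : ℝ → X), IsApprox D T (D.A (eps n)) f₁ f₂ q p →
      IsApprox D T (D.A (eps n)) f₁' f₂' q' p' → q 0 = q₀ → p 0 = p₀ →
      q' 0 = D.R (eps k) q₀ → p' 0 = D.a 0 (D.R (eps k) (D.b 0 p₀)) →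
      ∀ t ∈ Icc 0 T, ‖q t - q' t‖ ^ 2 + ‖p t - p' t‖ ^ 2 ≤ η / 18 := by
    intro n q p q' p' hs hs' hq hp hq' hp' t ht
    have h := hM _ _ _ _ _ (eps_pos n) (hf₁.sub hc₁).continuousOn (hf₂.sub hc₂).continuousOn
      (hs.sub hs') t ht
    simp only [Pi.sub_apply, hq, hp, hq', hp'] at h
    refine h.trans (le_trans ?_ hk.le)
    have ea : ∀ s ∈ Icc 0 T, ∀ x y : X, ‖x - D.a s y‖ ^ 2 ≤ B ^ 2 * ‖y - D.b s x‖ ^ 2 := by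
      intro s hs x y
      have : x - D.a s y = D.a s (-(y - D.b s x)) := by rw [neg_sub, map_sub, D.a_b]
      rw [this, ← mul_pow]
      gcongr
      refine ((D.a s).le_of_opNorm_le (hB s hs).1 _).trans ?_
      rw [norm_neg]
    have e1 : ‖q₀ - D.R (eps k) q₀‖ = ‖D.R (eps k) q₀ - q₀‖ := norm_sub_rev _ _
    have e2 := ea 0 (left_mem_Icc.2 hT) p₀ (D.R (eps k) (D.b 0 p₀))
    have hbc : Continuous fun s => ‖D.R (eps k) (f₁ s) - f₁ s‖ ^ 2 := by fun_prop
    have hbc' : Continuous fun s => B ^ 2 * ‖D.R (eps k) (g s) - g s‖ ^ 2 := by fun_prop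
    have e3 : ∫ s in (0 : ℝ)..t, (‖f₁ s - f₁' s‖ ^ 2 + ‖f₂ s - f₂' s‖ ^ 2) ≤
        (∫ s in (0 : ℝ)..T, ‖D.R (eps k) (f₁ s) - f₁ s‖ ^ 2) +
          B ^ 2 * ∫ s in (0 : ℝ)..T, ‖D.R (eps k) (g s) - g s‖ ^ 2 := by
      rw [← intervalIntegral.integral_const_mul, ← intervalIntegral.integral_add
        (hbc.intervalIntegrable _ _) (hbc'.intervalIntegrable _ _)]
      calc _ ≤ ∫ s in (0 : ℝ)..t, (‖D.R (eps k) (f₁ s) - f₁ s‖ ^ 2 +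
            B ^ 2 * ‖D.R (eps k) (g s) - g s‖ ^ 2) := by
            refine intervalIntegral.integral_mono_on ht.1
              (Continuous.intervalIntegrable (by fun_prop) _ _)
              ((hbc.add hbc').intervalIntegrable _ _) fun s hs => ?_
            rw [hf₁', hf₂', norm_sub_rev (f₁ s)]
            have := ea s ⟨hs.1, hs.2.trans ht.2⟩ (f₂ s) (D.R (eps k) (g s))
            linarith
        _ ≤ _ := by
            refine intervalIntegral.integral_mono_interval le_rfl ht.1 ht.2
              (.of_forall fun s => ?_) ((hbc.add hbc').intervalIntegrable _ _)
            simp only [Pi.zero_apply]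
            positivity
    rw [e1]
    exact mul_le_mul_of_nonneg_left (add_le_add (add_le_add_right e2 _) e3) hM0
  obtain ⟨N, hN⟩ := (Metric.tendsto_atTop.1
    (show Tendsto (fun n => P * eps n) atTop (𝓝 0) by simpa using tendsto_eps.const_mul P))
    (η / 36) (by positivity)
  refine ⟨N, fun n hn n' hn' q p q' p' hs hs' hq hp hq' hp' t ht => ?_⟩
  obtain ⟨x, y, hxy, hx, hy⟩ := exists_isApprox D hT (D.A (eps n)) hc₁ hc₂
    (D.R (eps k) q₀) (D.a 0 (D.R (eps k) (D.b 0 p₀)))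
  obtain ⟨x', y', hxy', hx', hy'⟩ := exists_isApprox D hT (D.A (eps n')) hc₁ hc₂
    (D.R (eps k) q₀) (D.a 0 (D.R (eps k) (D.b 0 p₀)))
  have h1 := hclose n q p x y hs hxy hq hp hx hy t ht
  have h3 := hclose n' q' p' x' y' hs' hxy' hq' hp' hx' hy' t ht
  have h2 := hP _ _ x y x' y' (eps_pos n) (eps_pos n') hxy hxy' hx (by rw [hy, D.b_a]; rfl)
    hx' (by rw [hy', D.b_a]; rfl) t ht
  have l1 := hN n hn
  have l2 := hN n' hn'
  rw [Real.dist_0_eq_abs, abs_lt] at l1 l2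
  have h2' : ‖x t - x' t‖ ^ 2 + ‖y t - y' t‖ ^ 2 ≤ η / 18 := h2.trans (by linarith)
  linarith [sq_add_sq_le_of_three _ _ _ _ _ _ _ _ h1 h2' h3]

end EvolutionData

/-! ### Limits of the approximations and the closed limit system. -/

namespace EvolutionData

variable {X Y : Type*} [NormedAddCommGroup X] [InnerProductSpace ℝ X]
  [NormedAddCommGroup Y] [NormedSpace ℝ Y] {D : EvolutionData X Y} {ε δ T : ℝ}

/-- `(q, p)` is the uniform limit of all sequences of approximate solutions with its initial data
and the right hand side `(f₁, f₂)`. -/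
def IsLimit (D : EvolutionData X Y) (T : ℝ) (f₁ f₂ q p : ℝ → X) : Prop :=
  ∀ qn pn : ℕ → ℝ → X,
    (∀ n, IsApprox D T (D.A (eps n)) f₁ f₂ (qn n) (pn n) ∧ qn n 0 = q 0 ∧ pn n 0 = p 0) →
    ∀ η > 0, ∃ N, ∀ n ≥ N, ∀ t ∈ Icc 0 T, ‖qn n t - q t‖ ^ 2 + ‖pn n t - p t‖ ^ 2 ≤ η

/-- One sequence of approximations converges uniformly by the Cauchy property. That property
compares arbitrary solutions with the same data, so every other such sequence has the same limit. -/
theorem exists_isLimit [CompleteSpace X] (D : EvolutionData X Y) (hT : 0 ≤ T) {f₁ f₂ : ℝ → X}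
    (hf₁ : Continuous f₁) (hf₂ : Continuous f₂) (q₀ p₀ : X) :
    ∃ q p, Continuous q ∧ Continuous p ∧ q 0 = q₀ ∧ p 0 = p₀ ∧ IsLimit D T f₁ f₂ q p := by
  choose qn pn hs hq hp using fun n => exists_isApprox D hT (D.A (eps n)) hf₁ hf₂ q₀ p₀
  have hC := fun η (hη : (0 : ℝ) < η) => IsApprox.cauchy D hT hf₁ hf₂ q₀ p₀ hη
  set P : ℝ → ℝ := fun t => projIcc 0 T hT t with hP
  have hPm : ∀ t, P t ∈ Icc 0 T := fun t => (projIcc 0 T hT t).2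
  have hPc : Continuous P := continuous_subtype_val.comp continuous_projIcc
  have hP0 : P 0 = 0 := by simp [hP]
  have hPid : ∀ t ∈ Icc 0 T, P t = t := fun t ht => by simp [hP, projIcc_of_mem hT ht]
  have key : ∀ f : ℕ → ℝ → X, (∀ n, ContinuousOn (f n) (Icc 0 T)) →
      (∀ η > 0, ∃ N, ∀ n ≥ N, ∀ n' ≥ N, ∀ t ∈ Icc 0 T, ‖f n t - f n' t‖ ^ 2 < η) →
      ∃ l : ℝ → X, Continuous l ∧ ∀ t, Tendsto (fun n => f n (P t)) atTop (𝓝 (l t)) := by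
    intro f hf hfc
    have hcs : UniformCauchySeqOn (fun n t => f n (P t)) atTop univ := by
      rw [Metric.uniformCauchySeqOn_iff]
      intro η hη
      obtain ⟨N, hN⟩ := hfc (η ^ 2) (by positivity)
      refine ⟨N, fun n hn n' hn' t _ => ?_⟩
      rw [dist_eq_norm]
      exact lt_of_pow_lt_pow_left₀ 2 hη.le (hN n hn n' hn' _ (hPm t))
    have hlim : ∀ t, ∃ x, Tendsto (fun n => f n (P t)) atTop (𝓝 x) := fun t =>
      cauchySeq_tendsto_of_complete (hcs.cauchySeq (mem_univ t))
    choose l hl using hlim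
    refine ⟨l, ?_, hl⟩
    have := hcs.tendstoUniformlyOn_of_tendsto (fun t _ => hl t)
    rw [tendstoUniformlyOn_univ] at this
    exact this.continuous (.of_forall fun n => (hf n).comp_continuous hPc hPm)
  obtain ⟨q, hqc, hql⟩ := key qn (fun n => (hs n).continuousOn.1) (fun η hη => by
    obtain ⟨N, hN⟩ := hC η hη
    refine ⟨N, fun n hn n' hn' t ht => ?_⟩
    have := hN n hn n' hn' _ _ _ _ (hs n) (hs n') (hq n) (hp n) (hq n') (hp n') t ht
    nlinarith [sq_nonneg ‖pn n t - pn n' t‖])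
  obtain ⟨p, hpc, hpl⟩ := key pn (fun n => (hs n).continuousOn.2) (fun η hη => by
    obtain ⟨N, hN⟩ := hC η hη
    refine ⟨N, fun n hn n' hn' t ht => ?_⟩
    have := hN n hn n' hn' _ _ _ _ (hs n) (hs n') (hq n) (hp n) (hq n') (hp n') t ht
    nlinarith [sq_nonneg ‖qn n t - qn n' t‖])
  have hq0 : q 0 = q₀ := tendsto_nhds_unique (hql 0) (by simp [hP0, hq])
  have hp0 : p 0 = p₀ := tendsto_nhds_unique (hpl 0) (by simp [hP0, hp])
  refine ⟨q, p, hqc, hpc, hq0, hp0, fun qn' pn' h' η hη => ?_⟩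
  obtain ⟨N, hN⟩ := hC η hη
  refine ⟨N, fun n hn t ht => ?_⟩
  have l1 := hql t
  have l2 := hpl t
  rw [hPid t ht] at l1 l2
  refine le_of_tendsto (((l1.const_sub (qn' n t)).norm.pow 2).add
    ((l2.const_sub (pn' n t)).norm.pow 2)) ?_
  filter_upwards [eventually_ge_atTop N] with n' hn'
  obtain ⟨a1, a2, a3⟩ := h' n
  exact (hN n hn n' hn' _ _ _ _ a1 (hs n') (a2.trans hq0) (a3.trans hp0) (hq n') (hp n') t ht).le

theorem IsLimit.tendsto {f₁ f₂ q p : ℝ → X} (h : IsLimit D T f₁ f₂ q p) {qn pn : ℕ → ℝ → X}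
    (hn : ∀ n, IsApprox D T (D.A (eps n)) f₁ f₂ (qn n) (pn n) ∧ qn n 0 = q 0 ∧ pn n 0 = p 0)
    {t : ℝ} (ht : t ∈ Icc 0 T) :
    Tendsto (fun n => qn n t) atTop (𝓝 (q t)) ∧ Tendsto (fun n => pn n t) atTop (𝓝 (p t)) := by
  constructor <;> rw [Metric.tendsto_atTop] <;> intro η hη <;>
    obtain ⟨N, hN⟩ := h qn pn hn (η ^ 2 / 2) (by positivity) <;>
    refine ⟨N, fun n hn => ?_⟩ <;> have := hN n hn t ht <;> rw [dist_eq_norm] <;>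
    refine lt_of_pow_lt_pow_left₀ 2 hη.le ?_
  · nlinarith [sq_nonneg ‖pn n t - p t‖, sq_pos_of_pos hη]
  · nlinarith [sq_nonneg ‖qn n t - q t‖, sq_pos_of_pos hη]

/-- The uniform estimate for differences of approximations passes to the limit; it supplies the
Volterra bound for the fixed point below. -/
theorem IsLimit.stability [CompleteSpace X] (D : EvolutionData X Y) (hT : 0 ≤ T) :
    ∃ M, 0 ≤ M ∧ ∀ f₁ f₂ f₁' f₂' q p q' p' : ℝ → X, Continuous f₁ → Continuous f₂ →
      Continuous f₁' → Continuous f₂' → IsLimit D T f₁ f₂ q p → IsLimit D T f₁' f₂' q' p' →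
      q 0 = q' 0 → p 0 = p' 0 → ∀ t ∈ Icc 0 T, ‖q t - q' t‖ ^ 2 + ‖p t - p' t‖ ^ 2 ≤
        M * ∫ s in (0 : ℝ)..t, (‖f₁ s - f₁' s‖ ^ 2 + ‖f₂ s - f₂' s‖ ^ 2) := by
  obtain ⟨M, hM0, hM⟩ := IsApprox.stability D T
  refine ⟨M, hM0, ?_⟩
  intro f₁ f₂ f₁' f₂' q p q' p' hf₁ hf₂ hf₁' hf₂' h h' hq hp t ht
  choose qn pn hs hqn hpn using fun n => exists_isApprox D hT (D.A (eps n)) hf₁ hf₂ (q 0) (p 0)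
  choose qn' pn' hs' hqn' hpn' using
    fun n => exists_isApprox D hT (D.A (eps n)) hf₁' hf₂' (q' 0) (p' 0)
  obtain ⟨l1, l2⟩ := h.tendsto (fun n => ⟨hs n, hqn n, hpn n⟩) ht
  obtain ⟨l3, l4⟩ := h'.tendsto (fun n => ⟨hs' n, hqn' n, hpn' n⟩) ht
  refine le_of_tendsto' (((l1.sub l3).norm.pow 2).add ((l2.sub l4).norm.pow 2)) fun n => ?_
  have := hM _ _ _ _ _ (eps_pos n) (hf₁.sub hf₁').continuousOn (hf₂.sub hf₂').continuousOn
    ((hs n).sub (hs' n)) t ht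
  simpa [hqn, hqn', hpn, hpn', hq, hp] using this

/-- From `y = ρ 1 (ι y + S y)`, the elements `ρ ε xₙ` equal `ρ 1 (R xₙ + A xₙ)`. They therefore
converge in `Y`, to a point whose images under `ι` and `S` are `x` and `w`. -/
theorem graph_closed {x w : X} {xn : ℕ → X} (hx : Tendsto xn atTop (𝓝 x))
    (hw : Tendsto (fun n => D.A (eps n) (xn n)) atTop (𝓝 w)) :
    D.ι (D.ρ 1 (x + w)) = x ∧ D.S (D.ρ 1 (x + w)) = w := by
  have hR : Tendsto (fun n => D.R (eps n) (xn n)) atTop (𝓝 x) := by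
    have h1 : Tendsto (fun n => D.R (eps n) (xn n - x)) atTop (𝓝 0) := by
      refine squeeze_zero_norm (fun n => norm_R_le (eps_pos n) _) ?_
      simpa using (hx.sub_const x).norm
    simpa using h1.add (tendsto_R (D := D) x)
  have hρ : ∀ n, D.ρ (eps n) (xn n) = D.ρ 1 (D.R (eps n) (xn n) + D.A (eps n) (xn n)) := by
    intro n
    have := D.res_left 1 one_pos (D.ρ (eps n) (xn n))
    rw [one_smul] at this
    exact this.symm
  have hl : Tendsto (fun n => D.ρ (eps n) (xn n)) atTop (𝓝 (D.ρ 1 (x + w))) := by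
    simp only [hρ]
    exact ((D.ρ 1).continuous.tendsto _).comp (hR.add hw)
  exact ⟨tendsto_nhds_unique ((D.ι.continuous.tendsto _).comp hl) hR,
    tendsto_nhds_unique ((D.S.continuous.tendsto _).comp hl) hw⟩

/-- The limit of the system satisfied by the velocity and the images under the generator. -/
theorem exists_limit_system [CompleteSpace X] (D : EvolutionData X Y) (hT : 0 ≤ T) {g : ℝ → Y}
    (hg : Continuous g) (V₀ : Y) (Q₀ : Y) :
    ∃ v s r : ℝ → X, Continuous v ∧ Continuous s ∧ Continuous r ∧
      v 0 = D.ι V₀ ∧ s 0 = D.S V₀ ∧ r 0 = -D.S Q₀ ∧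
      (∀ t ∈ Icc 0 T, HasDerivWithinAt v (D.m t (v t) + D.b t (r t) + D.ι (g t)) (Icc 0 T) t) ∧
      IsLimit D T (fun t => D.m t (s t) + D.K t (v t + s t) + D.S (g t)) (fun _ => 0) s r := by
  obtain ⟨B, hB0, hB⟩ := D.exists_bound T
  obtain ⟨M, hM0, hM⟩ := IsLimit.stability D hT
  have hmc := D.m_cont
  have hbc := D.b_cont
  have hKc := D.K_cont
  -- The unknown is the triple `(v, s, r)`. The map freezes it in the sources, takes `v` by
  -- integration, and takes `(s, r)` as the limit solution for the frozen source.
  let Z := C(Icc 0 T, X × X × X)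
  let fs : Z → ℝ → X := fun z t => D.m t (pathExt hT z t).2.1 +
    D.K t ((pathExt hT z t).1 + (pathExt hT z t).2.1) + D.S (g t)
  let fv : Z → ℝ → X := fun z t => D.m t (pathExt hT z t).1 + D.b t (pathExt hT z t).2.2 +
    D.ι (g t)
  have hzc := fun z : Z => continuous_pathExt hT z
  have hfs : ∀ z, Continuous (fs z) := fun z => by have := hzc z; fun_prop
  have hfv : ∀ z, Continuous (fv z) := fun z => by have := hzc z; fun_prop
  choose s r hsc hrc hs0 hr0 hlim using fun z : Z =>
    exists_isLimit D hT (hfs z) (continuous_const (y := (0 : X))) (D.S V₀) (-D.S Q₀)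
  let v : Z → ℝ → X := fun z t => D.ι V₀ + ∫ τ in (0 : ℝ)..t, fv z τ
  have hvd : ∀ z t, HasDerivAt (v z) (fv z t) t := fun z t =>
    ((hfv z).integral_hasStrictDerivAt 0 t).hasDerivAt.const_add _
  have hvc : ∀ z, Continuous (v z) := fun z =>
    continuous_iff_continuousAt.2 fun t => (hvd z t).continuousAt
  let Ψ : Z → Z := fun z => ⟨fun t => (v z t, s z t, r z t),
    ((hvc z).prodMk ((hsc z).prodMk (hrc z))).comp continuous_subtype_val⟩
  obtain ⟨z, hz⟩ := volterra_fixedPoint hT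
    (K := Real.exp T * (2 * B) ^ 2 + M * (3 * B) ^ 2) (by positivity) Ψ (by
    intro z w t ht
    rw [pathExt_of_mem hT _ ht, pathExt_of_mem hT _ ht]
    set d : ℝ → ℝ := fun τ => ‖pathExt hT z τ - pathExt hT w τ‖ with hd
    have hdc : Continuous d := ((hzc z).sub (hzc w)).norm
    have d1 : ∀ τ, ‖(pathExt hT z τ).1 - (pathExt hT w τ).1‖ ≤ d τ := fun τ =>
      norm_fst_le (pathExt hT z τ - pathExt hT w τ)
    have d2 : ∀ τ, ‖(pathExt hT z τ).2.1 - (pathExt hT w τ).2.1‖ ≤ d τ := fun τ =>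
      (norm_fst_le (pathExt hT z τ - pathExt hT w τ).2).trans (norm_snd_le _)
    have d3 : ∀ τ, ‖(pathExt hT z τ).2.2 - (pathExt hT w τ).2.2‖ ≤ d τ := fun τ =>
      (norm_snd_le (pathExt hT z τ - pathExt hT w τ).2).trans (norm_snd_le _)
    have ev : ‖v z t - v w t‖ ^ 2 ≤ Real.exp T * (2 * B) ^ 2 * ∫ τ in (0 : ℝ)..t, d τ ^ 2 := by
      have e1 : v z t - v w t = ∫ τ in (0 : ℝ)..t, (fv z τ - fv w τ) := by
        rw [intervalIntegral.integral_sub ((hfv z).intervalIntegrable _ _)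
          ((hfv w).intervalIntegrable _ _)]
        exact add_sub_add_left_eq_sub _ _ _
      have e2 : ‖v z t - v w t‖ ≤ ∫ τ in (0 : ℝ)..t, 2 * B * d τ := by
        rw [e1]
        refine intervalIntegral.norm_integral_le_of_norm_le ht.1 ?_
          ((hdc.const_mul _).intervalIntegrable _ _)
        filter_upwards with τ hτ
        obtain ⟨-, hb, hm, -⟩ := hB τ ⟨hτ.1.le, hτ.2.trans ht.2⟩
        have e3 : fv z τ - fv w τ = D.m τ ((pathExt hT z τ).1 - (pathExt hT w τ).1) +
            D.b τ ((pathExt hT z τ).2.2 - (pathExt hT w τ).2.2) := by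
          simp only [fv, map_sub]; abel
        rw [e3]
        have e4 := (D.m τ).le_of_opNorm_le_of_le hm (d1 τ)
        have e5 := (D.b τ).le_of_opNorm_le_of_le hb (d3 τ)
        linarith [norm_add_le (D.m τ ((pathExt hT z τ).1 - (pathExt hT w τ).1))
          (D.b τ ((pathExt hT z τ).2.2 - (pathExt hT w τ).2.2))]
      calc _ ≤ (∫ τ in (0 : ℝ)..t, 2 * B * d τ) ^ 2 := by gcongr
        _ ≤ Real.exp T * ∫ τ in (0 : ℝ)..t, (2 * B * d τ) ^ 2 :=
          sq_integral_le (hdc.const_mul _).continuousOn t ht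
        _ = _ := by
          simp only [mul_pow _ (d _), intervalIntegral.integral_const_mul]
          ring
    have esr : ‖s z t - s w t‖ ^ 2 + ‖r z t - r w t‖ ^ 2 ≤
        M * (3 * B) ^ 2 * ∫ τ in (0 : ℝ)..t, d τ ^ 2 := by
      have h := hM _ _ _ _ _ _ _ _ (hfs z) continuous_const (hfs w) continuous_const
        (hlim z) (hlim w) ((hs0 z).trans (hs0 w).symm) ((hr0 z).trans (hr0 w).symm) t ht
      refine h.trans ?_
      rw [mul_assoc]
      refine mul_le_mul_of_nonneg_left ?_ hM0
      rw [← intervalIntegral.integral_const_mul]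
      refine intervalIntegral.integral_mono_on ht.1 ?_ ?_ fun τ hτ => ?_
      · have := hfs z
        have := hfs w
        exact Continuous.intervalIntegrable (by fun_prop) _ _
      · exact ((hdc.pow 2).const_mul _).intervalIntegrable _ _
      · obtain ⟨-, hb, hm, hK⟩ := hB τ ⟨hτ.1, hτ.2.trans ht.2⟩
        have e3 : fs z τ - fs w τ = D.m τ ((pathExt hT z τ).2.1 - (pathExt hT w τ).2.1) +
            (D.K τ ((pathExt hT z τ).1 - (pathExt hT w τ).1) +
            D.K τ ((pathExt hT z τ).2.1 - (pathExt hT w τ).2.1)) := by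
          simp only [fs, map_sub, map_add]; abel
        have e4 := (D.m τ).le_of_opNorm_le_of_le hm (d2 τ)
        have e5 := (D.K τ).le_of_opNorm_le_of_le hK (d1 τ)
        have e6 := (D.K τ).le_of_opNorm_le_of_le hK (d2 τ)
        have e7 : ‖fs z τ - fs w τ‖ ≤ 3 * B * d τ := by
          rw [e3]
          refine (norm_add_le _ _).trans ?_
          linarith [norm_add_le (D.K τ ((pathExt hT z τ).1 - (pathExt hT w τ).1))
            (D.K τ ((pathExt hT z τ).2.1 - (pathExt hT w τ).2.1))]
        rw [sub_self, norm_zero, ← mul_pow]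
        have := pow_le_pow_left₀ (norm_nonneg _) e7 2
        linarith
    have hmax : ‖Ψ z ⟨t, ht⟩ - Ψ w ⟨t, ht⟩‖ ^ 2 ≤
        ‖v z t - v w t‖ ^ 2 + (‖s z t - s w t‖ ^ 2 + ‖r z t - r w t‖ ^ 2) := by
      change ‖(v z t - v w t, s z t - s w t, r z t - r w t)‖ ^ 2 ≤ _
      rw [Prod.norm_def, Prod.norm_def]
      have h1 := sq_nonneg ‖v z t - v w t‖
      have h2 := sq_nonneg ‖s z t - s w t‖
      have h3 := sq_nonneg ‖r z t - r w t‖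
      rcases max_choice ‖v z t - v w t‖ (max ‖s z t - s w t‖ ‖r z t - r w t‖) with h | h <;>
        rw [h]
      · linarith
      · rcases max_choice ‖s z t - s w t‖ ‖r z t - r w t‖ with h | h <;> rw [h] <;> linarith
    rw [add_mul]
    linarith)
  have hext : ∀ t ∈ Icc 0 T, pathExt hT z t = (v z t, s z t, r z t) := by
    intro t ht
    rw [pathExt_of_mem hT _ ht]
    conv_lhs => rw [← hz]
    rfl
  have h0 := hext 0 (left_mem_Icc.2 hT)
  have hv0 : v z 0 = D.ι V₀ := by simp [v]
  refine ⟨fun t => (pathExt hT z t).1, fun t => (pathExt hT z t).2.1, fun t => (pathExt hT z t).2.2,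
    by have := hzc z; fun_prop, by have := hzc z; fun_prop, by have := hzc z; fun_prop,
    by simp [h0, hv0], by simp [h0, hs0], by simp [h0, hr0], fun t ht => ?_, ?_⟩
  · exact (hvd z t).hasDerivWithinAt.congr (fun τ hτ => by simp [hext τ hτ]) (by simp [hext t ht])
  · intro qn pn hn η hη
    obtain ⟨N, hN⟩ := hlim z qn pn (fun n => by
      have h := hn n
      simp only [h0] at h
      exact h) η hη
    refine ⟨N, fun n hn t ht => ?_⟩
    simpa [hext t ht] using hN n hn t ht

end EvolutionData

/-! ### Strong solutions. -/

namespace EvolutionData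

variable {X Y : Type*} [NormedAddCommGroup X] [InnerProductSpace ℝ X]
  [NormedAddCommGroup Y] [NormedSpace ℝ Y] {D : EvolutionData X Y} {ε δ T : ℝ}

set_option maxHeartbeats 800000 in
/-- Well-posedness in the domain of the generator. -/
theorem exists_strong_solution [CompleteSpace X] (D : EvolutionData X Y) (hT : 0 ≤ T) {g : ℝ → Y}
    (hg : Continuous g) (V₀ : Y) (Q₀ : Y) :
    ∃ V Q : ℝ → Y, Continuous V ∧ Continuous Q ∧ V 0 = V₀ ∧ Q 0 = Q₀ ∧
      ∀ t ∈ Icc 0 T,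
        HasDerivWithinAt (fun t => D.ι (V t))
          (D.m t (D.ι (V t)) - D.b t (D.S (Q t)) + D.ι (g t)) (Icc 0 T) t ∧
        HasDerivWithinAt (fun t => D.ι (Q t)) (D.S (V t)) (Icc 0 T) t := by
  obtain ⟨B, hB0, hB⟩ := D.exists_bound T
  obtain ⟨M, hM0, hM⟩ := IsApprox.stability D T
  have hmc := D.m_cont
  have hbc := D.b_cont
  have hac := D.a_cont
  have hKc := D.K_cont
  obtain ⟨v, s, r, hvc, hsc, hrc, hv0, hs0, hr0, hvd, hlim⟩ := exists_limit_system D hT hg V₀ Q₀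
  have h0mem : (0 : ℝ) ∈ Icc 0 T := left_mem_Icc.2 hT
  -- approximate solutions
  have hfc : Continuous fun t => D.a t (D.ι (g t)) := by fun_prop
  choose qn pn hn hqn hpn using fun n => exists_isApprox D hT (D.A (eps n))
    (continuous_const (y := (0 : X))) hfc (D.ι Q₀) (D.a 0 (D.ι V₀))
  set vn : ℕ → ℝ → X := fun n t => D.b t (pn n t) with hvn
  set sn : ℕ → ℝ → X := fun n t => D.A (eps n) (vn n t) with hsn
  set rn : ℕ → ℝ → X := fun n t => -D.A (eps n) (qn n t) with hrn
  have hvn0 : ∀ n, vn n 0 = D.ι V₀ := fun n => by simp only [hvn, hpn, D.b_a]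
  have hvnd : ∀ n, ∀ t ∈ Icc 0 T, HasDerivWithinAt (vn n)
      (D.m t (vn n t) + D.b t (rn n t) + D.ι (g t)) (Icc 0 T) t := fun n t ht =>
    ((hn n).velocity ht).congr_deriv (by simp only [D.b_a]; rfl)
  -- The first source of the approximate problem is zero and the second satisfies `b f₂ = ι g`, so
  -- the differentiated problem has regular data.
  have hgen : ∀ n, IsApprox D T (D.A (eps n))
      (fun t => D.A (eps n) (D.m t (vn n t)) + D.R (eps n) (D.S (g t)))
      (fun t => -D.R (eps n) (D.S 0)) (sn n) (rn n) := fun n =>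
    (hn n).generator (eps_pos n) (F₁ := fun _ => 0) (fun _ _ => by simp) fun t _ => D.b_a _ _
  have hvnc : ∀ n, ContinuousOn (vn n) (Icc 0 T) := fun n t ht =>
    (hvnd n t ht).continuousWithinAt
  -- comparison solutions
  set f : ℝ → X := fun t => D.m t (s t) + D.K t (v t + s t) + D.S (g t) with hf
  have hfcont : Continuous f := by fun_prop
  choose xn yn hxy hxn hyn using fun n => exists_isApprox D hT (D.A (eps n)) hfcont
    (continuous_const (y := (0 : X))) (s 0) (r 0)
  have hcmp := hlim xn yn fun n => ⟨hxy n, hxn n, hyn n⟩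
  set h : ℝ → X := fun t => D.K t (v t + s t) + D.S (g t) with hh
  have hhc : Continuous h := by fun_prop
  set e : ℕ → ℝ → ℝ := fun n t => ‖vn n t - v t‖ ^ 2 + ‖sn n t - s t‖ ^ 2 + ‖rn n t - r t‖ ^ 2
    with he
  have hec : ∀ n, ContinuousOn (e n) (Icc 0 T) := fun n =>
    ((((hvnc n).sub hvc.continuousOn).norm.pow 2).add
      (((hgen n).continuousOn.1.sub hsc.continuousOn).norm.pow 2)).add
      (((hgen n).continuousOn.2.sub hrc.continuousOn).norm.pow 2)
  have he0 : ∀ n t, 0 ≤ e n t := fun n t => by positivity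
  -- The velocity errors satisfy an ODE with bounded coefficients driven by `rn - r`; half of the
  -- cross term is absorbed by Gronwall.
  have hvest : ∀ n, ∀ t ∈ Icc 0 T,
      ‖vn n t - v t‖ ^ 2 ≤ Real.exp (3 * B * T) * B * ∫ τ in (0 : ℝ)..t, e n τ := by
    intro n t ht
    have hd : ∀ t ∈ Icc 0 T, HasDerivWithinAt (fun t => vn n t - v t)
        (D.m t (vn n t - v t) + D.b t (rn n t - r t)) (Icc 0 T) t := fun t ht =>
      ((hvnd n t ht).sub (hvd t ht)).congr_deriv (by simp only [map_sub]; abel)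
    have h1 := gronwall_integral (k := 3 * B) (by positivity)
      (φ := fun t => B * e n t) ((hec n).const_mul B)
      (fun t _ => mul_nonneg hB0 (he0 n t)) (fun t ht => (hd t ht).norm_sq) (fun t ht => by
        obtain ⟨-, hb, hm, -⟩ := hB t ht
        rw [inner_add_right]
        have e1 := (real_inner_le_norm (vn n t - v t) (D.m t (vn n t - v t))).trans
          (mul_le_mul_of_nonneg_left ((D.m t).le_of_opNorm_le hm _) (norm_nonneg _))
        have e2 := (real_inner_le_norm (vn n t - v t) (D.b t (rn n t - r t))).trans
          (mul_le_mul_of_nonneg_left ((D.b t).le_of_opNorm_le hb _) (norm_nonneg _))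
        have e3 : 0 ≤ B * ‖sn n t - s t‖ ^ 2 := by positivity
        have e4 : 0 ≤ B * ‖vn n t - v t‖ ^ 2 := by positivity
        simp only [he]
        nlinarith [mul_nonneg hB0 (sq_nonneg (‖vn n t - v t‖ - ‖rn n t - r t‖))]) t ht
    rw [hvn0, hv0, sub_self, norm_zero, intervalIntegral.integral_const_mul] at h1
    refine h1.trans ?_
    have h2 : 0 ≤ ∫ τ in (0 : ℝ)..t, e n τ := intervalIntegral.integral_nonneg ht.1 fun _ _ => he0 n _
    have h3 : Real.exp (3 * B * t) ≤ Real.exp (3 * B * T) := by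
      have := ht.2
      gcongr
    have h4 := mul_le_mul_of_nonneg_right h3 (mul_nonneg hB0 h2)
    calc _ = Real.exp (3 * B * t) * (B * ∫ τ in (0 : ℝ)..t, e n τ) := by ring
      _ ≤ _ := h4
      _ = _ := by ring
  -- The consistency error: everything arising from `R (eps n)` acting on fixed quantities instead
  -- of the identity.
  set d : ℕ → ℝ := fun n => M * (‖D.R (eps n) (D.S V₀) - D.S V₀‖ ^ 2 +
    ‖D.R (eps n) (D.S Q₀) - D.S Q₀‖ ^ 2 +
    ((4 * B ^ 2 * ∫ τ in (0 : ℝ)..T, ‖D.R (eps n) (v τ) - v τ‖ ^ 2) +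
      4 * ∫ τ in (0 : ℝ)..T, ‖D.R (eps n) (h τ) - h τ‖ ^ 2)) with hd
  have hdlim : Tendsto d atTop (𝓝 0) := by
    have t1 := ((tendsto_R (D := D) (D.S V₀)).sub_const (D.S V₀)).norm.pow 2
    have t2 := ((tendsto_R (D := D) (D.S Q₀)).sub_const (D.S Q₀)).norm.pow 2
    have t3 := tendsto_integral_R (D := D) hT hvc
    have t4 := tendsto_integral_R (D := D) hT hhc
    have := ((t1.add t2).add ((t3.const_mul (4 * B ^ 2)).add (t4.const_mul 4))).const_mul M
    simpa using this
  have hgest : ∀ n, ∀ t ∈ Icc 0 T, ‖sn n t - xn n t‖ ^ 2 + ‖rn n t - yn n t‖ ^ 2 ≤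
      d n + M * (16 * B ^ 2) * ∫ τ in (0 : ℝ)..t, e n τ := by
    intro n t ht
    have hsub : Icc 0 t ⊆ Icc 0 T := Icc_subset_Icc_right ht.2
    have hc1 : ContinuousOn (fun t => D.A (eps n) (D.m t (vn n t)) + D.R (eps n) (D.S (g t)))
        (Icc 0 T) :=
      ((D.A (eps n)).continuous.comp_continuousOn (hmc.continuousOn.clm_apply (hvnc n))).add
        (Continuous.continuousOn (by fun_prop))
    have h1 := hM _ _ _ _ _ (eps_pos n) (hc1.sub hfcont.continuousOn)
      (continuousOn_const.sub continuousOn_const) ((hgen n).sub (hxy n)) t ht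
    have i1 : sn n 0 - xn n 0 = D.R (eps n) (D.S V₀) - D.S V₀ := by
      rw [hxn, hs0, ← A_ι (eps_pos n), ← hvn0 n]
    have i2 : rn n 0 - yn n 0 = -(D.R (eps n) (D.S Q₀) - D.S Q₀) := by
      rw [hyn, hr0, ← A_ι (eps_pos n), ← hqn n]
      simp only [hrn]
      abel
    simp only [Pi.sub_apply, i1, i2, norm_neg] at h1
    refine h1.trans ?_
    have hI : ∫ τ in (0 : ℝ)..t, (‖D.A (eps n) (D.m τ (vn n τ)) + D.R (eps n) (D.S (g τ)) - f τ‖ ^ 2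
        + ‖-D.R (eps n) (D.S 0) - 0‖ ^ 2) ≤
        ∫ τ in (0 : ℝ)..t, (16 * B ^ 2 * e n τ + (4 * B ^ 2 * ‖D.R (eps n) (v τ) - v τ‖ ^ 2 +
          4 * ‖D.R (eps n) (h τ) - h τ‖ ^ 2)) := by
      refine intervalIntegral.integral_mono_on ht.1 ?_ ?_ fun τ hτ => ?_
      · exact ((((hc1.sub hfcont.continuousOn).norm.pow 2).add continuousOn_const).mono
          (by rwa [uIcc_of_le ht.1])).intervalIntegrable
      · exact ((((hec n).const_mul _).add (Continuous.continuousOn (by fun_prop))).mono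
          (by rwa [uIcc_of_le ht.1])).intervalIntegrable
      · obtain ⟨-, hb, hm, hK⟩ := hB τ (hsub hτ)
        -- By `A_m`, the source error splits into terms linear in `sn - s` and `vn - v`, and two
        -- smoothing errors on the fixed functions `v` and `h`.
        have e1 : D.A (eps n) (D.m τ (vn n τ)) + D.R (eps n) (D.S (g τ)) - f τ =
            D.m τ (sn n τ - s τ) +
            D.R (eps n) (D.K τ (D.R (eps n) (vn n τ - v τ) + (sn n τ - s τ))) +
            D.R (eps n) (D.K τ (D.R (eps n) (v τ) - v τ)) + (D.R (eps n) (h τ) - h τ) := by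
          rw [A_m (eps_pos n)]
          simp only [hf, hh, map_add, map_sub, hsn]
          abel
        have e2 : ‖D.m τ (sn n τ - s τ)‖ ≤ B * ‖sn n τ - s τ‖ := (D.m τ).le_of_opNorm_le hm _
        have e3 : ‖D.R (eps n) (D.K τ (D.R (eps n) (vn n τ - v τ) + (sn n τ - s τ)))‖ ≤
            B * (‖vn n τ - v τ‖ + ‖sn n τ - s τ‖) :=
          (norm_R_le (eps_pos n) _).trans ((D.K τ).le_of_opNorm_le_of_le hK
            ((norm_add_le _ _).trans (by gcongr; exact norm_R_le (eps_pos n) _)))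
        have e4 : ‖D.R (eps n) (D.K τ (D.R (eps n) (v τ) - v τ))‖ ≤
            B * ‖D.R (eps n) (v τ) - v τ‖ :=
          (norm_R_le (eps_pos n) _).trans ((D.K τ).le_of_opNorm_le hK _)
        have e5 := norm_add₄_le (a := D.m τ (sn n τ - s τ))
          (b := D.R (eps n) (D.K τ (D.R (eps n) (vn n τ - v τ) + (sn n τ - s τ))))
          (c := D.R (eps n) (D.K τ (D.R (eps n) (v τ) - v τ))) (d := D.R (eps n) (h τ) - h τ)
        rw [← e1] at e5
        have e6 : ‖D.A (eps n) (D.m τ (vn n τ)) + D.R (eps n) (D.S (g τ)) - f τ‖ ≤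
            2 * (B * ‖sn n τ - s τ‖) + B * ‖vn n τ - v τ‖ + B * ‖D.R (eps n) (v τ) - v τ‖ +
              ‖D.R (eps n) (h τ) - h τ‖ := by linarith
        have e7 := pow_le_pow_left₀ (norm_nonneg _) e6 2
        have e8 : ∀ a b c d : ℝ, (2 * a + b + c + d) ^ 2 ≤
            4 * (4 * a ^ 2 + b ^ 2 + c ^ 2 + d ^ 2) := fun a b c d => by
          nlinarith [sq_nonneg (2 * a - b), sq_nonneg (2 * a - c), sq_nonneg (2 * a - d),
            sq_nonneg (b - c), sq_nonneg (b - d), sq_nonneg (c - d)]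
        have e9 := e7.trans (e8 _ _ _ _)
        have e10 : 0 ≤ B ^ 2 * ‖vn n τ - v τ‖ ^ 2 := by positivity
        have e11 : 0 ≤ B ^ 2 * ‖rn n τ - r τ‖ ^ 2 := by positivity
        simp only [mul_pow] at e9
        simp only [he, map_zero, neg_zero, sub_zero, norm_zero]
        linarith
    have hIv : Continuous fun τ => 4 * B ^ 2 * ‖D.R (eps n) (v τ) - v τ‖ ^ 2 +
          4 * ‖D.R (eps n) (h τ) - h τ‖ ^ 2 := by fun_prop
    have hI2 : ∫ τ in (0 : ℝ)..t, (4 * B ^ 2 * ‖D.R (eps n) (v τ) - v τ‖ ^ 2 +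
          4 * ‖D.R (eps n) (h τ) - h τ‖ ^ 2) ≤
        (4 * B ^ 2 * ∫ τ in (0 : ℝ)..T, ‖D.R (eps n) (v τ) - v τ‖ ^ 2) +
          4 * ∫ τ in (0 : ℝ)..T, ‖D.R (eps n) (h τ) - h τ‖ ^ 2 := by
      rw [← intervalIntegral.integral_const_mul, ← intervalIntegral.integral_const_mul,
        ← intervalIntegral.integral_add (Continuous.intervalIntegrable (by fun_prop) _ _)
        (Continuous.intervalIntegrable (by fun_prop) _ _)]
      refine intervalIntegral.integral_mono_interval le_rfl ht.1 ht.2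
        (.of_forall fun s => ?_) (hIv.intervalIntegrable _ _)
      simp only [Pi.zero_apply]
      positivity
    rw [intervalIntegral.integral_add ((((hec n).const_mul _).mono
      (by rwa [uIcc_of_le ht.1])).intervalIntegrable) (hIv.intervalIntegrable _ _),
      intervalIntegral.integral_const_mul] at hI
    have hI3 := mul_le_mul_of_nonneg_left (hI.trans (add_le_add_right hI2 _)) hM0
    rw [mul_add]
    refine (add_le_add_right hI3 _).trans (le_of_eq ?_)
    simp only [hd]
    ring
  -- The factor `2` comes from inserting `(xn, yn)` between `(sn, rn)` and `(s, r)` in squared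
  -- norms.
  set κ := 2 * (M * (16 * B ^ 2)) + Real.exp (3 * B * T) * B with hκ
  have hκ0 : 0 ≤ κ := by positivity
  have hconv : ∀ η > 0, ∃ N, ∀ n ≥ N, ∀ t ∈ Icc 0 T, e n t ≤ η := by
    intro η hη
    -- `W` is the Gronwall factor. Comparison and consistency errors below `η / W / 4` are each
    -- doubled, for a total of at most `η / W`.
    set W := 1 + κ * (Real.exp (κ * T) * T) with hW
    have hW0 : 0 < W := by positivity
    obtain ⟨N₁, hN₁⟩ := hcmp (η / W / 4) (by positivity)
    obtain ⟨N₂, hN₂⟩ := eventually_atTop.1 (hdlim.eventually (gt_mem_nhds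
      (show 0 < η / W / 4 by positivity)))
    refine ⟨max N₁ N₂, fun n hn t ht => ?_⟩
    have a1 := hN₁ n (le_of_max_le_left hn)
    have a2 := hN₂ n (le_of_max_le_right hn)
    have := le_of_le_add_integral (A := η / W) (by positivity) hκ0 (hec n) (fun t ht => by
      have b1 := hvest n t ht
      have b2 := hgest n t ht
      have b3 := a1 t ht
      have tri : ∀ x y z : X, ‖x - z‖ ^ 2 ≤ 2 * ‖x - y‖ ^ 2 + 2 * ‖y - z‖ ^ 2 := fun x y z => by
        have := pow_le_pow_left₀ (norm_nonneg _) (norm_sub_le_norm_sub_add_norm_sub x y z) 2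
        nlinarith [sq_nonneg (‖x - y‖ - ‖y - z‖)]
      have b4 := tri (sn n t) (xn n t) (s t)
      have b5 := tri (rn n t) (yn n t) (r t)
      simp only [he] at b1 b2 ⊢
      rw [hκ, add_mul]
      linarith) t ht
    rwa [← hW, div_mul_cancel₀ _ hW0.ne'] at this
  have hptw : ∀ f : ℕ → ℝ → X, ∀ l : ℝ → X, (∀ n, ∀ t ∈ Icc 0 T, ‖f n t - l t‖ ^ 2 ≤ e n t) →
      ∀ t ∈ Icc 0 T, Tendsto (fun n => f n t) atTop (𝓝 (l t)) := by
    intro f l hfl t ht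
    rw [Metric.tendsto_atTop]
    intro η hη
    obtain ⟨N, hN⟩ := hconv (η ^ 2 / 2) (by positivity)
    refine ⟨N, fun n hn => ?_⟩
    rw [dist_eq_norm]
    refine lt_of_pow_lt_pow_left₀ 2 hη.le ?_
    linarith [hfl n t ht, hN n hn t ht, sq_pos_of_pos hη]
  have hvl := hptw vn v fun n t _ => by
    simp only [he]; nlinarith [sq_nonneg ‖sn n t - s t‖, sq_nonneg ‖rn n t - r t‖]
  have hsl := hptw sn s fun n t _ => by
    simp only [he]; nlinarith [sq_nonneg ‖vn n t - v t‖, sq_nonneg ‖rn n t - r t‖]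
  have hrl := hptw rn r fun n t _ => by
    simp only [he]; nlinarith [sq_nonneg ‖vn n t - v t‖, sq_nonneg ‖sn n t - s t‖]
  -- the limit of `qn`
  set q : ℝ → X := fun t => D.ι Q₀ + ∫ τ in (0 : ℝ)..t, s τ with hq
  have hqd : ∀ t, HasDerivAt q (s t) t := fun t =>
    (hsc.integral_hasStrictDerivAt 0 t).hasDerivAt.const_add _
  have hqc : Continuous q := continuous_iff_continuousAt.2 fun t => (hqd t).continuousAt
  have hq0 : q 0 = D.ι Q₀ := by simp [hq]
  have hql : ∀ t ∈ Icc 0 T, Tendsto (fun n => qn n t) atTop (𝓝 (q t)) := by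
    intro t ht
    rw [Metric.tendsto_atTop]
    intro η hη
    obtain ⟨N, hN⟩ := hconv (η ^ 2 / (2 * (Real.exp T * (T + 1)))) (by positivity)
    refine ⟨N, fun n hnN => ?_⟩
    rw [dist_eq_norm]
    refine lt_of_pow_lt_pow_left₀ 2 hη.le ?_
    have hd : ∀ t ∈ Icc 0 T, HasDerivWithinAt (fun t => qn n t - q t)
        (sn n t - s t) (Icc 0 T) t := fun t ht =>
      ((hn n t ht).1.sub (hqd t).hasDerivWithinAt).congr_deriv (by rw [add_zero])
    have h1 := gronwall_integral zero_le_one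
      (φ := fun t => e n t) (hec n) (fun t _ => he0 n t) (fun t ht => (hd t ht).norm_sq)
      (fun t ht => by
        have e1 := real_inner_le_norm (qn n t - q t) (sn n t - s t)
        simp only [he]
        nlinarith [sq_nonneg (‖qn n t - q t‖ - ‖sn n t - s t‖), sq_nonneg ‖vn n t - v t‖,
          sq_nonneg ‖rn n t - r t‖]) t ht
    rw [hqn, hq0, sub_self, norm_zero, one_mul] at h1
    have h2 := integral_le_of_le (hec n) (by positivity) (hN n hnN) ht
    have h3 : Real.exp t ≤ Real.exp T := Real.exp_le_exp.2 ht.2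
    set G := η ^ 2 / (2 * (Real.exp T * (T + 1))) with hG
    have hG0 : 0 < G := by positivity
    have h4 : 0 ≤ ∫ τ in (0 : ℝ)..t, e n τ := intervalIntegral.integral_nonneg ht.1 fun _ _ => he0 n _
    calc _ ≤ Real.exp t * (0 ^ 2 + ∫ τ in (0 : ℝ)..t, e n τ) := h1
      _ ≤ Real.exp T * (0 ^ 2 + T * G) :=
          mul_le_mul h3 (by linarith) (by linarith) (Real.exp_pos _).le
      _ ≤ Real.exp T * ((T + 1) * G) := by
          gcongr
          nlinarith
      _ = η ^ 2 / 2 := by rw [hG]; field_simp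
      _ < η ^ 2 := by linarith [sq_pos_of_pos hη]
  have hVg : ∀ t ∈ Icc 0 T, D.ι (D.ρ 1 (v t + s t)) = v t ∧ D.S (D.ρ 1 (v t + s t)) = s t :=
    fun t ht => graph_closed (hvl t ht) (hsl t ht)
  have hQg : ∀ t ∈ Icc 0 T, D.ι (D.ρ 1 (q t + -r t)) = q t ∧ D.S (D.ρ 1 (q t + -r t)) = -r t :=
    fun t ht => graph_closed (hql t ht) (by simpa [hrn] using (hrl t ht).neg)
  have hρ1 := fun y => D.res_left 1 one_pos y
  simp only [one_smul] at hρ1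
  -- Writing `y = ρ 1 (ι y + S y)` makes continuity into `Y` immediate from continuity of `v`, `s`,
  -- `q`, `r` in `X`.
  refine ⟨fun t => D.ρ 1 (v t + s t), fun t => D.ρ 1 (q t + -r t), by fun_prop, by fun_prop,
    by simp only [hv0, hs0, hρ1], by simp only [hq0, hr0, neg_neg, hρ1], fun t ht => ⟨?_, ?_⟩⟩
  · refine ((hvd t ht).congr (fun τ hτ => (hVg τ hτ).1) (hVg t ht).1).congr_deriv ?_
    rw [(hVg t ht).1, (hQg t ht).2, map_neg]
    abel
  · exact ((hqd t).hasDerivWithinAt.congr (fun τ hτ => (hQg τ hτ).1) (hQg t ht).1).congr_deriv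
      (hVg t ht).2.symm

end EvolutionData

/-! ### Weak derivatives and test functions. -/

namespace BeamEq

theorem IsTestFunction.iterate_deriv {φ : ℝ → ℝ} (hφ : IsTestFunction φ) (n : ℕ) :
    IsTestFunction (_root_.deriv^[n] φ) := by
  induction n with
  | zero => exact hφ
  | succ n ih => rw [Function.iterate_succ_apply']; exact ih.deriv

theorem IsTestFunction.hasDerivAt {φ : ℝ → ℝ} (hφ : IsTestFunction φ) (x : ℝ) :
    HasDerivAt φ (_root_.deriv φ x) x :=
  (hφ.1.differentiable (by simp) x).hasDerivAt

/-- A test function as an element of `L²`. -/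
noncomputable def testL2 {φ : ℝ → ℝ} (hφ : IsTestFunction φ) : L2 := hφ.memLp.toLp φ

theorem inner_testL2 (f : L2) {φ : ℝ → ℝ} (hφ : IsTestFunction φ) :
    ⟪f, testL2 hφ⟫_ℝ = ∫ x, f x * φ x := by
  rw [L2.inner_def]
  refine integral_congr_ae ?_
  filter_upwards [hφ.memLp.coeFn_toLp] with x hx
  rw [testL2, hx]
  simp [mul_comm]

theorem hasWeakDeriv_iff {f g : L2} : HasWeakDeriv f g ↔
    ∀ φ (hφ : IsTestFunction φ), ⟪f, testL2 hφ.deriv⟫_ℝ + ⟪g, testL2 hφ⟫_ℝ = 0 := by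
  simp only [inner_testL2, HasWeakDeriv, ← eq_neg_iff_add_eq_zero]

theorem HasWeakDeriv.add {f f' g g' : L2} (h : HasWeakDeriv f f') (h' : HasWeakDeriv g g') :
    HasWeakDeriv (f + g) (f' + g') := by
  rw [hasWeakDeriv_iff] at *
  intro φ hφ
  rw [inner_add_left, inner_add_left]
  linarith [h φ hφ, h' φ hφ]

theorem HasWeakDeriv.smul {f f' : L2} (h : HasWeakDeriv f f') (c : ℝ) :
    HasWeakDeriv (c • f) (c • f') := by
  rw [hasWeakDeriv_iff] at *
  intro φ hφ
  rw [real_inner_smul_left, real_inner_smul_left, ← mul_add, h φ hφ, mul_zero]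

theorem HasWeakDeriv.neg {f f' : L2} (h : HasWeakDeriv f f') : HasWeakDeriv (-f) (-f') := by
  simpa using h.smul (-1)

theorem eq_zero_of_inner_testL2 {f : L2}
    (h : ∀ φ (hφ : IsTestFunction φ), ⟪f, testL2 hφ⟫_ℝ = 0) : f = 0 := by
  have h0 : HasWeakDeriv 0 f := by
    rw [hasWeakDeriv_iff]
    intro φ hφ
    rw [inner_zero_left, zero_add, h φ hφ]
  have h1 : HasWeakDeriv 0 0 := by
    rw [hasWeakDeriv_iff]
    intro φ hφ
    rw [inner_zero_left, inner_zero_left, add_zero]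
  exact h0.unique h1

theorem hasWeakDeriv_testL2 {φ : ℝ → ℝ} (hφ : IsTestFunction φ) :
    HasWeakDeriv (testL2 hφ) (testL2 hφ.deriv) := by
  intro ψ hψ
  have e : ∀ {χ : ℝ → ℝ} (hχ : IsTestFunction χ) (η : ℝ → ℝ),
      ∫ x, testL2 hχ x * η x = ∫ x, χ x * η x := fun hχ η => by
    refine integral_congr_ae ?_
    filter_upwards [hχ.memLp.coeFn_toLp] with x hx
    rw [testL2, hx]
  rw [e, e]
  have hi : ∀ {χ η : ℝ → ℝ}, IsTestFunction χ → IsTestFunction η → Integrable (χ * η) :=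
    fun hχ hη => (hχ.1.continuous.mul hη.1.continuous).integrable_of_hasCompactSupport
      (hη.2.mul_left)
  exact integral_mul_deriv_eq_deriv_mul_of_integrable (fun x _ => hφ.hasDerivAt x)
    (fun x _ => hψ.hasDerivAt x) (hi hφ hψ.deriv) (hi hφ.deriv hψ) (hi hφ hψ)

theorem isTestFunction_translate {φ : ℝ → ℝ} (hφ : IsTestFunction φ) (y : ℝ) :
    IsTestFunction fun x => φ (x - y) :=
  ⟨hφ.1.comp (contDiff_id.sub contDiff_const),
    hφ.2.comp_homeomorph (Homeomorph.subRight y)⟩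

theorem deriv_translate (φ : ℝ → ℝ) (y : ℝ) :
    deriv (fun x => φ (x - y)) = fun x => deriv φ (x - y) := by
  ext x
  exact deriv_comp_sub_const φ y x

theorem norm_testL2_translate {φ : ℝ → ℝ} (hφ : IsTestFunction φ) (y : ℝ) :
    ‖testL2 (isTestFunction_translate hφ y)‖ = ‖testL2 hφ‖ := by
  rw [testL2, testL2, Lp.norm_toLp, Lp.norm_toLp]
  congr 1
  exact eLpNorm_comp_measurePreserving hφ.1.continuous.aestronglyMeasurable
    (measurePreserving_sub_right volume y)

/-- As a function of `y` the pairing is the convolution of `w` with the reflected test function, and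
the derivative falls on the smooth factor. -/
theorem hasDerivAt_inner_translate (w : L2) {φ : ℝ → ℝ} (hφ : IsTestFunction φ) (y : ℝ) :
    HasDerivAt (fun y => ∫ x, w x * φ (x - y)) (-∫ x, w x * deriv φ (x - y)) y := by
  set χ : ℝ → ℝ := fun x => φ (-x) with hχ
  have hχt : IsTestFunction χ :=
    ⟨hφ.1.comp contDiff_neg, hφ.2.comp_homeomorph (Homeomorph.neg ℝ)⟩
  have hd : ∀ x, deriv χ x = -deriv φ (-x) := fun x => by
    rw [hχ, deriv_comp_neg]
  have h := hχt.2.hasDerivAt_convolution_right (ContinuousLinearMap.mul ℝ ℝ)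
    ((Lp.memLp w).locallyIntegrable (by norm_num)) (hχt.1.of_le (by simp)) y (μ := volume)
  have e1 : convolution w χ (ContinuousLinearMap.mul ℝ ℝ) volume =
      fun y => ∫ x, w x * φ (x - y) := by
    ext y
    simp [convolution_def, hχ]
  have e2 : convolution w (deriv χ) (ContinuousLinearMap.mul ℝ ℝ) volume y =
      -∫ x, w x * deriv φ (x - y) := by
    rw [← integral_neg]
    simp [convolution_def, hd]
  rwa [e1, e2] at h

/-- Pairing with translates of a test function gives a bounded solution of `W' = c W` on the line,
which must vanish. -/
theorem HasWeakDeriv.eq_zero_of_smul {w : L2} {c : ℝ} (hc : c ≠ 0) (h : HasWeakDeriv w (c • w)) :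
    w = 0 := by
  refine eq_zero_of_inner_testL2 fun φ hφ => ?_
  set W : ℝ → ℝ := fun y => ∫ x, w x * φ (x - y) with hW
  have hWd : ∀ y, HasDerivAt W (c * W y) y := by
    intro y
    have h1 := hasDerivAt_inner_translate w hφ y
    have h2 := h _ (isTestFunction_translate hφ y)
    rw [deriv_translate, integral_smul_mul] at h2
    rwa [h2, neg_neg] at h1
  have hb : ∀ y, |W y| ≤ ‖w‖ * ‖testL2 hφ‖ := by
    intro y
    have h1 := abs_real_inner_le_norm w (testL2 (isTestFunction_translate hφ y))
    rwa [inner_testL2, norm_testL2_translate] at h1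
  have hconst : ∀ y, Real.exp (-(c * y)) * W y = W 0 := by
    intro y
    have hd : ∀ y, HasDerivAt (fun y => Real.exp (-(c * y)) * W y) 0 y := by
      intro y
      have e : HasDerivAt (fun y : ℝ => -(c * y)) (-c) y := by
        simpa using ((hasDerivAt_id y).const_mul c).fun_neg
      exact (e.exp.mul (hWd y)).congr_deriv (by ring)
    have := is_const_of_deriv_eq_zero (fun y => (hd y).differentiableAt)
      (fun y => (hd y).deriv) y 0
    simpa using this
  have hW0 : W 0 = 0 := by
    have hle : ∀ n : ℕ, |W 0| ≤ Real.exp (-(n : ℝ)) * (‖w‖ * ‖testL2 hφ‖) := by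
      intro n
      -- The point `n / c` makes the exponential equal `exp (-n)` for either sign of `c`.
      rw [← hconst (n / c), abs_mul, Real.abs_exp, mul_div_cancel₀ _ hc]
      gcongr
      exact hb _
    have hlim : Tendsto (fun n : ℕ => Real.exp (-(n : ℝ)) * (‖w‖ * ‖testL2 hφ‖)) atTop (𝓝 0) := by
      simpa using (Real.tendsto_exp_neg_atTop_nhds_zero.comp
        tendsto_natCast_atTop_atTop).mul_const (‖w‖ * ‖testL2 hφ‖)
    exact abs_nonpos_iff.1 (ge_of_tendsto' hlim hle)
  rw [inner_testL2]
  simpa [hW] using hW0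

/-! ### Sobolev spaces and the resolvent of `-∂²`. -/

section Sobolev

/-- The weak derivative as a continuous linear map. -/
noncomputable def wderivL {k : ℕ} (j : Fin (k + 1)) : H k →L[ℝ] L2 :=
  (PiLp.proj 2 (fun _ : Fin (k + 1) => L2) j : PiLp 2 (fun _ : Fin (k + 1) => L2) →L[ℝ] L2) ∘L
    (H k).subtypeL

@[simp] theorem wderivL_apply {k : ℕ} (j : Fin (k + 1)) (u : H k) : wderivL j u = wderiv j u := rfl

theorem isClosed_H (k : ℕ) : IsClosed (H k : Set (PiLp 2 (fun _ : Fin (k + 1) => L2))) := by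
  have : (H k : Set (PiLp 2 (fun _ : Fin (k + 1) => L2))) =
      ⋂ j : Fin k, ⋂ φ : ℝ → ℝ, ⋂ hφ : IsTestFunction φ,
        {U | ⟪U j.castSucc, testL2 hφ.deriv⟫_ℝ + ⟪U j.succ, testL2 hφ⟫_ℝ = 0} := by
    ext U
    simp only [mem_iInter, mem_ofPred_eq, SetLike.mem_coe, ← hasWeakDeriv_iff]
    rfl
  rw [this]
  refine isClosed_iInter fun j => isClosed_iInter fun φ => isClosed_iInter fun hφ => ?_
  exact isClosed_eq (by fun_prop) continuous_const

instance (k : ℕ) : CompleteSpace (H k) := (isClosed_H k).completeSpace_coe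

/-- Continuous linear maps into `Hᵏ` from their components. -/
noncomputable def mkH {k : ℕ} {E : Type*} [NormedAddCommGroup E] [NormedSpace ℝ E]
    (L : Fin (k + 1) → E →L[ℝ] L2)
    (h : ∀ e, ∀ j : Fin k, HasWeakDeriv (L j.castSucc e) (L j.succ e)) : E →L[ℝ] H k :=
  ((PiLp.continuousLinearEquiv 2 ℝ (fun _ : Fin (k + 1) => L2)).symm.toContinuousLinearMap ∘L
    ContinuousLinearMap.pi L).codRestrict (H k) h

theorem wderiv_mkH {k : ℕ} {E : Type*} [NormedAddCommGroup E] [NormedSpace ℝ E]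
    (L : Fin (k + 1) → E →L[ℝ] L2)
    (h : ∀ e, ∀ j : Fin k, HasWeakDeriv (L j.castSucc e) (L j.succ e)) (e : E) (j : Fin (k + 1)) :
    wderiv j (mkH L h e) = L j e := rfl

theorem inner_H {k : ℕ} (u v : H k) : ⟪u, v⟫_ℝ = ∑ j, ⟪wderiv j u, wderiv j v⟫_ℝ :=
  PiLp.inner_apply _ _

theorem norm_sq_H {k : ℕ} (u : H k) : ‖u‖ ^ 2 = ∑ j, ‖wderiv j u‖ ^ 2 :=
  PiLp.norm_sq_eq_of_L2 _ _

/-- A test function as an element of `Hᵏ`. -/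
noncomputable def testH (k : ℕ) {φ : ℝ → ℝ} (hφ : IsTestFunction φ) : H k :=
  ⟨WithLp.toLp 2 fun j => testL2 (hφ.iterate_deriv j), fun j => by
    have h := hasWeakDeriv_testL2 (hφ.iterate_deriv j)
    have e : testL2 (hφ.iterate_deriv j).deriv = testL2 (hφ.iterate_deriv (j + 1)) := by
      simp only [Function.iterate_succ_apply']
    rw [e] at h
    exact h⟩

/-- An `H¹` function from a function and its weak derivative. -/
noncomputable def mkH1 {f f' : L2} (h : HasWeakDeriv f f') : H 1 :=
  ⟨WithLp.toLp 2 ![f, f'], fun j => by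
    fin_cases j
    exact h⟩

/-- An element `g` orthogonal to all test functions in `H¹` satisfies `g'' = g` weakly. Then `g +
g'` and `g - g'` are eigenvectors of `∂` with eigenvalues `1` and `-1`, hence zero. -/
theorem dense_testH : Dense ((Submodule.span ℝ
    {u : H 1 | ∃ φ, ∃ hφ : IsTestFunction φ, u = testH 1 hφ} : Submodule ℝ (H 1)) : Set (H 1)) := by
  rw [Submodule.dense_iff_topologicalClosure_eq_top, Submodule.topologicalClosure_eq_top_iff,
    Submodule.eq_bot_iff]
  intro g hg
  have h1 : HasWeakDeriv (wderiv 0 g) (wderiv 1 g) := g.2 0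
  have h2 : HasWeakDeriv (wderiv 1 g) (wderiv 0 g) := by
    rw [hasWeakDeriv_iff]
    intro φ hφ
    have := (Submodule.mem_orthogonal' _ _).1 hg (testH 1 hφ)
      (Submodule.subset_span ⟨φ, hφ, rfl⟩)
    rw [inner_H, Fin.sum_univ_two] at this
    rw [add_comm]
    exact this
  have h3 : wderiv 0 g + wderiv 1 g = 0 := by
    refine HasWeakDeriv.eq_zero_of_smul one_ne_zero ?_
    rw [one_smul]
    convert h1.add h2 using 1
    exact add_comm _ _
  have h4 : wderiv 0 g + -wderiv 1 g = 0 := by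
    refine HasWeakDeriv.eq_zero_of_smul (c := -1) (by norm_num) ?_
    convert h1.add h2.neg using 1
    module
  refine toL2_injective ?_
  have h5 : (2 : ℝ) • wderiv 0 g = 0 := by
    have : (2 : ℝ) • wderiv 0 g =
      (wderiv 0 g + wderiv 1 g) + (wderiv 0 g + -wderiv 1 g) := by module
    rw [this, h3, h4, add_zero]
  exact (smul_eq_zero.1 h5).resolve_left (by norm_num)

/-- Integration by parts. -/
theorem HasWeakDeriv.inner_eq {f f' g g' : L2} (hf : HasWeakDeriv f f') (hg : HasWeakDeriv g g') :
    ⟪f, g'⟫_ℝ = -⟪f', g⟫_ℝ := by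
  -- For fixed `g`, the defect in integration by parts is a continuous functional on `H¹`. It
  -- vanishes on test functions by the definition of the weak derivative, hence everywhere.
  let Λ : H 1 →L[ℝ] ℝ := innerSL ℝ g' ∘L wderivL 0 + innerSL ℝ g ∘L wderivL 1
  have hΛ : Λ = 0 := by
    refine ContinuousLinearMap.ext_on dense_testH ?_
    rintro _ ⟨φ, hφ, rfl⟩
    have h := hasWeakDeriv_iff.1 hg φ hφ
    change ⟪g', testL2 hφ⟫_ℝ + ⟪g, testL2 hφ.deriv⟫_ℝ = 0
    linarith
  have h := congrArg (fun L : H 1 →L[ℝ] ℝ => L (mkH1 hf)) hΛ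
  change ⟪g', f⟫_ℝ + ⟪g, f'⟫_ℝ = 0 at h
  rw [real_inner_comm f g', real_inner_comm f' g] at *
  linarith

theorem inner_wderiv_two (x y : H 2) :
    ⟪wderiv 2 x, wderiv 0 y⟫_ℝ = -⟪wderiv 1 x, wderiv 1 y⟫_ℝ := by
  have hx : HasWeakDeriv (wderiv 1 x) (wderiv 2 x) := x.2 1
  have hy : HasWeakDeriv (wderiv 0 y) (wderiv 1 y) := y.2 0
  rw [hx.inner_eq hy, neg_neg]

/-- The form `⟨u, v⟩ + ε ⟨u', v'⟩` on `H¹`. -/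
noncomputable def resolventForm (ε : ℝ) : H 1 →L[ℝ] H 1 →L[ℝ] ℝ :=
  ((innerSL ℝ : L2 →L[ℝ] L2 →L[ℝ] ℝ).comp (wderivL 0)).flip.comp (wderivL 0) +
    ε • ((innerSL ℝ : L2 →L[ℝ] L2 →L[ℝ] ℝ).comp (wderivL 1)).flip.comp (wderivL 1)

theorem resolventForm_apply (ε : ℝ) (u v : H 1) : resolventForm ε u v =
    ⟪wderiv 0 u, wderiv 0 v⟫_ℝ + ε * ⟪wderiv 1 u, wderiv 1 v⟫_ℝ := by
  rw [real_inner_comm (wderiv 0 v), real_inner_comm (wderiv 1 v)]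
  rfl

theorem isCoercive_resolventForm {ε : ℝ} (hε : 0 < ε) : IsCoercive (resolventForm ε) := by
  refine ⟨min 1 ε, lt_min one_pos hε, fun u => ?_⟩
  rw [resolventForm_apply, real_inner_self_eq_norm_sq, real_inner_self_eq_norm_sq, mul_assoc,
    ← sq, norm_sq_H, Fin.sum_univ_two, mul_add]
  have h1 : min 1 ε * ‖wderiv 0 u‖ ^ 2 ≤ 1 * ‖wderiv 0 u‖ ^ 2 := by
    gcongr; exact min_le_left _ _
  have h2 : min 1 ε * ‖wderiv 1 u‖ ^ 2 ≤ ε * ‖wderiv 1 u‖ ^ 2 := by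
    gcongr; exact min_le_right _ _
  linarith

/-- The solution `u ∈ H¹` of `u - ε u'' = f`. -/
noncomputable def resolventH1 {ε : ℝ} (hε : 0 < ε) : L2 →L[ℝ] H 1 :=
  (isCoercive_resolventForm hε).continuousLinearEquivOfBilin.symm.toContinuousLinearMap ∘L
    (wderivL 0).adjoint

theorem resolventH1_spec {ε : ℝ} (hε : 0 < ε) (f : L2) (v : H 1) :
    ⟪wderiv 0 (resolventH1 hε f), wderiv 0 v⟫_ℝ +
      ε * ⟪wderiv 1 (resolventH1 hε f), wderiv 1 v⟫_ℝ = ⟪f, wderiv 0 v⟫_ℝ := by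
  have h := (isCoercive_resolventForm hε).continuousLinearEquivOfBilin_apply (resolventH1 hε f) v
  rw [resolventForm_apply] at h
  rw [← h]
  simp only [resolventH1, ContinuousLinearMap.comp_apply, ContinuousLinearEquiv.coe_coe,
    ContinuousLinearEquiv.apply_symm_apply, ContinuousLinearMap.adjoint_inner_left, wderivL_apply]

/-- Testing the variational identity with test functions shows that the Lax-Milgram solution has a
second weak derivative in `L²`. -/
theorem hasWeakDeriv_resolventH1 {ε : ℝ} (hε : 0 < ε) (f : L2) :
    HasWeakDeriv (wderiv 1 (resolventH1 hε f)) (ε⁻¹ • (wderiv 0 (resolventH1 hε f) - f)) := by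
  rw [hasWeakDeriv_iff]
  intro φ hφ
  have h : ⟪wderiv 0 (resolventH1 hε f), testL2 hφ⟫_ℝ +
      ε * ⟪wderiv 1 (resolventH1 hε f), testL2 hφ.deriv⟫_ℝ = ⟪f, testL2 hφ⟫_ℝ :=
    resolventH1_spec hε f (testH 1 hφ)
  rw [real_inner_smul_left, inner_sub_left, ← h]
  field_simp
  ring

/-- The resolvent `(1 - ε ∂²)⁻¹ : L² → H²` for `ε > 0`. -/
noncomputable def resolventPos {ε : ℝ} (hε : 0 < ε) : L2 →L[ℝ] H 2 :=
  mkH (k := 2) ![wderivL 0 ∘L resolventH1 hε, wderivL 1 ∘L resolventH1 hε,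
    ε⁻¹ • (wderivL 0 ∘L resolventH1 hε - ContinuousLinearMap.id ℝ L2)] (by
      intro f j
      fin_cases j
      · exact (resolventH1 hε f).2 0
      · exact hasWeakDeriv_resolventH1 hε f)

/-- The resolvent `(1 - ε ∂²)⁻¹ : L² → H²`, by convention zero for `ε ≤ 0`. -/
noncomputable def resolvent (ε : ℝ) : L2 →L[ℝ] H 2 :=
  if hε : 0 < ε then resolventPos hε else 0

theorem wderiv_two_resolvent {ε : ℝ} (hε : 0 < ε) (f : L2) :
    wderiv 2 (resolvent ε f) = ε⁻¹ • (wderiv 0 (resolvent ε f) - f) := by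
  rw [resolvent, dif_pos hε, resolventPos, wderiv_mkH, wderiv_mkH]
  rfl

theorem resolvent_right {ε : ℝ} (hε : 0 < ε) (f : L2) :
    wderivL 0 (resolvent ε f) + ε • (-wderivL 2) (resolvent ε f) = f := by
  rw [neg_apply, wderivL_apply, wderivL_apply, wderiv_two_resolvent hε,
    smul_neg, smul_smul, mul_inv_cancel₀ hε.ne', one_smul]
  abel

/-- By the right inverse property this is injectivity of `1 - ε ∂²` on `H²`: pairing `z - ε z'' = 0`
with `z` gives `‖z‖² + ε ‖z'‖² = 0`. -/
theorem resolvent_left {ε : ℝ} (hε : 0 < ε) (y : H 2) :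
    resolvent ε (wderivL 0 y + ε • (-wderivL 2) y) = y := by
  set z := resolvent ε (wderivL 0 y + ε • (-wderivL 2) y) - y with hz
  have h1 : wderivL 0 z + ε • (-wderivL 2) z = 0 := by
    rw [hz, map_sub, map_sub, smul_sub, sub_add_sub_comm, resolvent_right hε, sub_self]
  have h2 : ⟪wderiv 0 z + ε • -wderiv 2 z, wderiv 0 z⟫_ℝ = 0 := by
    have h1' : wderiv 0 z + ε • -wderiv 2 z = 0 := h1
    rw [h1', inner_zero_left]
  rw [inner_add_left, real_inner_smul_left, inner_neg_left, inner_wderiv_two, neg_neg,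
    real_inner_self_eq_norm_sq, real_inner_self_eq_norm_sq] at h2
  have h3 : ‖wderiv 0 z‖ = 0 := by
    have : ‖wderiv 0 z‖ ^ 2 = 0 := by
      nlinarith [sq_nonneg ‖wderiv 0 z‖, mul_nonneg hε.le (sq_nonneg ‖wderiv 1 z‖)]
    exact pow_eq_zero_iff (two_ne_zero) |>.1 this
  have h4 : z = 0 := toL2_injective (norm_eq_zero.1 h3)
  exact sub_eq_zero.1 h4

theorem denseRange_wderivL_zero : DenseRange (wderivL 0 : H 2 →L[ℝ] L2) := by
  have : Dense ((wderivL 0 : H 2 →L[ℝ] L2).range : Set L2) := by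
    rw [Submodule.dense_iff_topologicalClosure_eq_top, Submodule.topologicalClosure_eq_top_iff,
      Submodule.eq_bot_iff]
    intro f hf
    refine eq_zero_of_inner_testL2 fun φ hφ => ?_
    exact (Submodule.mem_orthogonal' _ _).1 hf (testL2 hφ) ⟨testH 2 hφ, rfl⟩
  exact this

end Sobolev

end BeamEq

/-! ### Multiplication operators and moving coefficients. -/

namespace BeamEq

open scoped BoundedContinuousFunction

theorem memLp_bcf_mul (c : ℝ →ᵇ ℝ) (f : L2) : MemLp (fun x => c x * f x) 2 volume := by
  refine MemLp.of_le_mul (c := ‖c‖) (Lp.memLp f)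
    (c.continuous.aestronglyMeasurable.mul (Lp.aestronglyMeasurable f)) (.of_forall fun x => ?_)
  rw [norm_mul]
  gcongr
  exact c.norm_coe_le_norm x

/-- Multiplication of `L²` functions by bounded continuous functions. -/
noncomputable def mulL : (ℝ →ᵇ ℝ) →L[ℝ] L2 →L[ℝ] L2 :=
  LinearMap.mkContinuous₂ (LinearMap.mk₂ ℝ (fun c f => (memLp_bcf_mul c f).toLp _)
    (fun c d f => by
      rw [← MemLp.toLp_add]
      exact MemLp.toLp_congr _ _ (.of_forall fun x => by simp [add_mul]))
    (fun r c f => by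
      rw [← MemLp.toLp_const_smul]
      exact MemLp.toLp_congr _ _ (.of_forall fun x => by simp [mul_assoc]))
    (fun c f g => by
      rw [← MemLp.toLp_add]
      refine MemLp.toLp_congr _ _ ?_
      filter_upwards [Lp.coeFn_add f g] with x hx
      rw [hx, Pi.add_apply, Pi.add_apply, mul_add])
    (fun r c f => by
      rw [← MemLp.toLp_const_smul]
      refine MemLp.toLp_congr _ _ ?_
      filter_upwards [Lp.coeFn_smul r f] with x hx
      rw [hx, Pi.smul_apply, Pi.smul_apply, smul_eq_mul, smul_eq_mul, mul_left_comm]))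
    1 (fun c f => by
      rw [one_mul]
      refine Lp.norm_le_mul_norm_of_ae_le_mul ?_
      filter_upwards [(memLp_bcf_mul c f).coeFn_toLp] with x hx
      simp only [LinearMap.mk₂_apply]
      rw [hx, norm_mul]
      gcongr
      exact c.norm_coe_le_norm x)

theorem coeFn_mulL (c : ℝ →ᵇ ℝ) (f : L2) : mulL c f =ᵐ[volume] fun x => c x * f x :=
  (memLp_bcf_mul c f).coeFn_toLp

theorem mulL_mulL (c d : ℝ →ᵇ ℝ) (f : L2) : mulL c (mulL d f) = mulL (c * d) f := by
  refine Lp.ext ?_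
  filter_upwards [coeFn_mulL c (mulL d f), coeFn_mulL d f, coeFn_mulL (c * d) f] with x h1 h2 h3
  rw [h1, h2, h3, BoundedContinuousFunction.mul_apply, mul_assoc]

theorem mulL_one (f : L2) : mulL 1 f = f := by
  refine Lp.ext ?_
  filter_upwards [coeFn_mulL 1 f] with x h1
  rw [h1, BoundedContinuousFunction.coe_one, Pi.one_apply, one_mul]

theorem inner_mulL (c : ℝ →ᵇ ℝ) (f g : L2) : ⟪mulL c f, g⟫_ℝ = ∫ x, c x * (f x * g x) := by
  rw [L2.inner_def]
  refine integral_congr_ae ?_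
  filter_upwards [coeFn_mulL c f] with x hx
  rw [hx]
  simp only [RCLike.inner_apply, conj_trivial]
  ring

theorem mulL_symm (c : ℝ →ᵇ ℝ) (f g : L2) : ⟪mulL c f, g⟫_ℝ = ⟪f, mulL c g⟫_ℝ := by
  rw [inner_mulL, real_inner_comm, inner_mulL]
  simp only [mul_comm]

theorem inner_mulL_nonneg {c : ℝ →ᵇ ℝ} (hc : ∀ x, 0 ≤ c x) (f : L2) : 0 ≤ ⟪f, mulL c f⟫_ℝ := by
  rw [← mulL_symm, inner_mulL]
  exact integral_nonneg fun x => mul_nonneg (hc x) (mul_self_nonneg _)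

/-- The translate `φ(· - y)` of a test function as a bounded continuous function. -/
noncomputable def shift {φ : ℝ → ℝ} (hφ : IsTestFunction φ) (y : ℝ) : ℝ →ᵇ ℝ :=
  BoundedContinuousFunction.ofNormedAddCommGroup (fun x => φ (x - y))
    (hφ.1.continuous.comp (continuous_id.sub continuous_const))
    (hφ.2.exists_bound_of_continuous hφ.1.continuous).choose
    (fun x => (hφ.2.exists_bound_of_continuous hφ.1.continuous).choose_spec (x - y))

@[simp] theorem shift_apply {φ : ℝ → ℝ} (hφ : IsTestFunction φ) (y x : ℝ) :
    shift hφ y x = φ (x - y) := rfl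

theorem continuous_shift {φ : ℝ → ℝ} (hφ : IsTestFunction φ) : Continuous (shift hφ) := by
  have hu := hφ.2.uniformContinuous_of_continuous hφ.1.continuous
  rw [Metric.uniformContinuous_iff] at hu
  rw [Metric.continuous_iff]
  intro y ε hε
  obtain ⟨δ, hδ, h⟩ := hu (ε / 2) (by positivity)
  refine ⟨δ, hδ, fun z hz => ?_⟩
  refine lt_of_le_of_lt ((BoundedContinuousFunction.dist_le (by positivity)).2 fun x => ?_)
    (half_lt_self hε)
  refine (h ?_).le
  rw [Real.dist_eq] at *
  rwa [sub_sub_sub_cancel_left, abs_sub_comm]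

/-- The fundamental theorem of calculus holds at each `x`. Reading the same integral in `ℝ →ᵇ ℝ`
upgrades it to differentiability in the sup norm, which operator norms require. -/
theorem hasDerivAt_shift {φ : ℝ → ℝ} (hφ : IsTestFunction φ) (y : ℝ) :
    HasDerivAt (shift hφ) (-shift hφ.deriv y) y := by
  have hc := continuous_shift hφ.deriv
  have e : shift hφ = fun y => shift hφ 0 - ∫ s in (0 : ℝ)..y, shift hφ.deriv s := by
    ext y x
    have h1 : (∫ s in (0 : ℝ)..y, shift hφ.deriv s) x = ∫ s in (0 : ℝ)..y, deriv φ (x - s) :=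
      ((BoundedContinuousFunction.evalCLM ℝ x).intervalIntegral_comp_comm
        (hc.intervalIntegrable 0 y)).symm
    have h2 : ∫ s in (0 : ℝ)..y, deriv φ (x - s) = -φ (x - y) - -φ (x - 0) := by
      refine intervalIntegral.integral_eq_sub_of_hasDerivAt (f := fun s => -φ (x - s))
        (fun s _ => ?_) ?_
      · have := ((hφ.hasDerivAt (x - s)).comp_const_sub x s).fun_neg
        simpa using this
      · exact (hφ.deriv.1.continuous.comp (continuous_const.sub
          continuous_id)).intervalIntegrable _ _
    rw [BoundedContinuousFunction.sub_apply, h1, h2]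
    simp
  rw [e]
  exact (hc.integral_hasStrictDerivAt 0 y).hasDerivAt.const_sub _

/-- The product of the translated multiplier with a test function is again a test function, so the
classical product rule on that side suffices. -/
theorem HasWeakDeriv.mulL_shift {f f' : L2} (h : HasWeakDeriv f f') {φ : ℝ → ℝ}
    (hφ : IsTestFunction φ) (y : ℝ) :
    HasWeakDeriv (mulL (shift hφ y) f) (mulL (shift hφ.deriv y) f + mulL (shift hφ y) f') := by
  intro ψ hψ
  have hφy := isTestFunction_translate hφ y
  have ht : IsTestFunction fun x => φ (x - y) * ψ x := ⟨hφy.1.mul hψ.1, hψ.2.mul_left⟩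
  have hd : deriv (fun x => φ (x - y) * ψ x) =
      fun x => deriv φ (x - y) * ψ x + φ (x - y) * deriv ψ x := by
    ext x
    have h1 := hφy.hasDerivAt x
    rw [deriv_translate] at h1
    exact (h1.mul (hψ.hasDerivAt x)).deriv
  have h1 := h _ ht
  rw [hd] at h1
  have e : ∀ {χ : ℝ → ℝ} (hχ : IsTestFunction χ) (u : L2) (η : ℝ → ℝ),
      ∫ x, mulL (shift hχ y) u x * η x = ∫ x, u x * (χ (x - y) * η x) := fun hχ u η => by
    refine integral_congr_ae ?_
    filter_upwards [coeFn_mulL (shift hχ y) u] with x hx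
    rw [hx, shift_apply]
    ring
  have hint : ∀ {χ η : ℝ → ℝ}, IsTestFunction χ → IsTestFunction η →
      Integrable (fun x => f x * (χ (x - y) * η x)) volume := fun hχ hη =>
    integrable_mul_test f ⟨(isTestFunction_translate hχ y).1.mul hη.1, hη.2.mul_left⟩
  simp only [mul_add] at h1
  rw [integral_add (hint hφ.deriv hψ) (hint hφ hψ.deriv)] at h1
  rw [integral_add_mul _ _ hψ, e, e, e]
  linarith

/-! ### The beam equation as evolution data. -/

section Data

variable {θ : ℝ → ℝ}

theorem one_add_pos (hθ_nonneg : ∀ x, 0 ≤ θ x) (x : ℝ) : 0 < 1 + θ x := by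
  linarith [hθ_nonneg x]

/-- Dividing a test function by `1 + θ` gives a test function. -/
theorem IsTestFunction.div_one_add {φ : ℝ → ℝ} (hφ : IsTestFunction φ) (hθ : IsTestFunction θ)
    (hθ_nonneg : ∀ x, 0 ≤ θ x) : IsTestFunction fun x => φ x / (1 + θ x) :=
  ⟨hφ.1.div (contDiff_const.add hθ.1) fun x => (one_add_pos hθ_nonneg x).ne', by
    simp only [div_eq_mul_inv]
    exact hφ.2.mul_right⟩

theorem deriv_div_one_add (hθ : IsTestFunction θ) (hθ_nonneg : ∀ x, 0 ≤ θ x) (x : ℝ) :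
    deriv (fun x => θ x / (1 + θ x)) x =
      deriv θ x / (1 + θ x) * (1 - θ x / (1 + θ x)) := by
  have h := (one_add_pos hθ_nonneg x).ne'
  have h1 := (hθ.hasDerivAt x).div ((hθ.hasDerivAt x).const_add 1) h
  refine h1.deriv.trans ?_
  field_simp

/-- Products of `H²` functions with `ψ(· - y)` lie in `H²`, and the Leibniz formula for `∂²`. -/
theorem exists_mulL_shift {ψ : ℝ → ℝ} (hψ : IsTestFunction ψ) (y : ℝ) (u : H 2) :
    ∃ v : H 2, wderiv 0 v = mulL (shift hψ y) (wderiv 0 u) ∧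
      wderiv 2 v = mulL (shift hψ y) (wderiv 2 u) + (mulL (shift hψ.deriv.deriv y) (wderiv 0 u) +
        (2 : ℝ) • mulL (shift hψ.deriv y) (wderiv 1 u)) := by
  have h0 : HasWeakDeriv (wderiv 0 u) (wderiv 1 u) := u.2 0
  have h1 : HasWeakDeriv (wderiv 1 u) (wderiv 2 u) := u.2 1
  have k0 := h0.mulL_shift hψ y
  have k1 := (h0.mulL_shift hψ.deriv y).add (h1.mulL_shift hψ y)
  refine ⟨⟨WithLp.toLp 2 ![mulL (shift hψ y) (wderiv 0 u),
    mulL (shift hψ.deriv y) (wderiv 0 u) + mulL (shift hψ y) (wderiv 1 u),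
    (mulL (shift hψ.deriv.deriv y) (wderiv 0 u) + mulL (shift hψ.deriv y) (wderiv 1 u)) +
      (mulL (shift hψ.deriv y) (wderiv 1 u) + mulL (shift hψ y) (wderiv 2 u))], fun j => ?_⟩,
    rfl, ?_⟩
  · fin_cases j
    · exact k0
    · exact k1
  · change (mulL (shift hψ.deriv.deriv y) (wderiv 0 u) + mulL (shift hψ.deriv y) (wderiv 1 u)) +
      (mulL (shift hψ.deriv y) (wderiv 1 u) + mulL (shift hψ y) (wderiv 2 u)) = _
    module

/-- The abstract evolution equation given by the beam equation with a `C¹` trajectory `Z`. -/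
noncomputable def beamData (hθ : IsTestFunction θ) (hθ_nonneg : ∀ x, 0 ≤ θ x) {Z Z' : ℝ → ℝ}
    (hZ : ∀ t, HasDerivAt Z (Z' t) t) (hZ' : Continuous Z') : EvolutionData L2 (H 2) where
  ι := wderivL 0
  S := -wderivL 2
  ρ := resolvent
  symm x y := by
    have h1 := inner_wderiv_two x y
    have h2 := inner_wderiv_two y x
    simp only [neg_apply, wderivL_apply, inner_neg_left, inner_neg_right]
    rw [real_inner_comm (wderiv 2 y), h1, h2, real_inner_comm]
  nonneg x := by
    simp only [neg_apply, wderivL_apply, inner_neg_left]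
    rw [inner_wderiv_two, neg_neg]
    exact real_inner_self_nonneg
  dense := denseRange_wderivL_zero
  res_right _ hε x := resolvent_right hε x
  res_left _ hε y := resolvent_left hε y
  a t := mulL (1 + shift hθ (Z t))
  -- This is `1 / (1 + θ)`, written as `1` minus a test function so that the calculus of `shift`
  -- applies.
  b t := mulL (1 - shift (hθ.div_one_add hθ hθ_nonneg) (Z t))
  m t := Z' t • mulL (shift (hθ.deriv.div_one_add hθ hθ_nonneg) (Z t))
  -- By Leibniz, `-∂²(μ u) = μ (-∂²u) - (μ'' u + 2 μ' u')`. Only `u` and `u'` occur, so the operator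
  -- is bounded on `H²`.
  C t := -(Z' t • (mulL (shift (hθ.deriv.div_one_add hθ hθ_nonneg).deriv.deriv (Z t)) ∘L wderivL 0 +
    (2 : ℝ) • mulL (shift (hθ.deriv.div_one_add hθ hθ_nonneg).deriv (Z t)) ∘L wderivL 1))
  m_cont := by
    have hZc : Continuous Z := continuous_iff_continuousAt.2 fun t => (hZ t).continuousAt
    exact hZ'.smul (mulL.continuous.comp ((continuous_shift _).comp hZc))
  C_cont := by
    have hZc : Continuous Z := continuous_iff_continuousAt.2 fun t => (hZ t).continuousAt
    have h := fun {χ : ℝ → ℝ} (hχ : IsTestFunction χ) =>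
      mulL.continuous.comp ((continuous_shift hχ).comp hZc)
    exact (hZ'.smul (((h _).clm_comp continuous_const).add
      (((h _).clm_comp continuous_const).const_smul (2 : ℝ)))).neg
  a_deriv t := by
    have h := mulL.hasFDerivAt.comp_hasDerivAt t
      (((hasDerivAt_shift hθ (Z t)).scomp t (hZ t)).const_add 1)
    refine h.congr_deriv ?_
    ext1 f
    simp only [map_smul, map_neg, smul_apply, neg_apply, ContinuousLinearMap.comp_apply, mulL_mulL,
      smul_neg]
    congr 4
    ext x
    have := (one_add_pos hθ_nonneg (x - Z t)).ne'
    simp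
    field_simp
  b_deriv t := by
    have h := mulL.hasFDerivAt.comp_hasDerivAt t
      (((hasDerivAt_shift (hθ.div_one_add hθ hθ_nonneg) (Z t)).scomp t (hZ t)).const_sub 1)
    refine h.congr_deriv ?_
    ext1 f
    simp only [map_smul, smul_apply, ContinuousLinearMap.comp_apply, mulL_mulL, smul_neg, neg_neg]
    congr 3
    ext x
    simp [deriv_div_one_add hθ hθ_nonneg]
  a_b t f := by
    rw [mulL_mulL]
    conv_rhs => rw [← mulL_one f]
    congr 2
    ext x
    have := (one_add_pos hθ_nonneg (x - Z t)).ne'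
    simp
    field_simp
    ring
  b_a t f := by
    rw [mulL_mulL]
    conv_rhs => rw [← mulL_one f]
    congr 2
    ext x
    have := (one_add_pos hθ_nonneg (x - Z t)).ne'
    simp
    field_simp
    ring
  b_symm t f g := mulL_symm _ f g
  c := 1 / (1 + ‖shift hθ 0‖)
  c_pos := by positivity
  b_coercive t f := by
    have hle : ∀ x, θ x ≤ ‖shift hθ 0‖ := fun x => by
      have := (shift hθ 0).norm_coe_le_norm x
      rw [shift_apply, sub_zero] at this
      exact (le_abs_self _).trans this
    have h := inner_mulL_nonneg (c := (1 - shift (hθ.div_one_add hθ hθ_nonneg) (Z t)) -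
      (1 / (1 + ‖shift hθ 0‖)) • 1) (fun x => by
        have h1 := one_add_pos hθ_nonneg (x - Z t)
        have h2 : 1 - θ (x - Z t) / (1 + θ (x - Z t)) = 1 / (1 + θ (x - Z t)) := by
          field_simp
          ring
        have h3 := one_div_le_one_div_of_le h1 (add_le_add_right (hle (x - Z t)) 1)
        simp only [BoundedContinuousFunction.sub_apply, BoundedContinuousFunction.coe_one, Pi.one_apply,
          shift_apply, BoundedContinuousFunction.smul_apply, smul_eq_mul, mul_one, h2]
        linarith) f
    rw [map_sub, map_smul, sub_apply, smul_apply, mulL_one, inner_sub_right, inner_smul_right,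
      real_inner_self_eq_norm_sq] at h
    linarith
  comm t u := by
    obtain ⟨v, hv0, hv2⟩ := exists_mulL_shift (hθ.deriv.div_one_add hθ hθ_nonneg) (Z t) u
    refine ⟨Z' t • v, ?_, ?_⟩
    · rw [map_smul, wderivL_apply, hv0]
      rfl
    · rw [map_smul, neg_apply, wderivL_apply, hv2]
      simp only [neg_apply, smul_apply, add_apply, ContinuousLinearMap.comp_apply, wderivL_apply,
        map_neg]
      module

end Data

end BeamEq

/-! ### A priori estimate for strong solutions. -/

namespace EvolutionData

variable {X Y : Type*} [NormedAddCommGroup X] [InnerProductSpace ℝ X]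
  [NormedAddCommGroup Y] [NormedSpace ℝ Y] {D : EvolutionData X Y} {T : ℝ}

/-- Strong solutions of `U' = V`, `V' = m V - b S Q + g`, `S U = Q`. -/
structure IsStrong (D : EvolutionData X Y) (T : ℝ) (g : ℝ → Y) (U V Q : ℝ → Y) : Prop where
  deriv_U : ∀ t ∈ Icc 0 T, HasDerivWithinAt U (V t) (Icc 0 T) t
  deriv_V : ∀ t ∈ Icc 0 T, HasDerivWithinAt (fun t => D.ι (V t))
    (D.m t (D.ι (V t)) - D.b t (D.S (Q t)) + D.ι (g t)) (Icc 0 T) t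
  graph : ∀ t ∈ Icc 0 T, D.S (U t) = D.ι (Q t)

theorem IsStrong.sub {g g' U V Q U' V' Q' : ℝ → Y} (h : IsStrong D T g U V Q)
    (h' : IsStrong D T g' U' V' Q') :
    IsStrong D T (fun t => g t - g' t) (fun t => U t - U' t) (fun t => V t - V' t)
      (fun t => Q t - Q' t) where
  deriv_U t ht := (h.deriv_U t ht).sub (h'.deriv_U t ht)
  deriv_V t ht := by
    simp only [map_sub]
    refine ((h.deriv_V t ht).sub (h'.deriv_V t ht)).congr_deriv ?_
    abel
  graph t ht := by rw [map_sub, map_sub, h.graph t ht, h'.graph t ht]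

/-- The energy estimate is applied to `q = S U` and `p = a V`, with `S U = ι Q` and symmetry
providing the cancellation. The bound on `U` itself then follows by integrating `U' = V`. -/
theorem IsStrong.estimate (D : EvolutionData X Y) (hT : 0 ≤ T) :
    ∃ M, 0 ≤ M ∧ ∀ g U V Q : ℝ → Y, ContinuousOn g (Icc 0 T) → IsStrong D T g U V Q →
      ∀ t ∈ Icc 0 T, ‖D.S (U t)‖ ^ 2 + ‖D.ι (U t)‖ ^ 2 + ‖D.ι (V t)‖ ^ 2 ≤
        M * (‖D.S (U 0)‖ ^ 2 + ‖D.ι (U 0)‖ ^ 2 + ‖D.ι (V 0)‖ ^ 2 +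
          ∫ s in (0 : ℝ)..t, ‖D.ι (g s)‖ ^ 2) := by
  obtain ⟨B, hB0, hB⟩ := D.exists_bound T
  obtain ⟨M, hM0, hM⟩ := D.energy_estimate T (k := B ^ 4) (by positivity)
  set M₁ := M * (1 + B ^ 2) with hM₁
  have hM₁0 : 0 ≤ M₁ := by positivity
  refine ⟨M₁ + B ^ 2 * M₁ + Real.exp T * (1 + T * (B ^ 2 * M₁)), by positivity, ?_⟩
  intro g U V Q hg h
  have hgc : ContinuousOn (fun t => ‖D.ι (g t)‖ ^ 2) (Icc 0 T) :=
    (D.ι.continuous.comp_continuousOn hg).norm.pow 2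
  have hgi : ∀ t ∈ Icc 0 T, 0 ≤ ∫ s in (0 : ℝ)..t, ‖D.ι (g s)‖ ^ 2 := fun t ht =>
    intervalIntegral.integral_nonneg ht.1 fun _ _ => by positivity
  set N : ℝ → ℝ := fun t => ‖D.S (U 0)‖ ^ 2 + ‖D.ι (U 0)‖ ^ 2 + ‖D.ι (V 0)‖ ^ 2 +
          ∫ s in (0 : ℝ)..t, ‖D.ι (g s)‖ ^ 2 with hN
  have hN0 : ∀ t ∈ Icc 0 T, 0 ≤ N t := fun t ht => by
    have := hgi t ht
    positivity
  have hNmono : ∀ s t, 0 ≤ s → s ≤ t → t ≤ T → N s ≤ N t := by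
    intro s t hs hst htT
    have : ∫ τ in (0 : ℝ)..s, ‖D.ι (g τ)‖ ^ 2 ≤ ∫ τ in (0 : ℝ)..t, ‖D.ι (g τ)‖ ^ 2 := by
      refine intervalIntegral.integral_mono_interval le_rfl hs hst
        (.of_forall fun τ => ?_) ?_
      · simp only [Pi.zero_apply]
        positivity
      · exact (hgc.mono (by
          rw [uIcc_of_le (hs.trans hst)]
          exact Icc_subset_Icc_right htT)).intervalIntegrable
    simp only [hN]
    linarith
  have hd : ∀ t ∈ Icc 0 T, HasDerivWithinAt (fun t => D.a t (D.ι (V t)))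
      (-D.S (Q t) + D.a t (D.ι (g t))) (Icc 0 T) t := by
    intro t ht
    refine ((D.a_deriv t).hasDerivWithinAt.clm_apply (h.deriv_V t ht)).congr_deriv ?_
    rw [map_add, map_sub, D.a_b, neg_apply, ContinuousLinearMap.comp_apply]
    abel
  have hVle : ∀ t ∈ Icc 0 T, ‖D.ι (V t)‖ ^ 2 ≤ B ^ 2 * ‖D.a t (D.ι (V t))‖ ^ 2 := by
    intro t ht
    rw [← mul_pow]
    gcongr
    nth_rewrite 1 [← D.b_a t (D.ι (V t))]
    exact (D.b t).le_of_opNorm_le (hB t ht).2.1 _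
  have hbase : ∀ t ∈ Icc 0 T, ‖D.S (U t)‖ ^ 2 + ‖D.a t (D.ι (V t))‖ ^ 2 ≤ M₁ * N t := by
    intro t ht
    have h1 := hM (fun t => D.S (U t)) (fun t => D.a t (D.ι (V t))) _ _ _ hgc
      (fun _ _ => by positivity)
      (fun t ht => D.S.hasFDerivAt.comp_hasDerivWithinAt t (h.deriv_U t ht)) hd (fun t ht => by
        -- This is the only place where the constraint linking `U` and `Q` enters: it moves `S` from
        -- `V` onto `Q`, to cancel against `p'`.
        have e1 : ⟪D.S (U t), D.S (V t)⟫_ℝ = ⟪D.ι (V t), D.S (Q t)⟫_ℝ := by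
          rw [h.graph t ht, ← D.symm, real_inner_comm]
        have e2 : ‖D.a t (D.ι (g t))‖ ≤ B * ‖D.ι (g t)‖ := (D.a t).le_of_opNorm_le (hB t ht).1 _
        have e3 : ‖D.ι (V t)‖ ≤ B * ‖D.a t (D.ι (V t))‖ := by
          nth_rewrite 1 [← D.b_a t (D.ι (V t))]
          exact (D.b t).le_of_opNorm_le (hB t ht).2.1 _
        have e4 : ⟪D.ι (V t), D.a t (D.ι (g t))⟫_ℝ ≤
            (B * ‖D.a t (D.ι (V t))‖) * (B * ‖D.ι (g t)‖) :=
          (real_inner_le_norm _ _).trans (mul_le_mul e3 e2 (norm_nonneg _) (by positivity))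
        rw [D.b_a, inner_add_right, inner_neg_right, e1]
        have e5 : 0 ≤ B ^ 4 * ‖D.S (U t)‖ ^ 2 := by positivity
        nlinarith [sq_nonneg (B ^ 2 * ‖D.a t (D.ι (V t))‖ - ‖D.ι (g t)‖),
          sq_nonneg (B ^ 2 * ‖D.a t (D.ι (V t))‖), sq_nonneg ‖D.ι (g t)‖]) t ht
    refine h1.trans ?_
    rw [hM₁, mul_assoc]
    refine mul_le_mul_of_nonneg_left ?_ hM0
    have e6 : ‖D.a 0 (D.ι (V 0))‖ ^ 2 ≤ B ^ 2 * ‖D.ι (V 0)‖ ^ 2 := by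
      rw [← mul_pow]
      gcongr
      exact (D.a 0).le_of_opNorm_le (hB 0 (left_mem_Icc.2 hT)).1 _
    have e7 := hgi t ht
    have e8 : 0 ≤ B ^ 2 * (‖D.S (U 0)‖ ^ 2 + ‖D.ι (U 0)‖ ^ 2 +
      ∫ s in (0 : ℝ)..t, ‖D.ι (g s)‖ ^ 2) := by positivity
    have e9 := sq_nonneg ‖D.ι (U 0)‖
    have e10 := sq_nonneg ‖D.ι (V 0)‖
    simp only [hN]
    linarith
  have hV : ∀ t ∈ Icc 0 T, ‖D.ι (V t)‖ ^ 2 ≤ B ^ 2 * M₁ * N t := by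
    intro t ht
    refine (hVle t ht).trans ?_
    rw [mul_assoc]
    gcongr
    linarith [hbase t ht, sq_nonneg ‖D.S (U t)‖]
  intro t ht
  have hVc : ContinuousOn (fun t => ‖D.ι (V t)‖ ^ 2) (Icc 0 T) := fun t ht =>
    (h.deriv_V t ht).continuousWithinAt.norm.pow 2
  have hU : ‖D.ι (U t)‖ ^ 2 ≤ Real.exp T * (1 + T * (B ^ 2 * M₁)) * N t := by
    have h1 := gronwall_integral zero_le_one hVc (fun _ _ => by positivity)
      (fun t ht => (D.ι.hasFDerivAt.comp_hasDerivWithinAt t (h.deriv_U t ht)).norm_sq)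
      (fun t ht => by
        have e1 := real_inner_le_norm (D.ι (U t)) (D.ι (V t))
        simp only [Function.comp_apply]
        nlinarith [sq_nonneg (‖D.ι (U t)‖ - ‖D.ι (V t)‖)]) t ht
    simp only [Function.comp_apply, one_mul] at h1
    have hNt := hN0 t ht
    have h2 : ∫ s in (0 : ℝ)..t, ‖D.ι (V s)‖ ^ 2 ≤ t * (B ^ 2 * M₁ * N t) :=
      integral_le_of_le (hVc.mono (Icc_subset_Icc_right ht.2)) (by positivity) (fun s hs =>
        (hV s ⟨hs.1, hs.2.trans ht.2⟩).trans
          (mul_le_mul_of_nonneg_left (hNmono s t hs.1 hs.2 ht.2) (by positivity)))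
        ⟨ht.1, le_rfl⟩
    have h3 : t * (B ^ 2 * M₁ * N t) ≤ T * (B ^ 2 * M₁ * N t) := by
      gcongr
      exact ht.2
    have h4 : ‖D.ι (U 0)‖ ^ 2 ≤ N t := by
      have := hgi t ht
      simp only [hN]
      linarith [sq_nonneg ‖D.S (U 0)‖, sq_nonneg ‖D.ι (V 0)‖]
    calc _ ≤ _ := h1
      _ ≤ Real.exp T * (N t + T * (B ^ 2 * M₁ * N t)) := by
          refine mul_le_mul (Real.exp_le_exp.2 ht.2) (by linarith) ?_ (Real.exp_pos _).le
          have : 0 ≤ ∫ s in (0 : ℝ)..t, ‖D.ι (V s)‖ ^ 2 :=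
            intervalIntegral.integral_nonneg ht.1 fun _ _ => by positivity
          positivity
      _ = _ := by ring
  have h5 := hbase t ht
  have h6 := hV t ht
  change _ ≤ _ * N t
  nlinarith [sq_nonneg ‖D.a t (D.ι (V t))‖]

end EvolutionData

theorem eqOn_Icc_of_hasDerivWithinAt {E : Type*} [NormedAddCommGroup E] [NormedSpace ℝ E] {T : ℝ}
    (hT : 0 < T) {f g f' : ℝ → E} (hf : ∀ t ∈ Icc 0 T, HasDerivWithinAt f (f' t) (Icc 0 T) t)
    (hg : ∀ t ∈ Icc 0 T, HasDerivWithinAt g (f' t) (Icc 0 T) t) (h0 : f 0 = g 0) :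
    EqOn f g (Icc 0 T) := by
  have hd : ∀ t ∈ Icc 0 T, HasDerivWithinAt (fun t => f t - g t) 0 (Icc 0 T) t := fun t ht =>
    ((hf t ht).sub (hg t ht)).congr_deriv (sub_self _)
  intro t ht
  have := constant_of_derivWithin_zero (fun t ht => (hd t ht).differentiableWithinAt)
    (fun t ht => (hd t (Ico_subset_Icc_self ht)).derivWithin
      (uniqueDiffOn_Icc hT t (Ico_subset_Icc_self ht))) t ht
  simpa [h0, sub_eq_zero] using this

/-! ### From strong abstract solutions to solutions of the beam equation. -/

namespace BeamEq

/-- A `C¹` function on `[0,T]` extends to a `C¹` function on the line. -/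
theorem exists_C1_extension {T : ℝ} (hT : 0 < T) {ζ : ℝ → ℝ} (hζ : ContDiffOn ℝ 1 ζ (Icc 0 T)) :
    ∃ Z Z' : ℝ → ℝ, (∀ t, HasDerivAt Z (Z' t) t) ∧ Continuous Z' ∧
      ∀ t ∈ Icc 0 T, Z t = ζ t ∧ Z' t = derivWithin ζ (Icc 0 T) t := by
  have hc := hζ.continuousOn_derivWithin (uniqueDiffOn_Icc hT) le_rfl
  set Z' : ℝ → ℝ := fun t => derivWithin ζ (Icc 0 T) (projIcc 0 T hT.le t) with hZ'
  have hZc : Continuous Z' := hc.comp_continuous (continuous_subtype_val.comp continuous_projIcc)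
    fun t => (projIcc 0 T hT.le t).2
  have hZ'eq : ∀ t ∈ Icc 0 T, Z' t = derivWithin ζ (Icc 0 T) t := fun t ht => by
    simp only [hZ', projIcc_of_mem hT.le ht]
  have hd : ∀ t, HasDerivAt (fun t => ζ 0 + ∫ s in (0 : ℝ)..t, Z' s) (Z' t) t := fun t =>
    (hZc.integral_hasStrictDerivAt 0 t).hasDerivAt.const_add _
  refine ⟨_, Z', hd, hZc, fun t ht => ⟨?_, hZ'eq t ht⟩⟩
  refine eqOn_Icc_of_hasDerivWithinAt hT (fun t _ => (hd t).hasDerivWithinAt) (fun t ht => ?_)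
    (by simp) ht
  rw [hZ'eq t ht]
  exact (hζ.differentiableOn one_ne_zero t ht).hasDerivWithinAt

section Solutions

variable {θ ζ Z Z' : ℝ → ℝ} {T : ℝ}

/-- Where `Z` and `Z'` agree with `ζ` and its derivative, the multipliers behind `m` and `b` are
pointwise `-G` and `F`. -/
theorem equation_iff (hθ : IsTestFunction θ) (hθ_nonneg : ∀ x, 0 ≤ θ x)
    (hZ : ∀ t, HasDerivAt Z (Z' t) t) (hZ' : Continuous Z') {t : ℝ} (hZt : Z t = ζ t)
    (hZt' : Z' t = derivWithin ζ (Icc 0 T) t) (w f v g : L2) :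
    w = (beamData hθ hθ_nonneg hZ hZ').m t v - (beamData hθ hθ_nonneg hZ hZ').b t f + g ↔
      ∀ᵐ x : ℝ, w x + F θ ζ t x * f x + G T θ ζ t x * v x = g x := by
  have key : ∀ᵐ x : ℝ, ((beamData hθ hθ_nonneg hZ hZ').m t v -
      (beamData hθ hθ_nonneg hZ hZ').b t f + g) x =
      -(G T θ ζ t x * v x) - F θ ζ t x * f x + g x := by
    have hm : (beamData hθ hθ_nonneg hZ hZ').m t v =
      Z' t • mulL (shift (hθ.deriv.div_one_add hθ hθ_nonneg) (Z t)) v := rfl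
    have hb : (beamData hθ hθ_nonneg hZ hZ').b t f =
      mulL (1 - shift (hθ.div_one_add hθ hθ_nonneg) (Z t)) f := rfl
    rw [hm, hb]
    set c := shift (hθ.deriv.div_one_add hθ hθ_nonneg) (Z t) with hc
    set d := 1 - shift (hθ.div_one_add hθ hθ_nonneg) (Z t) with hd
    filter_upwards [Lp.coeFn_add (Z' t • mulL c v - mulL d f) g,
      Lp.coeFn_sub (Z' t • mulL c v) (mulL d f), Lp.coeFn_smul (Z' t) (mulL c v),
      coeFn_mulL c v, coeFn_mulL d f] with x h1 h2 h3 h4 h5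
    have h6 := (one_add_pos hθ_nonneg (x - ζ t)).ne'
    rw [h1, Pi.add_apply, h2, Pi.sub_apply, h3, Pi.smul_apply, h4, h5, hc, hd,
      BoundedContinuousFunction.sub_apply, BoundedContinuousFunction.coe_one, Pi.one_apply,
      shift_apply, shift_apply, hZt, F, G, ← hZt', smul_eq_mul]
    field_simp
    ring
  constructor
  · rintro rfl
    filter_upwards [key] with x hx
    rw [hx]
    ring
  · intro h
    refine Lp.ext ?_
    filter_upwards [key, h] with x h1 h2
    rw [h1, ← h2]
    ring

/-- The inclusion `H⁴ ⊆ H²` as a continuous linear map. -/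
noncomputable def inclL : H 4 →L[ℝ] H 2 :=
  mkH (k := 2) ![wderivL 0, wderivL 1, wderivL 2] (fun u j => by
    fin_cases j
    · exact u.2 0
    · exact u.2 1)

/-- The second derivative `∂² : H⁴ → H²`. -/
noncomputable def derivTwoL : H 4 →L[ℝ] H 2 :=
  mkH (k := 2) ![wderivL 2, wderivL 3, wderivL 4] (fun u j => by
    fin_cases j
    · exact u.2 2
    · exact u.2 3)

theorem incl_eq (u : H 4) : incl (by norm_num : 2 ≤ 4) u = inclL u :=
  toL2_injective rfl

/-- An `H⁴` function from `u ∈ H²` with `-∂²u = q ∈ H²`. -/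
noncomputable def mkH4 (u q : H 2) (h : -wderiv 2 u = wderiv 0 q) : H 4 :=
  ⟨WithLp.toLp 2 ![wderiv 0 u, wderiv 1 u, wderiv 2 u, -wderiv 1 q, -wderiv 2 q], fun j => by
    have h1 : HasWeakDeriv (wderiv 0 q) (wderiv 1 q) := q.2 0
    have h2 : HasWeakDeriv (wderiv 1 q) (wderiv 2 q) := q.2 1
    have h3 : HasWeakDeriv (wderiv 2 u) (-wderiv 1 q) := by
      have := h1.neg
      rwa [← h, neg_neg] at this
    fin_cases j
    · exact u.2 0
    · exact u.2 1
    · exact h3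
    · exact h2.neg⟩

theorem continuous_mkH4 {u q : ℝ → H 2} (h : ∀ t, -wderiv 2 (u t) = wderiv 0 (q t))
    (hu : Continuous u) (hq : Continuous q) : Continuous fun t => mkH4 (u t) (q t) (h t) := by
  refine Continuous.subtype_mk ((PiLp.continuous_toLp 2 _).comp (continuous_pi fun j => ?_)) _
  have h1 := fun i => (wderivL (k := 2) i).continuous.comp hu
  have h2 := fun i => ((wderivL (k := 2) i).continuous.comp hq).neg
  fin_cases j
  exacts [h1 0, h1 1, h1 2, h2 1, h2 2]

theorem IsSolution.isStrong (hθ : IsTestFunction θ) (hθ_nonneg : ∀ x, 0 ≤ θ x)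
    (hZ : ∀ t, HasDerivAt Z (Z' t) t) (hZ' : Continuous Z') (hT : 0 < T)
    (hZt : ∀ t ∈ Icc 0 T, Z t = ζ t ∧ Z' t = derivWithin ζ (Icc 0 T) t)
    {u₀ : H 4} {u₁ : H 2} {g : ℝ → H 2} {u : ℝ → H 4} (h : IsSolution T θ ζ u₀ u₁ g u) :
    ∃ V, (∀ t ∈ Icc 0 T, wderivL 0 (V t) = dt T u t) ∧
      (beamData hθ hθ_nonneg hZ hZ').IsStrong T g (fun t => inclL (u t)) V
        (fun t => -derivTwoL (u t)) := by
  have hU := uniqueDiffOn_Icc hT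
  obtain ⟨-, h1, h2⟩ := h.mem
  simp only [incl_eq] at h1
  set V : ℝ → H 2 := fun t => derivWithin (fun t => inclL (u t)) (Icc 0 T) t with hV
  have hd : ∀ t ∈ Icc 0 T, HasDerivWithinAt (fun t => inclL (u t)) (V t) (Icc 0 T) t :=
    fun t ht => (h1.differentiableOn one_ne_zero t ht).hasDerivWithinAt
  have hVdt : ∀ t ∈ Icc 0 T, wderivL 0 (V t) = dt T u t := by
    intro t ht
    exact (((wderivL (k := 2) 0).hasFDerivAt.comp_hasDerivWithinAt t (hd t ht)).derivWithin
      (hU t ht)).symm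
  refine ⟨V, hVdt, hd, fun t ht => ?_, fun t ht => rfl⟩
  have hdt : HasDerivWithinAt (dt T u) (dtt T u t) (Icc 0 T) t := by
    have h3 : ContDiffOn ℝ 1 (dt T u) (Icc 0 T) := h2.derivWithin hU (by norm_num)
    exact (h3.differentiableOn one_ne_zero t ht).hasDerivWithinAt
  refine (hdt.congr hVdt (hVdt t ht)).congr_deriv ?_
  have heq := (equation_iff hθ hθ_nonneg hZ hZ' (hZt t ht).1 (hZt t ht).2 (dtt T u t)
    (wderiv 4 (u t)) (dt T u t) (toL2 (g t))).2 (h.eqn t ht)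
  rw [heq, ← hVdt t ht]
  have e : (beamData hθ hθ_nonneg hZ hZ').S (-derivTwoL (u t)) = wderiv 4 (u t) := by
    rw [map_neg]
    exact neg_neg _
  rw [e]
  rfl

theorem exists_isSolution (hθ : IsTestFunction θ) (hθ_nonneg : ∀ x, 0 ≤ θ x)
    (hZ : ∀ t, HasDerivAt Z (Z' t) t) (hZ' : Continuous Z') (hT : 0 < T)
    (hZt : ∀ t ∈ Icc 0 T, Z t = ζ t ∧ Z' t = derivWithin ζ (Icc 0 T) t)
    (u₀ : H 4) (u₁ : H 2) {g : ℝ → H 2} (hg : ContinuousOn g (Icc 0 T)) :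
    ∃ u, IsSolution T θ ζ u₀ u₁ g u := by
  have hU := uniqueDiffOn_Icc hT
  set D := beamData hθ hθ_nonneg hZ hZ' with hD
  set P : ℝ → ℝ := fun t => projIcc 0 T hT.le t with hP
  have hPm : ∀ t, P t ∈ Icc 0 T := fun t => (projIcc 0 T hT.le t).2
  have hPc : Continuous P := continuous_subtype_val.comp continuous_projIcc
  have hPid : ∀ t ∈ Icc 0 T, P t = t := fun t ht => by simp [hP, projIcc_of_mem hT.le ht]
  have h0 : (0 : ℝ) ∈ Icc 0 T := left_mem_Icc.2 hT.le
  -- The source is extended by clamping time to `[0,T]`, and `Q` starts from `S u₀ = -∂²u₀`.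
  obtain ⟨V, Q, hVc, hQc, hV0, hQ0, hVQ⟩ := D.exists_strong_solution hT.le
    (hg.comp_continuous hPc hPm) u₁ (-derivTwoL u₀)
  set U : ℝ → H 2 := fun t => inclL u₀ + ∫ s in (0 : ℝ)..t, V s with hUdef
  have hUd : ∀ t, HasDerivAt U (V t) t := fun t =>
    (hVc.integral_hasStrictDerivAt 0 t).hasDerivAt.const_add _
  have hUc : Continuous U := continuous_iff_continuousAt.2 fun t => (hUd t).continuousAt
  have hU0 : U 0 = inclL u₀ := by simp [hUdef]
  -- Both sides have derivative `S V` and the same initial value.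
  have hgraph : ∀ t ∈ Icc 0 T, D.S (U t) = D.ι (Q t) := by
    refine eqOn_Icc_of_hasDerivWithinAt hT
      (fun t _ => D.S.hasFDerivAt.comp_hasDerivWithinAt t (hUd t).hasDerivWithinAt)
      (fun t ht => (hVQ t ht).2) ?_
    rw [hU0, hQ0]
    rfl
  set u : ℝ → H 4 := fun t => mkH4 (U (P t)) (Q (P t)) (hgraph _ (hPm t)) with hu
  have huc : Continuous u := continuous_mkH4 _ (hUc.comp hPc) (hQc.comp hPc)
  have huL : ∀ t ∈ Icc 0 T, inclL (u t) = U t := fun t ht => by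
    refine toL2_injective ?_
    change wderiv 0 (U (P t)) = wderiv 0 (U t)
    rw [hPid t ht]
  have hu2 : ∀ t ∈ Icc 0 T, toL2 (u t) = wderivL 0 (U t) := fun t ht => by
    rw [← huL t ht]; rfl
  have hu4 : ∀ t ∈ Icc 0 T, D.S (Q t) = wderiv 4 (u t) := fun t ht => by
    change -wderiv 2 (Q t) = -wderiv 2 (Q (P t))
    rw [hPid t ht]
  have hd1 : ∀ t ∈ Icc 0 T, HasDerivWithinAt (fun t => toL2 (u t)) (wderivL 0 (V t))
      (Icc 0 T) t := fun t ht =>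
    ((wderivL (k := 2) 0).hasFDerivAt.comp_hasDerivWithinAt t
      (hUd t).hasDerivWithinAt).congr hu2 (hu2 t ht)
  have hdt : ∀ t ∈ Icc 0 T, dt T u t = wderivL 0 (V t) := fun t ht =>
    (hd1 t ht).derivWithin (hU t ht)
  set A : ℝ → L2 := fun t => D.m t (D.ι (V t)) - D.b t (D.S (Q t)) + D.ι (g (P t)) with hA
  have hAc : Continuous A :=
    ((D.m_cont.clm_apply (D.ι.continuous.comp hVc)).sub
      (D.b_cont.clm_apply (D.S.continuous.comp hQc))).add
      (D.ι.continuous.comp (hg.comp_continuous hPc hPm))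
  have hd2 : ∀ t ∈ Icc 0 T, HasDerivWithinAt (dt T u) (A t) (Icc 0 T) t := fun t ht =>
    ((hVQ t ht).1).congr hdt (hdt t ht)
  have hdtt : ∀ t ∈ Icc 0 T, dtt T u t = A t := fun t ht => (hd2 t ht).derivWithin (hU t ht)
  have hC1 : ContDiffOn ℝ 1 (dt T u) (Icc 0 T) := by
    rw [contDiffOn_one_iff_derivWithin hU]
    exact ⟨fun t ht => (hd2 t ht).differentiableWithinAt, hAc.continuousOn.congr hdtt⟩
  refine ⟨u, ⟨huc.continuousOn, ?_, ?_⟩, fun t ht => ?_, ?_, ?_⟩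
  · simp only [incl_eq]
    refine ContDiffOn.congr ?_ huL
    refine ContDiff.contDiffOn (contDiff_one_iff_deriv.2
      ⟨fun t => (hUd t).differentiableAt, ?_⟩)
    rwa [show deriv U = V from funext fun t => (hUd t).deriv]
  · have h2 : (2 : WithTop ℕ∞) = 1 + 1 := by norm_num
    rw [h2, contDiffOn_succ_iff_derivWithin hU]
    exact ⟨fun t ht => (hd1 t ht).differentiableWithinAt, by simp, hC1⟩
  · rw [← equation_iff hθ hθ_nonneg hZ hZ' (hZt t ht).1 (hZt t ht).2, hdtt t ht, ← hu4 t ht,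
      hdt t ht]
    simp only [hA, hPid t ht]
    rfl
  · refine toL2_injective ?_
    rw [hu2 0 h0, hU0]
    rfl
  · rw [hdt 0 h0, hV0]
    rfl

/-- Integration by parts gives `‖y'‖² = -⟪y'', y⟫`, so the two extreme derivatives control the full
norm. -/
theorem norm_sq_le_H2 (y : H 2) : ‖y‖ ^ 2 ≤ 2 * (‖wderiv 2 y‖ ^ 2 + ‖wderiv 0 y‖ ^ 2) := by
  have h1 := inner_wderiv_two y y
  rw [real_inner_self_eq_norm_sq] at h1
  have h2 := abs_le.1 (abs_real_inner_le_norm (wderiv 2 y) (wderiv 0 y))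
  rw [norm_sq_H, Fin.sum_univ_three]
  nlinarith [sq_nonneg (‖wderiv 2 y‖ - ‖wderiv 0 y‖)]

theorem sq_norms_le_H2 (y : H 2) : ‖wderiv 2 y‖ ^ 2 + ‖wderiv 0 y‖ ^ 2 ≤ ‖y‖ ^ 2 := by
  rw [norm_sq_H, Fin.sum_univ_three]
  linarith [sq_nonneg ‖wderiv 1 y‖]

end Solutions

end BeamEq

/-! ### The main theorem. -/

open BeamEq

theorem proposition1 (θ : ℝ → ℝ) (hθ : BeamEq.IsTestFunction θ)
    (hθ_even : ∀ x, θ (-x) = θ x) (hθ_nonneg : ∀ x, 0 ≤ θ x) (hθ_int : ∫ x, θ x = 1)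
    (T : ℝ) (hT : 0 < T) (ζ : ℝ → ℝ) (hζ : ContDiffOn ℝ 2 ζ (Icc 0 T)) :
    ∃ C : ℝ, 0 < C ∧
      ∀ (u₀ : BeamEq.H 4) (u₁ : BeamEq.H 2) (g : ℝ → BeamEq.H 2), g ∈ BeamEq.E2 T →
        ∃ u : ℝ → BeamEq.H 4, BeamEq.IsSolution T θ ζ u₀ u₁ g u ∧
          (∀ v : ℝ → BeamEq.H 4, BeamEq.IsSolution T θ ζ u₀ u₁ g v → EqOn v u (Icc 0 T)) ∧
          ∀ t ∈ Icc 0 T,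
            ‖BeamEq.incl (by norm_num : 2 ≤ 4) (u t)‖ + ‖BeamEq.dt T u t‖ ≤
              C * (‖BeamEq.incl (by norm_num : 2 ≤ 4) u₀‖ + ‖BeamEq.toL2 u₁‖ + BeamEq.normL2L2 t g) := by
  obtain ⟨Z, Z', hZ, hZ', hZt⟩ := exists_C1_extension hT (hζ.of_le (by norm_num))
  set D := beamData hθ hθ_nonneg hZ hZ' with hD
  obtain ⟨M, hM0, hM⟩ := EvolutionData.IsStrong.estimate D hT.le
  -- The squared estimate gives `(x + y)² ≤ 4 M N²`, where `N` is the sum of the data norms. Since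
  -- `M ≤ (2 M + 1)²`, this constant avoids a square root.
  refine ⟨2 * (2 * M + 1), by positivity, fun u₀ u₁ g hg => ?_⟩
  obtain ⟨u, hu⟩ := exists_isSolution hθ hθ_nonneg hZ hZ' hT hZt u₀ u₁ hg
  obtain ⟨V, hV, hs⟩ := hu.isStrong hθ hθ_nonneg hZ hZ' hT hZt
  have h0 : (0 : ℝ) ∈ Icc 0 T := left_mem_Icc.2 hT.le
  refine ⟨u, hu, fun v hv t ht => ?_, fun t ht => ?_⟩
  · obtain ⟨W, hW, hs'⟩ := hv.isStrong hθ hθ_nonneg hZ hZ' hT hZt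
    -- Uniqueness: the difference of two solutions is a strong solution with zero source and zero
    -- data, so the estimate annihilates it.
    have h := hM _ _ _ _ (by simpa using continuousOn_const) (hs'.sub hs) t ht
    have hWV : D.ι (W 0 - V 0) = 0 := by
      change wderivL 0 (W 0 - V 0) = 0
      rw [map_sub, hW 0 h0, hV 0 h0, hv.init_dt, hu.init_dt, sub_self]
    simp only [hv.init, hu.init, hWV, sub_self, map_zero, norm_zero, ne_eq, OfNat.ofNat_ne_zero,
      not_false_eq_true, zero_pow, add_zero, intervalIntegral.integral_zero, mul_zero] at h
    have h1 : ‖D.ι (inclL (v t) - inclL (u t))‖ ^ 2 = 0 := by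
      have := sq_nonneg ‖D.S (inclL (v t) - inclL (u t))‖
      have := sq_nonneg ‖D.ι (inclL (v t) - inclL (u t))‖
      have := sq_nonneg ‖D.ι (W t - V t)‖
      linarith
    rw [sq_eq_zero_iff, norm_eq_zero, map_sub, sub_eq_zero] at h1
    exact toL2_injective h1
  · have h := hM _ _ _ _ hg hs t ht
    have e1 : D.ι (V t) = dt T u t := hV t ht
    have e2 : D.ι (V 0) = toL2 u₁ := (hV 0 h0).trans hu.init_dt
    rw [e1, e2, hu.init] at h
    have e3 : ∀ y : H 2, ‖D.S y‖ = ‖wderiv 2 y‖ := fun y => norm_neg (wderiv 2 y)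
    have e4 : ∀ y : H 2, D.ι y = wderiv 0 y := fun y => rfl
    rw [e3, e3, e4, e4] at h
    have e5 := norm_sq_le_H2 (inclL (u t))
    have e6 := sq_norms_le_H2 (inclL u₀)
    rw [incl_eq, incl_eq]
    have hI : 0 ≤ ∫ s in (0 : ℝ)..t, ‖toL2 (g s)‖ ^ 2 :=
      intervalIntegral.integral_nonneg ht.1 fun _ _ => by positivity
    have e7 : normL2L2 t g ^ 2 = ∫ s in (0 : ℝ)..t, ‖toL2 (g s)‖ ^ 2 := Real.sq_sqrt hI
    have e8 : ∫ s in (0 : ℝ)..t, ‖D.ι (g s)‖ ^ 2 = normL2L2 t g ^ 2 := e7.symm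
    rw [e8] at h
    have e9 : 0 ≤ normL2L2 t g := Real.sqrt_nonneg _
    generalize normL2L2 t g = n at *
    have p1 := norm_nonneg (inclL u₀)
    have p2 := norm_nonneg (toL2 u₁)
    have p3 := norm_nonneg (inclL (u t))
    have p4 := norm_nonneg (dt T u t)
    generalize ‖inclL u₀‖ = a at *
    generalize ‖toL2 u₁‖ = b at *
    generalize ‖inclL (u t)‖ = x at *
    generalize ‖dt T u t‖ = y at *
    have q1 : M * (‖wderiv 2 (inclL u₀)‖ ^ 2 + ‖wderiv 0 (inclL u₀)‖ ^ 2 + b ^ 2 + n ^ 2) ≤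
        M * (a + b + n) ^ 2 := by
      refine mul_le_mul_of_nonneg_left ?_ hM0
      nlinarith [mul_nonneg p1 p2, mul_nonneg p1 e9, mul_nonneg p2 e9]
    have q2 : x ^ 2 + y ^ 2 ≤ 2 * (M * (a + b + n) ^ 2) := by
      nlinarith [sq_nonneg y]
    refine le_of_sq_le_sq ?_ (by positivity)
    have q3 : (x + y) ^ 2 ≤ 4 * (M * (a + b + n) ^ 2) := by nlinarith [sq_nonneg (x - y)]
    have q4 : 0 ≤ M * (a + b + n) ^ 2 := by positivity
    have q5 : 0 ≤ M ^ 2 * (a + b + n) ^ 2 := by positivity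
    nlinarith [sq_nonneg (a + b + n)]
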